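/- Let $\kappa\ge 0$ and $\lambda_i=i^{-\kappa}$ for $i\ge 1$. Let $f=e^{-g}$ be a probability density on $\mathbb{R}$, where $g$ is infinitely differentiable with derivatives of all orders of at most polynomial growth, and all moments of $f$ are finite. For $n\ge 1$ let $\tilde\pi_n$ be the law on $\mathbb{R}^n$ with Lebesgue density $\tilde\pi_n(x)=\prod_{i=1}^n \lambda_i^{-1}f(x_i/\lambda_i)$, let $\phi_n:\mathbb{R}^n\to\mathbb{R}$ be measurable, and suppose that $d\pi_n=e^{-\phi_n}\,d\tilde\pi_n$ defines a probability measure, with Lebesgue density $\pi_n(x)=e^{-\phi_n(x)}\tilde\pi_n(x)$. Consider the Metropolis–Hastings algorithms with target $\pi_n$ and one of the proposals $$\text{RWM: } y=x+\sigma_nZ,\qquad \text{SLA: } y=x+\tfrac{\sigma_n^2}{2}\nabla\log\tilde\pi_n(x)+\sigma_nZ,\qquad Z\sim\mathcal N(0,I_n),$$ with proposal transition density $q_n(x,y)$ and acceptance probability $a_n(x,y)=1\wedge\frac{\pi_n(y)q_n(y,x)}{\pi_n(x)q_n(x,y)}$ (equal to $0$ if the denominator vanishes). Let $E[a_n(x,y)]$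 be the mean acceptance probability when $x\sim\pi_n$ and $y$ is proposed from $x$ with $Z$ independent of $x$. Assume $\sigma_n>0$ and $\sigma_n^2=l^2n^{-\rho}$ with $l,\rho>0$. Write $|x|_s=\bigl(\sum_{i=1}^n i^{2s}x_i^2\bigr)^{1/2}$. Assume that, after modifying each $\phi_n$ on a $\tilde\pi_n$-null set if necessary: (a) there is $M\in\mathbb{R}$ such that, for all sufficiently large $n$, $\phi_n(x)\ge M$ for all $x\in\mathbb{R}^n$; (b) there are a locally bounded function $\delta:[0,\infty)^2\to[0,\infty)$, constants $C>0$, $p>0$, and $s,s',s''<\kappa-\tfrac12$ such that, for all sufficiently large $n$ and all $x,y\in\mathbb{R}^n$, $|\phi_n(y)-\phi_n(x)|\le\delta(|x|_s,|y|_s)\,|y-x|_{s'}$ and $|\phi_n(x)|\le C(1+|x|_{s''}^p)$. Put $I=1$ for RWM and $I=1/3$ for SLA. Then, for each of the two algorithms, as $n\to\infty$: (i) if $\rho=2\kappa+I$, then $E[a_n(x,y)]\to a(l)$, where, with $\Phi$ the distribution function of $\mathcal N(0,1)$, $$a^{\mathrm{RWM}}(l)=2\Phi\Bigl(-\tfrac{l}{2}\sqrt{\tfrac{K^{\mathrm{RWM}}}{1+2\kappa}}\Bigr),\qquad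 a^{\mathrm{SLA}}(l)=2\Phi\Bigl(-\tfrac{l^3}{2}\sqrt{\tfrac{K^{\mathrm{SLA}}}{1+6\kappa}}\Bigr),$$ $$K^{\mathrm{RWM}}=\int g'(u)^2f(u)\,du>0,\qquad K^{\mathrm{SLA}}=\tfrac1{48}\int\bigl(3g''(u)^3+5g^{(3)}(u)^2\bigr)f(u)\,du>0;$$ (ii) if $\rho>2\kappa+I$, then $E[a_n(x,y)]\to 1$; (iii) if $2\kappa<\rho<2\kappa+I$, then $n^pE[a_n(x,y)]\to 0$ for every $p\ge 0$. -/

import Mathlib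

open MeasureTheory ProbabilityTheory Filter Topology
open scoped ContDiff

namespace LocalMCMC

noncomputable section

/-- The state space `ℝⁿ` with its Euclidean structure. Coordinate `i : Fin n` stands for the
`(i + 1)`-st coordinate of the usual numbering `1, …, n`. -/
abbrev State (n : ℕ) : Type := EuclideanSpace ℝ (Fin n)

/-- The two algorithms: random-walk Metropolis and the simplified Langevin algorithm. -/
inductive Algorithm where
  | RWM : Algorithm
  | SLA : Algorithm

/-- The scale `λ_i = i ^ (-κ)`, at the 0-based index `i`. -/
def scale (κ : ℝ) {n : ℕ} (i : Fin n) : ℝ := ((i : ℝ) + 1) ^ (-κ)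

/-- The Lebesgue density `∏ i, (1 / λ_i) f (x_i / λ_i)`, `f = exp (-g)`, of the reference law. -/
def refDensity (κ : ℝ) (g : ℝ → ℝ) {n : ℕ} (x : State n) : ℝ :=
  ∏ i : Fin n, 1 / scale κ i * Real.exp (-g (x i / scale κ i))

/-- The reference product law. -/
def refMeasure (κ : ℝ) (g : ℝ → ℝ) (n : ℕ) : Measure (State n) :=
  (volume : Measure (State n)).withDensity fun x => ENNReal.ofReal (refDensity κ g x)

/-- The target law: the change of measure `exp (-φ)` with respect to the reference law. -/
def targetMeasure (κ : ℝ) (g : ℝ → ℝ) {n : ℕ} (φ : State n → ℝ) : Measure (State n) :=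
  (refMeasure κ g n).withDensity fun x => ENNReal.ofReal (Real.exp (-φ x))

/-- The Lebesgue density of the target law. -/
def targetDensity (κ : ℝ) (g : ℝ → ℝ) {n : ℕ} (φ : State n → ℝ) (x : State n) : ℝ :=
  Real.exp (-φ x) * refDensity κ g x

/-- The mean of the proposal from `x`: `x` for RWM, and `x + (σ² / 2) ∇ log (refDensity) (x)` for
SLA. -/
def proposalMean (A : Algorithm) (κ : ℝ) (g : ℝ → ℝ) (σ : ℝ) {n : ℕ} (x : State n) : State n :=
  match A with
  | .RWM => x
  | .SLA => x + (σ ^ 2 / 2) • gradient (fun y : State n => Real.log (refDensity κ g y)) x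

/-- The proposal `y` made from `x` with the noise `z`. -/
def proposal (A : Algorithm) (κ : ℝ) (g : ℝ → ℝ) (σ : ℝ) {n : ℕ} (x z : State n) : State n :=
  proposalMean A κ g σ x + σ • z

/-- The transition density `q(x, y)` of the proposal: the density at `y` of the normal law with mean
`proposalMean A κ g σ x` and covariance `σ² I`. -/
def proposalDensity (A : Algorithm) (κ : ℝ) (g : ℝ → ℝ) (σ : ℝ) {n : ℕ} (x y : State n) : ℝ :=
  (Real.sqrt (2 * Real.pi * σ ^ 2))⁻¹ ^ n *
    Real.exp (-‖y - proposalMean A κ g σ x‖ ^ 2 / (2 * σ ^ 2))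

open Classical in
/-- The Metropolis–Hastings acceptance probability. -/
def acceptProb (A : Algorithm) (κ : ℝ) (g : ℝ → ℝ) (σ : ℝ) {n : ℕ} (φ : State n → ℝ)
    (x y : State n) : ℝ :=
  if 0 < targetDensity κ g φ x * proposalDensity A κ g σ x y then
    min 1 (targetDensity κ g φ y * proposalDensity A κ g σ y x /
      (targetDensity κ g φ x * proposalDensity A κ g σ x y))
  else 0

/-- The mean acceptance probability in stationarity: `x` has the target law, `z` is an independent
standard normal vector, and `y` is the proposal made from `x` with the noise `z`. -/
def meanAcceptProb (A : Algorithm) (κ : ℝ) (g : ℝ → ℝ) (σ : ℝ) {n : ℕ} (φ : State n → ℝ) : ℝ :=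
  ∫ w : State n × State n, acceptProb A κ g σ φ w.1 (proposal A κ g σ w.1 w.2)
    ∂((targetMeasure κ g φ).prod (stdGaussian (State n)))

/-- `f = exp (-g)` is a probability density, `g` is smooth with all derivatives of at most
polynomial growth, and all moments of `f` are finite. -/
structure RegularPotential (g : ℝ → ℝ) : Prop where
  smooth : ContDiff ℝ ∞ g
  polyGrowth : ∀ k : ℕ, ∃ (C : ℝ) (m : ℕ), ∀ u : ℝ, |iteratedDeriv k g u| ≤ C * (1 + |u| ^ m)
  moments : ∀ k : ℕ, Integrable fun u : ℝ => |u| ^ k * Real.exp (-g u)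
  normalized : ∫ u : ℝ, Real.exp (-g u) = 1

/-- The weighted norm `|x|_s = (∑ i, i ^ (2 s) x_i ²) ^ (1 / 2)`, with 1-based weights. -/
def sNorm (s : ℝ) {n : ℕ} (x : State n) : ℝ :=
  Real.sqrt (∑ i : Fin n, ((i : ℝ) + 1) ^ (2 * s) * x i ^ 2)

/-- For all large `n`, the functions `φ_n` have a common lower bound. -/
def BoundedBelow (φ : (n : ℕ) → State n → ℝ) : Prop :=
  ∃ M : ℝ, ∀ᶠ n : ℕ in atTop, ∀ x : State n, M ≤ φ n x

/-- A nonnegative function on `[0, ∞)²` that is bounded on bounded sets, which on this locally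
compact space is the same as locally bounded. Values outside `[0, ∞)²` are irrelevant. -/
def LocallyBoundedOnQuadrant (δ : ℝ → ℝ → ℝ) : Prop :=
  (∀ a b : ℝ, 0 ≤ a → 0 ≤ b → 0 ≤ δ a b) ∧
    ∀ R : ℝ, ∃ B : ℝ, ∀ a ∈ Set.Icc 0 R, ∀ b ∈ Set.Icc 0 R, δ a b ≤ B

/-- The local Lipschitz and polynomial growth condition on the family `φ_n`; the function `δ`, the
constants and the exponents do not depend on `n`. -/
def LocalLipschitzGrowth (κ : ℝ) (φ : (n : ℕ) → State n → ℝ) : Prop :=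
  ∃ (δ : ℝ → ℝ → ℝ) (C p s s' s'' : ℝ), LocallyBoundedOnQuadrant δ ∧ 0 < C ∧ 0 < p ∧
    s < κ - 1 / 2 ∧ s' < κ - 1 / 2 ∧ s'' < κ - 1 / 2 ∧
    ∀ᶠ n : ℕ in atTop,
      (∀ x y : State n, |φ n y - φ n x| ≤ δ (sNorm s x) (sNorm s y) * sNorm s' (y - x)) ∧
      (∀ x : State n, |φ n x| ≤ C * (1 + sNorm s'' x ^ p))

/-- The index `I`: `1` for RWM and `1 / 3` for SLA. -/
def scalingIndex : Algorithm → ℝ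
  | .RWM => 1
  | .SLA => 1 / 3

/-- The constant `K`: `E_f[g'²]` for RWM and `E_f[3 g''³ + 5 g'''²] / 48` for SLA. -/
def limitConst (A : Algorithm) (g : ℝ → ℝ) : ℝ :=
  match A with
  | .RWM => ∫ u : ℝ, (deriv g u) ^ 2 * Real.exp (-g u)
  | .SLA => (∫ u : ℝ, (3 * (iteratedDeriv 2 g u) ^ 3 + 5 * (iteratedDeriv 3 g u) ^ 2) *
      Real.exp (-g u)) / 48

/-- The limiting acceptance probability: `2 Φ(-(l / 2) √(K / (1 + 2 κ)))` for RWM and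
`2 Φ(-(l³ / 2) √(K / (1 + 6 κ)))` for SLA, with `Φ` the standard normal distribution function. -/
def limitAccept (A : Algorithm) (κ : ℝ) (g : ℝ → ℝ) (l : ℝ) : ℝ :=
  match A with
  | .RWM => 2 * cdf (gaussianReal 0 1) (-(l / 2) * Real.sqrt (limitConst .RWM g / (1 + 2 * κ)))
  | .SLA => 2 * cdf (gaussianReal 0 1) (-(l ^ 3 / 2) * Real.sqrt (limitConst .SLA g / (1 + 6 * κ)))

end

end LocalMCMC

/-! In the coordinates `u i = x i / λ i` the reference law is i.i.d. with density `f`, and the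
proposal acts on each coordinate separately with step `ε i = σ / λ i`. For the reference law the log
acceptance ratio is therefore a sum of independent terms `R i`. Taylor expansion
(`logRatio_sub_leadCoeff`) gives `R = ε ^ k * L + O(ε ^ (k + 1))`, with `k = 1` for RWM and `k = 3`
for SLA. Given `u`, the polynomial `L` in the noise is centred, and its variance averages to `K`
(`integral_leadVar`). When `ρ > 2 κ` all steps tend to `0` uniformly, and everything is governed by
`S = ∑ i, ε i ^ (2 k)`. This sum behaves like `n ^ (2 κ k + 1 - ρ k)` up to a constant, which puts
the threshold at `ρ = 2 κ + 1 / k`, that is at `I = 1 / k`.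

The mean of `R` is needed to order `ε ^ (2 k)`, but no expansion that far is made. Exchanging start
and proposal preserves Lebesgue measure and multiplies the density by `exp R`, so `E[H(R) exp R] =
E[H(-R)]` for every `H` (`integral_mul_exp_logRatio`). A suitable `H` yields `E R = -E R² / 2` up to
a cubic error, so the total log ratio is the leading sum shifted by `-K S / 2`, up to a vanishing
error in `L¹` (`integral_abs_logRatioSum_sub_le`).

For (i) and (ii), let `S → θ`. Conditionally on the start, the leading sum has a characteristic
function close, in mean, to that of `N(0, K θ)` (`integral_norm_condCharFun_sub_le`). The start
under the target law has density `exp (-φ) ≤ exp (-M)` with respect to the reference law, and the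
noise is independent of it, so an error small in reference mean stays small under the target. The
difference `φ x - φ y` vanishes in probability because the step is small in the weighted norms while
the start stays bounded in them (`tendsto_integral_min_potentialDiff`). It remains to integrate `min
1 (exp ·)` against `N(-K θ / 2, K θ)`, which gives `2 Φ(-√(K θ) / 2)`. Case (ii) has `θ = 0`.

For (iii), `min 1 (exp a) ≤ exp (a / 2)` bounds the acceptance by a product of Hellinger affinities,
each at most `1 - c ε ^ (2 k)` up to higher order (`integral_exp_half_logRatio_le`). The product is
at most `exp (-c' S)`, where `S` grows like a positive power of `n`. -/

namespace LocalMCMC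

/-! ### Calculus of orders in the step size, uniform up to polynomial weights. -/

/-- `F ε u z` is of order `ε ^ k`, up to a polynomial factor in `u` and `z`, for `0 < ε ≤ 1`. -/
def PolyO (k : ℕ) (F : ℝ → ℝ → ℝ → ℝ) : Prop :=
  ∃ (C : ℝ) (N : ℕ), 0 ≤ C ∧ ∀ ε : ℝ, 0 < ε → ε ≤ 1 → ∀ u z : ℝ,
    |F ε u z| ≤ C * ε ^ k * (1 + |u| + |z|) ^ N

lemma one_le_weight (u z : ℝ) : 1 ≤ 1 + |u| + |z| := by
  linarith [abs_nonneg u, abs_nonneg z]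

namespace PolyO

variable {k j : ℕ} {F G : ℝ → ℝ → ℝ → ℝ}

lemma of_abs_le (hG : PolyO k G)
    (h : ∀ ε : ℝ, 0 < ε → ε ≤ 1 → ∀ u z : ℝ, |F ε u z| ≤ |G ε u z|) : PolyO k F := by
  obtain ⟨C, N, hC, hb⟩ := hG
  exact ⟨C, N, hC, fun ε h0 h1 u z => (h ε h0 h1 u z).trans (hb ε h0 h1 u z)⟩

lemma congr (hG : PolyO k G)
    (h : ∀ ε : ℝ, 0 < ε → ε ≤ 1 → ∀ u z : ℝ, F ε u z = G ε u z) : PolyO k F :=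
  hG.of_abs_le fun ε h0 h1 u z => by rw [h ε h0 h1 u z]

lemma add (hF : PolyO k F) (hG : PolyO k G) : PolyO k (fun ε u z => F ε u z + G ε u z) := by
  obtain ⟨C, N, hC, hb⟩ := hF
  obtain ⟨D, M, hD, hd⟩ := hG
  refine ⟨C + D, N + M, by positivity, fun ε h0 h1 u z => ?_⟩
  have hw := one_le_weight u z
  have e1 : (1 + |u| + |z|) ^ N ≤ (1 + |u| + |z|) ^ (N + M) :=
    pow_le_pow_right₀ hw (by omega)
  have e2 : (1 + |u| + |z|) ^ M ≤ (1 + |u| + |z|) ^ (N + M) :=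
    pow_le_pow_right₀ hw (by omega)
  have hk : 0 ≤ ε ^ k := by positivity
  calc |F ε u z + G ε u z| ≤ |F ε u z| + |G ε u z| := abs_add_le _ _
    _ ≤ C * ε ^ k * (1 + |u| + |z|) ^ N + D * ε ^ k * (1 + |u| + |z|) ^ M :=
        add_le_add (hb ε h0 h1 u z) (hd ε h0 h1 u z)
    _ ≤ C * ε ^ k * (1 + |u| + |z|) ^ (N + M) + D * ε ^ k * (1 + |u| + |z|) ^ (N + M) := by
        gcongr
    _ = _ := by ring

lemma mul (hF : PolyO k F) (hG : PolyO j G) :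
    PolyO (k + j) (fun ε u z => F ε u z * G ε u z) := by
  obtain ⟨C, N, hC, hb⟩ := hF
  obtain ⟨D, M, hD, hd⟩ := hG
  refine ⟨C * D, N + M, by positivity, fun ε h0 h1 u z => ?_⟩
  rw [abs_mul]
  calc |F ε u z| * |G ε u z|
      ≤ (C * ε ^ k * (1 + |u| + |z|) ^ N) * (D * ε ^ j * (1 + |u| + |z|) ^ M) :=
        mul_le_mul (hb ε h0 h1 u z) (hd ε h0 h1 u z) (abs_nonneg _) (by positivity)
    _ = _ := by ring

lemma mono (hF : PolyO k F) (hjk : j ≤ k) : PolyO j F := by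
  obtain ⟨C, N, hC, hb⟩ := hF
  refine ⟨C, N, hC, fun ε h0 h1 u z => (hb ε h0 h1 u z).trans ?_⟩
  have : ε ^ k ≤ ε ^ j := pow_le_pow_of_le_one h0.le h1 hjk
  gcongr

lemma const (a : ℝ) : PolyO 0 (fun _ _ _ => a) :=
  ⟨|a|, 0, abs_nonneg _, fun _ _ _ _ _ => by simp⟩

lemma eps : PolyO 1 (fun ε _ _ => ε) :=
  ⟨1, 0, zero_le_one, fun ε h0 _ _ _ => by simp [abs_of_pos h0]⟩

lemma fst : PolyO 0 (fun _ u _ => u) :=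
  ⟨1, 1, zero_le_one, fun ε _ _ u z => by simp; linarith [abs_nonneg z]⟩

lemma snd : PolyO 0 (fun _ _ z => z) :=
  ⟨1, 1, zero_le_one, fun ε _ _ u z => by simp; linarith [abs_nonneg u]⟩

lemma const_mul (a : ℝ) (hF : PolyO k F) : PolyO k (fun ε u z => a * F ε u z) := by
  simpa using (const a).mul hF

lemma neg (hF : PolyO k F) : PolyO k (fun ε u z => -F ε u z) :=
  hF.of_abs_le fun ε _ _ u z => by rw [abs_neg]

lemma sub (hF : PolyO k F) (hG : PolyO k G) : PolyO k (fun ε u z => F ε u z - G ε u z) := by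
  simpa [sub_eq_add_neg] using hF.add hG.neg

lemma pow (hF : PolyO k F) (m : ℕ) : PolyO (k * m) (fun ε u z => F ε u z ^ m) := by
  induction m with
  | zero => simpa using const 1
  | succ m ih => simpa [pow_succ, Nat.mul_succ] using ih.mul hF

lemma abs (hF : PolyO k F) : PolyO k (fun ε u z => |F ε u z|) :=
  hF.of_abs_le fun ε _ _ u z => by rw [abs_abs]

lemma eps_pow (m : ℕ) : PolyO m (fun ε _ _ => ε ^ m) := by
  simpa using eps.pow m

end PolyO

/-! ### Taylor remainders with polynomial growth. -/

/-- At most polynomial growth on the line. -/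
def PolyGrowth (G : ℝ → ℝ) : Prop :=
  ∃ (C : ℝ) (N : ℕ), 0 ≤ C ∧ ∀ u : ℝ, |G u| ≤ C * (1 + |u|) ^ N

lemma PolyGrowth.comp_fst {G : ℝ → ℝ} (hG : PolyGrowth G) : PolyO 0 (fun _ u _ => G u) := by
  obtain ⟨C, N, hC, hb⟩ := hG
  refine ⟨C, N, hC, fun ε _ _ u z => (hb u).trans ?_⟩
  rw [pow_zero, mul_one]
  have : 1 + |u| ≤ 1 + |u| + |z| := by linarith [abs_nonneg z]
  gcongr

lemma PolyGrowth.mul {F G : ℝ → ℝ} (hF : PolyGrowth F) (hG : PolyGrowth G) :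
    PolyGrowth (fun u => F u * G u) := by
  obtain ⟨C, N, hC, hb⟩ := hF
  obtain ⟨D, M, hD, hd⟩ := hG
  refine ⟨C * D, N + M, by positivity, fun u => ?_⟩
  rw [abs_mul]
  calc |F u| * |G u| ≤ (C * (1 + |u|) ^ N) * (D * (1 + |u|) ^ M) :=
        mul_le_mul (hb u) (hd u) (abs_nonneg _) (by positivity)
    _ = _ := by ring

/-- The remainder of the Taylor polynomial of degree `k - 1` of `G` at `u`. -/
noncomputable def taylorRem (k : ℕ) (G : ℝ → ℝ) (u h : ℝ) : ℝ :=
  G (u + h) - ∑ j ∈ Finset.range k, iteratedDeriv j G u * (h ^ j / (j.factorial : ℝ))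

lemma taylorRem_at_zero (k : ℕ) (G : ℝ → ℝ) (u : ℝ) : taylorRem (k + 1) G u 0 = 0 := by
  simp [taylorRem, Finset.sum_range_succ']

lemma hasDerivAt_taylorRem {G : ℝ → ℝ} (hG : ContDiff ℝ ∞ G) (k : ℕ) (u h : ℝ) :
    HasDerivAt (taylorRem (k + 1) G u) (taylorRem k (deriv G) u h) h := by
  unfold taylorRem
  simp only [Finset.sum_range_succ' _ k]
  have hd : HasDerivAt (fun h => G (u + h)) (deriv G (u + h)) h :=
    ((hG.differentiable (by simp)) (u + h)).hasDerivAt.comp_const_add u h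
  have hs : HasDerivAt (fun h : ℝ => ∑ j ∈ Finset.range k,
      iteratedDeriv (j + 1) G u * (h ^ (j + 1) / ((j + 1).factorial : ℝ)))
      (∑ j ∈ Finset.range k, iteratedDeriv j (deriv G) u * (h ^ j / (j.factorial : ℝ))) h := by
    refine HasDerivAt.fun_sum fun j _ => ?_
    have := ((hasDerivAt_pow (j + 1) h).div_const ((j + 1).factorial : ℝ)).const_mul
      (iteratedDeriv (j + 1) G u)
    refine this.congr_deriv ?_
    rw [iteratedDeriv_succ', Nat.factorial_succ]
    have : (j.factorial : ℝ) ≠ 0 := by positivity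
    push_cast
    field_simp
  have := hd.fun_sub (hs.add_const (iteratedDeriv 0 G u * (h ^ 0 / (Nat.factorial 0 : ℝ))))
  exact this

/-- Induction on `k`: in the increment, the remainder of order `k + 1` of `G` vanishes at `0` and
has the remainder of order `k` of `deriv G` as derivative. The mean value inequality gains one
factor `|h|` each time. -/
lemma abs_taylorRem_le (k : ℕ) : ∀ {G : ℝ → ℝ} (_ : ContDiff ℝ ∞ G)
    {C : ℝ} {N : ℕ} (_ : 0 ≤ C) (_ : ∀ u, |iteratedDeriv k G u| ≤ C * (1 + |u|) ^ N) (u h : ℝ),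
    |taylorRem k G u h| ≤ C * (1 + |u| + |h|) ^ N * |h| ^ k := by
  induction k with
  | zero =>
    intro G _ C N hC hb u h
    have := hb (u + h)
    simp only [iteratedDeriv_zero] at this
    simp only [taylorRem, Finset.range_zero, Finset.sum_empty, sub_zero, pow_zero, mul_one]
    refine this.trans ?_
    have : 1 + |u + h| ≤ 1 + |u| + |h| := by linarith [abs_add_le u h]
    gcongr
  | succ k ih =>
    intro G hG C N hC hb u h
    have hG' : ContDiff ℝ ∞ (deriv G) := (contDiff_infty_iff_deriv.1 hG).2
    have hb' : ∀ u, |iteratedDeriv k (deriv G) u| ≤ C * (1 + |u|) ^ N := fun u => by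
      rw [← iteratedDeriv_succ']; exact hb u
    have key := Convex.norm_image_sub_le_of_norm_hasDerivWithin_le
      (f := taylorRem (k + 1) G u) (f' := fun t => taylorRem k (deriv G) u t)
      (s := Set.uIcc 0 h) (C := C * (1 + |u| + |h|) ^ N * |h| ^ k) (x := 0) (y := h)
      (fun t _ => (hasDerivAt_taylorRem hG k u t).hasDerivWithinAt)
      -- The inductive bound increases with the size of the increment, so its value at `h` serves on
      -- the whole segment.
      (fun t ht => by
        have ht' : |t| ≤ |h| := by
          rcases Set.mem_uIcc.1 ht with ⟨h1, h2⟩ | ⟨h1, h2⟩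
          · rw [abs_of_nonneg h1, abs_of_nonneg (h1.trans h2)]; exact h2
          · rw [abs_of_nonpos h2, abs_of_nonpos (h1.trans h2)]; linarith
        refine (ih hG' hC hb' u t).trans ?_
        gcongr) (convex_uIcc 0 h) Set.left_mem_uIcc Set.right_mem_uIcc
    rw [taylorRem_at_zero, sub_zero, sub_zero, Real.norm_eq_abs, Real.norm_eq_abs] at key
    rw [pow_succ, ← mul_assoc]
    exact key

lemma PolyO.taylorRem {k j : ℕ} {G : ℝ → ℝ} (hG : ContDiff ℝ ∞ G)
    (hb : PolyGrowth (iteratedDeriv k G)) {H : ℝ → ℝ → ℝ → ℝ} (hH : PolyO j H) :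
    PolyO (j * k) (fun ε u z => taylorRem k G u (H ε u z)) := by
  obtain ⟨C, N, hC, hb⟩ := hb
  have h0 : PolyO 0 (fun ε u z => C * (1 + |u| + |H ε u z|) ^ N) := by
    have := ((((PolyO.const 1).add PolyO.fst.abs).add (hH.mono (Nat.zero_le j)).abs).pow
      N).const_mul C
    simpa using this
  have := h0.mul (hH.abs.pow k)
  rw [zero_add] at this
  refine this.of_abs_le fun ε _ _ u z => ?_
  refine (abs_taylorRem_le k hG hC hb u (H ε u z)).trans (le_abs_self _)

namespace RegularPotential

variable {g : ℝ → ℝ}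

lemma polyGrowth_iteratedDeriv (hg : RegularPotential g) (k : ℕ) :
    PolyGrowth (iteratedDeriv k g) := by
  obtain ⟨C, m, hb⟩ := hg.polyGrowth k
  refine ⟨|C| * 2, m, by positivity, fun u => (hb u).trans ?_⟩
  have h1 : (1 : ℝ) ≤ (1 + |u|) ^ m := one_le_pow₀ (by linarith [abs_nonneg u])
  have h2 : |u| ^ m ≤ (1 + |u|) ^ m := by gcongr; linarith
  calc C * (1 + |u| ^ m) ≤ |C| * (1 + |u| ^ m) := by gcongr; exact le_abs_self C
    _ ≤ |C| * ((1 + |u|) ^ m + (1 + |u|) ^ m) := by gcongr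
    _ = _ := by ring

lemma contDiff_iteratedDeriv (hg : RegularPotential g) (k : ℕ) :
    ContDiff ℝ ∞ (iteratedDeriv k g) := by
  rw [iteratedDeriv_eq_iterate]
  exact ContDiff.iterate_deriv k hg.smooth

lemma continuous_iteratedDeriv (hg : RegularPotential g) (k : ℕ) :
    Continuous (iteratedDeriv k g) :=
  (hg.contDiff_iteratedDeriv k).continuous

lemma hasDerivAt_iteratedDeriv (hg : RegularPotential g) (k : ℕ) (u : ℝ) :
    HasDerivAt (iteratedDeriv k g) (iteratedDeriv (k + 1) g u) u := by
  rw [iteratedDeriv_succ]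
  exact ((hg.contDiff_iteratedDeriv k).differentiable (by simp) u).hasDerivAt

lemma hasDerivAt (hg : RegularPotential g) (u : ℝ) : HasDerivAt g (iteratedDeriv 1 g u) u := by
  simpa using hg.hasDerivAt_iteratedDeriv 0 u

lemma taylorRem_iteratedDeriv (hg : RegularPotential g) (i k : ℕ) {j : ℕ}
    {H : ℝ → ℝ → ℝ → ℝ} (hH : PolyO j H) :
    PolyO (j * k) (fun ε u z => taylorRem k (iteratedDeriv i g) u (H ε u z)) := by
  refine PolyO.taylorRem (hg.contDiff_iteratedDeriv i) ?_ hH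
  have : iteratedDeriv k (iteratedDeriv i g) = iteratedDeriv (k + i) g := by
    simp only [iteratedDeriv_eq_iterate, Function.iterate_add_apply]
  rw [this]
  exact hg.polyGrowth_iteratedDeriv _

end RegularPotential

/-! ### One rescaled coordinate: the log acceptance ratio and its expansion. -/

/-- The proposal mean in one rescaled coordinate. -/
noncomputable def coordMean (A : Algorithm) (g : ℝ → ℝ) (ε u : ℝ) : ℝ :=
  match A with
  | .RWM => u
  | .SLA => u - ε ^ 2 / 2 * iteratedDeriv 1 g u

/-- The proposal in one rescaled coordinate. -/
noncomputable def coordProposal (A : Algorithm) (g : ℝ → ℝ) (ε u z : ℝ) : ℝ :=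
  coordMean A g ε u + ε * z

/-- The noise that moves the proposal back to the starting point. -/
noncomputable def reverseNoise (A : Algorithm) (g : ℝ → ℝ) (ε u z : ℝ) : ℝ :=
  (u - coordMean A g ε (coordProposal A g ε u z)) / ε

/-- The logarithm of the acceptance ratio of one rescaled coordinate. -/
noncomputable def logRatio (A : Algorithm) (g : ℝ → ℝ) (ε u z : ℝ) : ℝ :=
  g u - g (coordProposal A g ε u z) + (z ^ 2 - reverseNoise A g ε u z ^ 2) / 2

/-- The order in `ε` of the logarithm of the acceptance ratio. -/
def order : Algorithm → ℕ
  | .RWM => 1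
  | .SLA => 3

/-- The leading coefficient of the logarithm of the acceptance ratio. -/
noncomputable def leadCoeff (A : Algorithm) (g : ℝ → ℝ) (u z : ℝ) : ℝ :=
  match A with
  | .RWM => -(iteratedDeriv 1 g u * z)
  | .SLA => iteratedDeriv 3 g u / 12 * z ^ 3 -
      iteratedDeriv 1 g u * iteratedDeriv 2 g u / 4 * z

lemma logRatio_RWM {g : ℝ → ℝ} {ε : ℝ} (hε : 0 < ε) (u z : ℝ) :
    logRatio .RWM g ε u z = g u - g (u + ε * z) := by
  have : reverseNoise .RWM g ε u z = -z := by
    simp only [reverseNoise, coordProposal, coordMean]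
    field_simp
    ring
  simp [logRatio, this, coordProposal, coordMean]

/-- In terms of the actual increment `h`, the first terms are the error of the trapezoidal rule for
`∫ g'` over `[u, u + h]`, hence of order `h ^ 3`. The last term has a factor `ε ^ 2` times an
increment of `g' ^ 2`. This is why SLA has order `3`. -/
lemma logRatio_SLA {g : ℝ → ℝ} {ε : ℝ} (hε : 0 < ε) {u z h : ℝ}
    (hh : h = ε * (z - ε / 2 * iteratedDeriv 1 g u)) :
    logRatio .SLA g ε u z = g u - g (u + h) +
      h * (iteratedDeriv 1 g u + iteratedDeriv 1 g (u + h)) / 2 -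
      ε ^ 2 / 8 * (iteratedDeriv 1 g (u + h) ^ 2 - iteratedDeriv 1 g u ^ 2) := by
  have h1 : coordProposal .SLA g ε u z = u + h := by
    simp only [coordProposal, coordMean, hh]
    ring
  have h2 : z = (h + ε ^ 2 / 2 * iteratedDeriv 1 g u) / ε := by
    rw [hh]
    field_simp
    ring
  rw [logRatio, reverseNoise, h1, h2, coordMean]
  field_simp
  ring

theorem logRatio_sub_leadCoeff {g : ℝ → ℝ} (hg : RegularPotential g) (A : Algorithm) :
    PolyO (order A + 1) (fun ε u z => logRatio A g ε u z - ε ^ order A * leadCoeff A g u z) := by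
  cases A with
  | RWM =>
    have hH : PolyO 1 (fun ε _ z => ε * z) := by simpa using PolyO.eps.mul PolyO.snd
    refine (hg.taylorRem_iteratedDeriv 0 2 hH).neg.congr fun ε h0 _ u z => ?_
    simp only [logRatio_RWM h0, order, leadCoeff, taylorRem, Finset.sum_range_succ,
      Finset.sum_range_zero, iteratedDeriv_zero, Nat.factorial]
    norm_num
    ring
  | SLA =>
    have hd (k : ℕ) : PolyO 0 (fun _ u _ => iteratedDeriv k g u) :=
      (hg.polyGrowth_iteratedDeriv k).comp_fst
    have hdiff : PolyO 1 (fun ε u _ => -(ε / 2 * iteratedDeriv 1 g u)) := by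
      simpa [div_eq_inv_mul] using ((PolyO.eps.const_mul 2⁻¹).mul (hd 1)).neg
    have hK : PolyO 0 (fun ε u z => z - ε / 2 * iteratedDeriv 1 g u) := by
      simpa [sub_eq_add_neg] using PolyO.snd.add (hdiff.mono zero_le_one)
    have hH : PolyO 1 (fun ε u z => ε * (z - ε / 2 * iteratedDeriv 1 g u)) := by
      simpa using PolyO.eps.mul hK
    have t4 := hg.taylorRem_iteratedDeriv 0 4 hH
    have t3 := hH.mul (hg.taylorRem_iteratedDeriv 1 3 hH)
    have t2 := hg.taylorRem_iteratedDeriv 1 2 hH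
    have e2 : PolyO 2 (fun ε _ _ => ε ^ 2) := PolyO.eps_pow 2
    have e3 : PolyO 3 (fun ε _ _ => ε ^ 3) := PolyO.eps_pow 3
    -- the square of the increment of `g'`, and the increment times the remainder
    have hinc : PolyO 1 (fun ε u z =>
        iteratedDeriv 2 g u * (ε * (z - ε / 2 * iteratedDeriv 1 g u)) +
        taylorRem 2 (iteratedDeriv 1 g) u (ε * (z - ε / 2 * iteratedDeriv 1 g u))) :=
      (by simpa using (hd 2).mul hH : PolyO 1 _).add (t2.mono (by norm_num))
    have q : PolyO 2 (fun ε u z =>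
        2 * (iteratedDeriv 1 g u *
          taylorRem 2 (iteratedDeriv 1 g) u (ε * (z - ε / 2 * iteratedDeriv 1 g u))) +
        (iteratedDeriv 2 g u * (ε * (z - ε / 2 * iteratedDeriv 1 g u)) +
        taylorRem 2 (iteratedDeriv 1 g) u (ε * (z - ε / 2 * iteratedDeriv 1 g u))) ^ 2) :=
      ((by simpa using (hd 1).mul t2 : PolyO 2 _).const_mul 2).add (by simpa using hinc.pow 2)
    -- This is the cost of putting `ε * z` in place of `h = ε * w` in the leading terms, where `w =
    -- z - ε / 2 * g'`: it uses `w ^ 3 - z ^ 3 = (w - z) * (w ^ 2 + w * z + z ^ 2)` and `w - z = -(ε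
    -- / 2 * g')`.
    have c1 : PolyO 1 (fun ε u z => -(ε / 2 * iteratedDeriv 1 g u) *
        (((z - ε / 2 * iteratedDeriv 1 g u) ^ 2 + (z - ε / 2 * iteratedDeriv 1 g u) * z + z ^ 2)
          * (iteratedDeriv 3 g u * (1 / 12)) -
          iteratedDeriv 1 g u * iteratedDeriv 2 g u * (1 / 4))) := by
      have p1 := ((hK.pow 2).add (hK.mul PolyO.snd)).add (PolyO.snd.pow 2)
      have p2 := (p1.mul ((hd 3).mul (PolyO.const (1 / 12)))).sub
        (((hd 1).mul (hd 2)).mul (PolyO.const (1 / 4)))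
      exact hdiff.mul p2
    -- Each summand has order `4`: the remainder of `g`, half of `h` times the remainder of `g'`, `ε
    -- ^ 2 / 8` times the nonlinear part of the increment of `g' ^ 2`, and `ε ^ 3` times `c1`.
    have total := (((t4.neg.add (t3.const_mul (1 / 2))).sub
      ((e2.mul q).const_mul (1 / 8))).add (e3.mul c1))
    refine total.congr fun ε h0 _ u z => ?_
    simp only [logRatio_SLA h0 rfl, order, leadCoeff]
    set h := ε * (z - ε / 2 * iteratedDeriv 1 g u) with hh
    simp only [taylorRem, Finset.sum_range_succ,
      Finset.sum_range_zero, iteratedDeriv_zero, Nat.factorial]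
    have i1 (j : ℕ) : iteratedDeriv j (iteratedDeriv 1 g) u = iteratedDeriv (j + 1) g u := by
      simp only [iteratedDeriv_eq_iterate, Function.iterate_add_apply]
    simp only [i1]
    rw [hh]
    norm_num
    ring

/-! ### The law of one coordinate and its noise; integrability. -/

/-- The law on the line with density `exp (-g)`. -/
noncomputable def refLaw (g : ℝ → ℝ) : Measure ℝ :=
  volume.withDensity fun u => ENNReal.ofReal (Real.exp (-g u))

/-- The joint law of one rescaled coordinate and its noise. -/
noncomputable def coordLaw (g : ℝ → ℝ) : Measure (ℝ × ℝ) :=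
  (refLaw g).prod (gaussianReal 0 1)

variable {g : ℝ → ℝ}

lemma integral_refLaw (hg : RegularPotential g) (F : ℝ → ℝ) :
    ∫ u, F u ∂(refLaw g) = ∫ u, Real.exp (-g u) * F u := by
  have hc := hg.smooth.continuous
  rw [refLaw, integral_withDensity_eq_integral_toReal_smul (by fun_prop) (by simp)]
  simp [ENNReal.toReal_ofReal (Real.exp_nonneg _)]

lemma integrable_refLaw_iff (hg : RegularPotential g) (F : ℝ → ℝ) :
    Integrable F (refLaw g) ↔ Integrable fun u => Real.exp (-g u) * F u := by
  have hc := hg.smooth.continuous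
  rw [refLaw, integrable_withDensity_iff_integrable_smul' (by fun_prop) (by simp)]
  simp [ENNReal.toReal_ofReal (Real.exp_nonneg _)]

namespace RegularPotential

lemma isProbabilityMeasure_refLaw (hg : RegularPotential g) :
    IsProbabilityMeasure (refLaw g) := by
  have hc := hg.smooth.continuous
  refine ⟨?_⟩
  rw [refLaw, withDensity_apply _ MeasurableSet.univ, setLIntegral_univ,
    ← ofReal_integral_eq_lintegral_ofReal (by simpa using hg.moments 0)
      (ae_of_all _ fun u => (Real.exp_pos _).le), hg.normalized, ENNReal.ofReal_one]

lemma isProbabilityMeasure_coordLaw (hg : RegularPotential g) :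
    IsProbabilityMeasure (coordLaw g) := by
  have := hg.isProbabilityMeasure_refLaw
  unfold coordLaw
  infer_instance

lemma one_add_abs_pow_le (x : ℝ) (N : ℕ) : (1 + |x|) ^ N ≤ 2 ^ N * (1 + |x| ^ N) := by
  rcases le_total |x| 1 with h | h
  · calc (1 + |x|) ^ N ≤ 2 ^ N := by gcongr; linarith
      _ ≤ 2 ^ N * (1 + |x| ^ N) := by
        have : 0 ≤ |x| ^ N := by positivity
        nlinarith [pow_pos (zero_lt_two (α := ℝ)) N]
  · calc (1 + |x|) ^ N ≤ (2 * |x|) ^ N := by gcongr; linarith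
      _ = 2 ^ N * |x| ^ N := mul_pow _ _ _
      _ ≤ 2 ^ N * (1 + |x| ^ N) := by gcongr; linarith

lemma integrable_one_add_abs_pow (hg : RegularPotential g) (N : ℕ) :
    Integrable (fun u : ℝ => (1 + |u|) ^ N) (refLaw g) := by
  have := hg.isProbabilityMeasure_refLaw
  have h1 : Integrable (fun u : ℝ => |u| ^ N) (refLaw g) := by
    rw [integrable_refLaw_iff hg]
    simpa [mul_comm] using hg.moments N
  refine (((integrable_const 1).add h1).const_mul (2 ^ N)).mono' (by fun_prop)
    (ae_of_all _ fun u => ?_)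
  rw [Real.norm_of_nonneg (by positivity)]
  exact one_add_abs_pow_le u N

lemma integrable_gaussian_one_add_abs_pow (N : ℕ) :
    Integrable (fun z : ℝ => (1 + |z|) ^ N) (gaussianReal 0 1) := by
  have h1 : Integrable (fun z : ℝ => |z| ^ N) (gaussianReal 0 1) := by
    rcases Nat.eq_zero_or_pos N with rfl | hN
    · simp
    have := (memLp_id_gaussianReal' (μ := 0) (v := 1) (N : ENNReal) (by simp)).integrable_norm_pow
      (by omega)
    simpa using this
  refine (((integrable_const 1).add h1).const_mul (2 ^ N)).mono' (by fun_prop)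
    (ae_of_all _ fun u => ?_)
  rw [Real.norm_of_nonneg (by positivity)]
  exact one_add_abs_pow_le u N

lemma integrable_weight_pow (hg : RegularPotential g) (N : ℕ) :
    Integrable (fun w : ℝ × ℝ => (1 + |w.1| + |w.2|) ^ N) (coordLaw g) := by
  have := hg.isProbabilityMeasure_refLaw
  refine ((hg.integrable_one_add_abs_pow N).mul_prod
    (integrable_gaussian_one_add_abs_pow N)).mono' (by fun_prop) (ae_of_all _ fun w => ?_)
  rw [Real.norm_of_nonneg (by positivity), ← mul_pow]
  gcongr
  nlinarith [mul_nonneg (abs_nonneg w.1) (abs_nonneg w.2)]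

end RegularPotential

theorem PolyO.integrable (hg : RegularPotential g) {k : ℕ} {F : ℝ → ℝ → ℝ → ℝ}
    (hF : PolyO k F) (hm : ∀ ε, Measurable fun w : ℝ × ℝ => F ε w.1 w.2)
    {ε : ℝ} (h0 : 0 < ε) (h1 : ε ≤ 1) :
    Integrable (fun w : ℝ × ℝ => F ε w.1 w.2) (coordLaw g) := by
  obtain ⟨C, N, hC, hb⟩ := hF
  exact ((hg.integrable_weight_pow N).const_mul (C * ε ^ k)).mono' (hm ε).aestronglyMeasurable
    (ae_of_all _ fun w => hb ε h0 h1 w.1 w.2)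

theorem PolyO.abs_integral_le (hg : RegularPotential g) {k : ℕ} {F : ℝ → ℝ → ℝ → ℝ}
    (hF : PolyO k F) :
    ∃ C : ℝ, 0 ≤ C ∧ ∀ ε : ℝ, 0 < ε → ε ≤ 1 →
      |∫ w, F ε w.1 w.2 ∂(coordLaw g)| ≤ C * ε ^ k := by
  obtain ⟨C, N, hC, hb⟩ := hF
  refine ⟨C * ∫ w, (1 + |w.1| + |w.2|) ^ N ∂(coordLaw g),
    mul_nonneg hC (integral_nonneg fun w => by positivity), fun ε h0 h1 => ?_⟩
  have := norm_integral_le_of_norm_le ((hg.integrable_weight_pow N).const_mul (C * ε ^ k))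
    (f := fun w : ℝ × ℝ => F ε w.1 w.2) (ae_of_all _ fun w => hb ε h0 h1 w.1 w.2)
  rw [integral_const_mul, Real.norm_eq_abs] at this
  linarith

section Measurability

lemma measurable_coordMean (hg : RegularPotential g) (A : Algorithm) (ε : ℝ) :
    Measurable (coordMean A g ε) := by
  have := (hg.continuous_iteratedDeriv 1).measurable
  cases A <;> unfold coordMean <;> fun_prop

lemma measurable_coordProposal (hg : RegularPotential g) (A : Algorithm) (ε : ℝ) :
    Measurable fun w : ℝ × ℝ => coordProposal A g ε w.1 w.2 := by
  have := measurable_coordMean hg A ε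
  unfold coordProposal
  fun_prop

lemma measurable_reverseNoise (hg : RegularPotential g) (A : Algorithm) (ε : ℝ) :
    Measurable fun w : ℝ × ℝ => reverseNoise A g ε w.1 w.2 := by
  have := measurable_coordMean hg A ε
  have := measurable_coordProposal hg A ε
  unfold reverseNoise
  fun_prop

lemma measurable_logRatio (hg : RegularPotential g) (A : Algorithm) (ε : ℝ) :
    Measurable fun w : ℝ × ℝ => logRatio A g ε w.1 w.2 := by
  have := hg.smooth.continuous.measurable
  have := measurable_reverseNoise hg A ε
  have := measurable_coordProposal hg A ε
  unfold logRatio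
  fun_prop

lemma continuous_leadCoeff (hg : RegularPotential g) (A : Algorithm) :
    Continuous fun w : ℝ × ℝ => leadCoeff A g w.1 w.2 := by
  have h1 := hg.continuous_iteratedDeriv 1
  have h2 := hg.continuous_iteratedDeriv 2
  have h3 := hg.continuous_iteratedDeriv 3
  cases A <;> unfold leadCoeff <;> fun_prop

lemma measurable_leadCoeff (hg : RegularPotential g) (A : Algorithm) :
    Measurable fun w : ℝ × ℝ => leadCoeff A g w.1 w.2 :=
  (continuous_leadCoeff hg A).measurable

end Measurability

/-! ### Reversibility of the exchange of start and proposal. -/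

/-- Exchange of the starting point and the proposal, in one rescaled coordinate. -/
noncomputable def exchange (A : Algorithm) (g : ℝ → ℝ) (ε : ℝ) (w : ℝ × ℝ) : ℝ × ℝ :=
  (coordProposal A g ε w.1 w.2, reverseNoise A g ε w.1 w.2)

lemma exchange_involutive (A : Algorithm) (g : ℝ → ℝ) {ε : ℝ} (hε : 0 < ε) :
    Function.Involutive (exchange A g ε) := by
  intro w
  have h1 : coordProposal A g ε (coordProposal A g ε w.1 w.2) (reverseNoise A g ε w.1 w.2)
      = w.1 := by
    conv_lhs => rw [coordProposal, reverseNoise]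
    field_simp
    ring
  refine Prod.ext h1 ?_
  simp only [exchange]
  rw [reverseNoise, h1, coordProposal]
  field_simp
  ring

lemma map_affine_volume {a : ℝ} (ha : a ≠ 0) (b : ℝ) :
    Measure.map (fun z : ℝ => b + a * z) volume = ENNReal.ofReal |a⁻¹| • volume := by
  have : (fun z : ℝ => b + a * z) = (fun z => b + z) ∘ fun z => a * z := rfl
  rw [this, ← Measure.map_map (by fun_prop) (by fun_prop), Real.map_volume_mul_left ha,
    Measure.map_smul, (measurePreserving_add_left volume b).map_eq]

/-- The map factors as `(u, z) ↦ (u, y)`, then the swap, then `(y, u) ↦ (y, z')`. The outer maps are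
affine on fibres with slopes `ε` and `ε⁻¹`, so the Jacobians cancel. The drift enters only as a
translation of fibres, hence measurability of `coordMean` suffices. -/
lemma measurePreserving_exchange (hg : RegularPotential g) (A : Algorithm) {ε : ℝ} (hε : 0 < ε) :
    MeasurePreserving (exchange A g ε) := by
  have hm := measurable_coordMean hg A ε
  set c : ENNReal := ENNReal.ofReal |ε⁻¹| with hc
  have s1 : MeasurePreserving (fun w : ℝ × ℝ => (id w.1, coordMean A g ε w.1 + ε * w.2))
      (volume.prod volume) (volume.prod (c • volume)) :=
    (MeasurePreserving.id volume).skew_product (g := fun u z => coordMean A g ε u + ε * z)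
      (by unfold Function.uncurry; fun_prop)
      (ae_of_all _ fun u => map_affine_volume hε.ne' _)
  have s2 : MeasurePreserving (Prod.swap : ℝ × ℝ → ℝ × ℝ) (volume.prod (c • volume))
      (volume.prod (c • volume)) := by
    have := Measure.measurePreserving_swap (μ := (volume : Measure ℝ)) (ν := c • (volume : Measure ℝ))
    rwa [Measure.prod_smul_left, ← Measure.prod_smul_right] at this
  have s3 : MeasurePreserving (fun w : ℝ × ℝ => (id w.1, (w.2 - coordMean A g ε w.1) / ε))
      (volume.prod (c • volume)) (volume.prod volume) := by
    refine (MeasurePreserving.id volume).skew_product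
      (g := fun v u => (u - coordMean A g ε v) / ε) (by unfold Function.uncurry; fun_prop)
      (ae_of_all _ fun v => ?_)
    have : (fun u : ℝ => (u - coordMean A g ε v) / ε)
        = fun u => -(coordMean A g ε v) / ε + ε⁻¹ * u := by
      ext u; field_simp; ring
    rw [this, Measure.map_smul, map_affine_volume (inv_ne_zero hε.ne'), smul_smul, hc, inv_inv,
      ← ENNReal.ofReal_mul (abs_nonneg _), ← abs_mul, inv_mul_cancel₀ hε.ne']
    simp
  exact s3.comp (s2.comp s1)

/-- The density of `coordLaw`. -/
noncomputable def coordDensity (g : ℝ → ℝ) (w : ℝ × ℝ) : ℝ :=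
  Real.exp (-g w.1) * gaussianPDFReal 0 1 w.2

lemma integral_coordLaw (hg : RegularPotential g) (F : ℝ × ℝ → ℝ) :
    ∫ w, F w ∂(coordLaw g) = ∫ w, coordDensity g w * F w := by
  have hc := hg.smooth.continuous
  rw [coordLaw, refLaw, gaussianReal_of_var_ne_zero _ one_ne_zero,
    prod_withDensity (by fun_prop) (measurable_gaussianPDF 0 1),
    integral_withDensity_eq_integral_toReal_smul (by fun_prop)
      (ae_of_all _ fun w => ENNReal.mul_lt_top (by simp) gaussianPDF_lt_top)]
  simp [ENNReal.toReal_ofReal (Real.exp_nonneg _), toReal_gaussianPDF, coordDensity,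
    Measure.volume_eq_prod]

lemma coordDensity_exchange (A : Algorithm) (ε : ℝ) (w : ℝ × ℝ) :
    coordDensity g (exchange A g ε w) =
      Real.exp (logRatio A g ε w.1 w.2) * coordDensity g w := by
  simp only [coordDensity, gaussianPDFReal, logRatio, exchange]
  rw [show ∀ a b c d : ℝ, a * (b * c) = b * (a * c) from fun a b c d => by ring]
  · rw [show ∀ a b c d : ℝ, a * (b * (c * d)) = c * (a * b * d) from fun a b c d => by ring,
      ← Real.exp_add, ← Real.exp_add, ← Real.exp_add]
    congr 2
    simp
    ring
  -- The reordering identity quantifies over a variable `d` that does not occur in it; any number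
  -- fills the leftover goal.
  · exact 0

lemma logRatio_exchange (A : Algorithm) {ε : ℝ} (hε : 0 < ε) (w : ℝ × ℝ) :
    logRatio A g ε (exchange A g ε w).1 (exchange A g ε w).2 = -logRatio A g ε w.1 w.2 := by
  have h := exchange_involutive A g hε w
  have h1 : coordProposal A g ε (exchange A g ε w).1 (exchange A g ε w).2 = w.1 :=
    congrArg Prod.fst h
  have h2 : reverseNoise A g ε (exchange A g ε w).1 (exchange A g ε w).2 = w.2 :=
    congrArg Prod.snd h
  rw [logRatio, h1, h2]
  simp only [logRatio, exchange]
  ring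

/-- Detailed balance for one coordinate. -/
theorem integral_mul_exp_logRatio (hg : RegularPotential g) (A : Algorithm) {ε : ℝ} (hε : 0 < ε)
    (H : ℝ → ℝ) :
    ∫ w, H (logRatio A g ε w.1 w.2) * Real.exp (logRatio A g ε w.1 w.2) ∂(coordLaw g) =
      ∫ w, H (-logRatio A g ε w.1 w.2) ∂(coordLaw g) := by
  have hm : Measurable (exchange A g ε) :=
    (measurable_coordProposal hg A ε).prodMk (measurable_reverseNoise hg A ε)
  rw [integral_coordLaw hg, integral_coordLaw hg]
  have := (measurePreserving_exchange hg A hε).integral_comp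
    (MeasurableEquiv.ofInvolutive _ (exchange_involutive A g hε) hm).measurableEmbedding
    (fun w => coordDensity g w * H (-logRatio A g ε w.1 w.2))
  rw [← this]
  refine integral_congr_ae (ae_of_all _ fun w => ?_)
  simp only [logRatio_exchange A hε, coordDensity_exchange, neg_neg]
  ring

lemma integral_exp_logRatio (hg : RegularPotential g) (A : Algorithm) {ε : ℝ} (hε : 0 < ε) :
    ∫ w, Real.exp (logRatio A g ε w.1 w.2) ∂(coordLaw g) = 1 := by
  have := hg.isProbabilityMeasure_coordLaw
  simpa using integral_mul_exp_logRatio hg A hε fun _ => 1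

/-- A non-integrable function has integral `0` by convention, and this integral is `1`. The same
argument gives integrability of the target densities below. -/
lemma integrable_exp_logRatio (hg : RegularPotential g) (A : Algorithm) {ε : ℝ} (hε : 0 < ε) :
    Integrable (fun w : ℝ × ℝ => Real.exp (logRatio A g ε w.1 w.2)) (coordLaw g) := by
  by_contra h
  have := integral_exp_logRatio hg A hε
  rw [integral_undef h] at this
  exact zero_ne_one this

/-- With `H t = t / (1 + exp t)` the two sides of detailed balance are negatives of each other. This
exact identity replaces a high-order expansion of the mean of the log ratio. -/
lemma integral_logRatio_div (hg : RegularPotential g) (A : Algorithm) {ε : ℝ} (hε : 0 < ε) :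
    ∫ w, logRatio A g ε w.1 w.2 / (1 + Real.exp (-logRatio A g ε w.1 w.2)) ∂(coordLaw g) = 0 := by
  have h := integral_mul_exp_logRatio hg A hε fun t => t / (1 + Real.exp t)
  have e1 (t : ℝ) : t / (1 + Real.exp t) * Real.exp t = t / (1 + Real.exp (-t)) := by
    have := Real.exp_pos t
    rw [Real.exp_neg]
    field_simp
    ring
  simp only [e1, neg_div] at h
  rw [integral_neg] at h
  linarith

/-! ### Gaussian moments. -/

section GaussianMoments

lemma integrable_pow_gaussian (n : ℕ) : Integrable (fun z : ℝ => z ^ n) (gaussianReal 0 1) := by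
  refine (RegularPotential.integrable_gaussian_one_add_abs_pow n).mono' (by fun_prop)
    (ae_of_all _ fun z => ?_)
  rw [Real.norm_eq_abs, abs_pow]
  gcongr
  linarith

/-- Integration by parts: the derivative of the density times `z ^ (n + 1)` is integrable and has
integral zero. -/
lemma integral_pow_gaussian_succ (n : ℕ) :
    ∫ z, z ^ (n + 2) ∂(gaussianReal 0 1) = (n + 1) * ∫ z, z ^ n ∂(gaussianReal 0 1) := by
  have hd (z : ℝ) : HasDerivAt (gaussianPDFReal 0 1) (-z * gaussianPDFReal 0 1 z) z := by
    unfold gaussianPDFReal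
    have h := ((((hasDerivAt_id z).sub_const 0).pow 2).neg.div_const (2 * ((1 : NNReal) : ℝ))).exp
    have h := h.const_mul (√(2 * Real.pi * ((1 : NNReal) : ℝ)))⁻¹
    refine h.congr_deriv ?_
    simp
    ring
  have hi (m : ℕ) : Integrable fun z : ℝ => gaussianPDFReal 0 1 z * z ^ m := by
    have := integrable_pow_gaussian m
    rw [gaussianReal_of_var_ne_zero _ one_ne_zero, integrable_withDensity_iff_integrable_smul'
      (measurable_gaussianPDF 0 1) (ae_of_all _ fun _ => gaussianPDF_lt_top)] at this
    simpa [toReal_gaussianPDF] using this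
  have hh (z : ℝ) : HasDerivAt (fun z => gaussianPDFReal 0 1 z * z ^ (n + 1))
      ((n + 1) * (gaussianPDFReal 0 1 z * z ^ n) - gaussianPDFReal 0 1 z * z ^ (n + 2)) z := by
    refine ((hd z).mul (hasDerivAt_pow (n + 1) z)).congr_deriv ?_
    push_cast
    simp
    ring
  have key := integral_eq_zero_of_hasDerivAt_of_integrable hh
    (((hi n).const_mul _).sub (hi (n + 2))) (hi (n + 1))
  rw [integral_sub ((hi n).const_mul _) (hi (n + 2)), integral_const_mul] at key
  simp only [integral_gaussianReal_eq_integral_smul (one_ne_zero), smul_eq_mul]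
  linarith

lemma integral_gaussian_one : ∫ z, z ∂(gaussianReal 0 1) = 0 := integral_id_gaussianReal

lemma integral_gaussian_two : ∫ z, z ^ 2 ∂(gaussianReal 0 1) = 1 := by
  simpa using integral_pow_gaussian_succ 0

lemma integral_gaussian_three : ∫ z, z ^ 3 ∂(gaussianReal 0 1) = 0 := by
  rw [integral_pow_gaussian_succ 1]
  simp

lemma integral_gaussian_four : ∫ z, z ^ 4 ∂(gaussianReal 0 1) = 3 := by
  rw [integral_pow_gaussian_succ 2, integral_gaussian_two]
  norm_num

lemma integral_gaussian_six : ∫ z, z ^ 6 ∂(gaussianReal 0 1) = 15 := by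
  rw [integral_pow_gaussian_succ 4, integral_gaussian_four]
  norm_num

end GaussianMoments

/-! ### Mean and variance of the leading coefficient; the constant `K`. -/

section LeadingCoefficient

/-- The conditional variance of the leading coefficient, given the starting point. -/
noncomputable def leadVar (A : Algorithm) (g : ℝ → ℝ) (u : ℝ) : ℝ :=
  match A with
  | .RWM => iteratedDeriv 1 g u ^ 2
  | .SLA => 5 / 48 * iteratedDeriv 3 g u ^ 2 -
      iteratedDeriv 1 g u * iteratedDeriv 2 g u * iteratedDeriv 3 g u / 8 +
      (iteratedDeriv 1 g u * iteratedDeriv 2 g u) ^ 2 / 16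

lemma continuous_leadVar (hg : RegularPotential g) (A : Algorithm) :
    Continuous (leadVar A g) := by
  have h1 := hg.continuous_iteratedDeriv 1
  have h2 := hg.continuous_iteratedDeriv 2
  have h3 := hg.continuous_iteratedDeriv 3
  cases A <;> unfold leadVar <;> fun_prop

lemma integral_leadCoeff (A : Algorithm) (g : ℝ → ℝ) (u : ℝ) :
    ∫ z, leadCoeff A g u z ∂(gaussianReal 0 1) = 0 := by
  cases A with
  | RWM =>
    simp only [leadCoeff]
    rw [integral_neg, integral_const_mul, integral_gaussian_one]
    simp
  | SLA =>
    simp only [leadCoeff]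
    rw [integral_sub ((integrable_pow_gaussian 3).const_mul _)
      ((by simpa using integrable_pow_gaussian 1 :
        Integrable (fun z : ℝ => z) (gaussianReal 0 1)).const_mul _),
      integral_const_mul, integral_const_mul, integral_gaussian_one, integral_gaussian_three]
    simp

lemma integral_leadCoeff_sq (A : Algorithm) (g : ℝ → ℝ) (u : ℝ) :
    ∫ z, leadCoeff A g u z ^ 2 ∂(gaussianReal 0 1) = leadVar A g u := by
  cases A with
  | RWM =>
    simp only [leadCoeff, leadVar, neg_sq, mul_pow]
    rw [integral_const_mul, integral_gaussian_two, mul_one]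
  | SLA =>
    simp only [leadCoeff, leadVar]
    set a := iteratedDeriv 3 g u / 12 with ha
    set b := iteratedDeriv 1 g u * iteratedDeriv 2 g u / 4 with hb
    have e (z : ℝ) : (a * z ^ 3 - b * z) ^ 2 =
        a ^ 2 * z ^ 6 - 2 * a * b * z ^ 4 + b ^ 2 * z ^ 2 := by ring
    simp only [e]
    have s1 : Integrable (fun z : ℝ => a ^ 2 * z ^ 6 - 2 * a * b * z ^ 4) (gaussianReal 0 1) :=
      ((integrable_pow_gaussian 6).const_mul _).sub ((integrable_pow_gaussian 4).const_mul _)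
    rw [integral_add s1 ((integrable_pow_gaussian 2).const_mul _),
      integral_sub ((integrable_pow_gaussian 6).const_mul _)
        ((integrable_pow_gaussian 4).const_mul _),
      integral_const_mul, integral_const_mul, integral_const_mul, integral_gaussian_two,
      integral_gaussian_four, integral_gaussian_six, ha, hb]
    ring

lemma leadVar_nonneg (A : Algorithm) (g : ℝ → ℝ) (u : ℝ) : 0 ≤ leadVar A g u := by
  rw [← integral_leadCoeff_sq]
  exact integral_nonneg fun z => sq_nonneg _

lemma polyO_leadCoeff (hg : RegularPotential g) (A : Algorithm) :
    PolyO 0 (fun _ u z => leadCoeff A g u z) := by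
  have hd (k : ℕ) : PolyO 0 (fun _ u _ => iteratedDeriv k g u) :=
    (hg.polyGrowth_iteratedDeriv k).comp_fst
  cases A with
  | RWM => exact ((hd 1).mul PolyO.snd).neg
  | SLA =>
    have := (((hd 3).mul (PolyO.snd.pow 3)).const_mul (1 / 12)).sub
      ((((hd 1).mul (hd 2)).mul PolyO.snd).const_mul (1 / 4))
    exact this.congr fun ε _ _ u z => by simp only [leadCoeff]; ring

lemma polyO_leadVar (hg : RegularPotential g) (A : Algorithm) :
    PolyO 0 (fun _ u _ => leadVar A g u) := by
  have hd (k : ℕ) : PolyO 0 (fun _ u _ => iteratedDeriv k g u) :=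
    (hg.polyGrowth_iteratedDeriv k).comp_fst
  cases A with
  | RWM => exact (hd 1).pow 2
  | SLA =>
    have := ((((hd 3).pow 2).const_mul (5 / 48)).sub
      ((((hd 1).mul (hd 2)).mul (hd 3)).const_mul (1 / 8))).add
      ((((hd 1).mul (hd 2)).pow 2).const_mul (1 / 16))
    exact this.congr fun ε _ _ u z => by simp only [leadVar]; ring

lemma PolyGrowth.integrable (hg : RegularPotential g) {h : ℝ → ℝ} (hc : Continuous h)
    (hh : PolyGrowth h) : Integrable fun u => Real.exp (-g u) * h u := by
  obtain ⟨C, N, hC, hb⟩ := hh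
  rw [← integrable_refLaw_iff hg]
  exact ((hg.integrable_one_add_abs_pow N).const_mul C).mono' hc.aestronglyMeasurable
    (ae_of_all _ hb)

/-- Integration by parts against `exp (-g)`. -/
lemma integral_deriv_mul_exp (hg : RegularPotential g) {h h' : ℝ → ℝ}
    (hd : ∀ u, HasDerivAt h (h' u) u) (hc' : Continuous h') (hh : PolyGrowth h)
    (hh' : PolyGrowth h') :
    ∫ u, Real.exp (-g u) * h' u = ∫ u, Real.exp (-g u) * (h u * iteratedDeriv 1 g u) := by
  have hc : Continuous h := continuous_iff_continuousAt.2 fun u => (hd u).continuousAt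
  have i1 := hh'.integrable hg hc'
  have i2 : Integrable fun u => Real.exp (-g u) * (h u * iteratedDeriv 1 g u) :=
    (hh.mul (hg.polyGrowth_iteratedDeriv 1)).integrable hg
      (hc.mul (hg.continuous_iteratedDeriv 1))
  have key := integral_eq_zero_of_hasDerivAt_of_integrable
    (f := fun u => Real.exp (-g u) * h u)
    (f' := fun u => Real.exp (-g u) * h' u - Real.exp (-g u) * (h u * iteratedDeriv 1 g u))
    (fun u => ((hg.hasDerivAt u).neg.exp.mul (hd u)).congr_deriv
      (by simp only [Pi.neg_apply]; ring)) (i1.sub i2)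
    (hh.integrable hg hc)
  rw [integral_sub i1 i2] at key
  linarith

/-- Otherwise `g' ^ 2` has zero derivative, so `g'` is a constant `d`. Integrating by parts against
`1` gives `d = 0`, and against `u` it then gives `1 = 0`: no affine `g` makes `exp (-g)` a
probability density. -/
lemma exists_deriv_mul_deriv_ne_zero (hg : RegularPotential g) :
    ∃ u, iteratedDeriv 1 g u * iteratedDeriv 2 g u ≠ 0 := by
  by_contra! h
  have hsq : ∀ u, iteratedDeriv 1 g u ^ 2 = iteratedDeriv 1 g 0 ^ 2 := fun u =>
    is_const_of_deriv_eq_zero (f := fun u => iteratedDeriv 1 g u ^ 2)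
      (fun u => ((hg.hasDerivAt_iteratedDeriv 1 u).pow 2).differentiableAt)
      (fun u => by
        rw [((hg.hasDerivAt_iteratedDeriv 1 u).fun_pow 2).deriv]
        simpa [mul_assoc] using h u) u 0
  have hconst : ∃ d, ∀ u, iteratedDeriv 1 g u = d := by
    by_cases h0 : iteratedDeriv 1 g 0 = 0
    · exact ⟨0, fun u => by simpa [h0] using hsq u⟩
    · refine ⟨iteratedDeriv 1 g 0, fun u => is_const_of_deriv_eq_zero
        (fun u => (hg.hasDerivAt_iteratedDeriv 1 u).differentiableAt) (fun u => ?_) u 0⟩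
      rw [(hg.hasDerivAt_iteratedDeriv 1 u).deriv]
      refine (mul_eq_zero.1 (h u)).resolve_left fun h1 => h0 ?_
      simpa [h1] using (hsq u).symm
  obtain ⟨d, hd⟩ := hconst
  have gc (a : ℝ) : PolyGrowth fun _ => a := ⟨|a|, 0, abs_nonneg a, fun u => by simp⟩
  have gi : PolyGrowth fun u => u := ⟨1, 1, zero_le_one, fun u => by simp⟩
  have p1 := integral_deriv_mul_exp hg (h := fun _ => 1) (h' := fun _ => 0)
    (fun u => hasDerivAt_const u 1) continuous_const (gc 1) (gc 0)
  have p2 := integral_deriv_mul_exp hg (h := fun u => u) (h' := fun _ => 1)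
    (fun u => hasDerivAt_id u) continuous_const gi (gc 1)
  have hn := hg.normalized
  simp only [hd, mul_one, one_mul, mul_zero, integral_zero, integral_mul_const, hn] at p1 p2
  rw [← p1] at p2
  simp at p2

/-- For SLA, integration by parts with `h = g' * g'' ^ 2` gives `E[(g' g'')²] = E[g''³] + 2 E[g' g''
g''']`. The mixed terms of the variance then cancel. -/
lemma integral_leadVar (hg : RegularPotential g) (A : Algorithm) :
    ∫ u, leadVar A g u ∂(refLaw g) = limitConst A g := by
  rw [integral_refLaw hg]
  cases A with
  | RWM => simp [leadVar, limitConst, mul_comm]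
  | SLA =>
    have c1 := hg.continuous_iteratedDeriv 1
    have c2 := hg.continuous_iteratedDeriv 2
    have c3 := hg.continuous_iteratedDeriv 3
    have g1 := hg.polyGrowth_iteratedDeriv 1
    have g2 := hg.polyGrowth_iteratedDeriv 2
    have g3 := hg.polyGrowth_iteratedDeriv 3
    have gadd {F G : ℝ → ℝ} (hF : PolyGrowth F) (hG : PolyGrowth G) :
        PolyGrowth fun u => F u + G u := by
      obtain ⟨C, N, hC, hb⟩ := hF
      obtain ⟨D, M, hD, hd⟩ := hG
      refine ⟨C + D, N + M, by positivity, fun u => ?_⟩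
      have hw : 1 ≤ 1 + |u| := by linarith [abs_nonneg u]
      have e1 : (1 + |u|) ^ N ≤ (1 + |u|) ^ (N + M) := pow_le_pow_right₀ hw (by omega)
      have e2 : (1 + |u|) ^ M ≤ (1 + |u|) ^ (N + M) := pow_le_pow_right₀ hw (by omega)
      calc |F u + G u| ≤ C * (1 + |u|) ^ N + D * (1 + |u|) ^ M :=
            (abs_add_le _ _).trans (add_le_add (hb u) (hd u))
        _ ≤ C * (1 + |u|) ^ (N + M) + D * (1 + |u|) ^ (N + M) := by gcongr
        _ = _ := by ring
    have g222 := g2.mul (g2.mul g2)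
    have g123 := g1.mul (g2.mul g3)
    have g1122 := (g1.mul (g2.mul g2)).mul g1
    have g33 := g3.mul g3
    have hibp := integral_deriv_mul_exp hg
      (h := fun u => iteratedDeriv 1 g u * (iteratedDeriv 2 g u * iteratedDeriv 2 g u))
      (h' := fun u => iteratedDeriv 2 g u * (iteratedDeriv 2 g u * iteratedDeriv 2 g u) +
        (iteratedDeriv 1 g u * (iteratedDeriv 2 g u * iteratedDeriv 3 g u) +
          iteratedDeriv 1 g u * (iteratedDeriv 2 g u * iteratedDeriv 3 g u)))
      (fun u => ((hg.hasDerivAt_iteratedDeriv 1 u).mul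
        ((hg.hasDerivAt_iteratedDeriv 2 u).mul (hg.hasDerivAt_iteratedDeriv 2 u))).congr_deriv
          (by simp only [Pi.mul_apply]; ring)) (by fun_prop) (g1.mul (g2.mul g2))
      (gadd g222 (gadd g123 g123))
    have i222 := g222.integrable hg (by fun_prop)
    have i123 := g123.integrable hg (by fun_prop)
    have i1122 := g1122.integrable hg (by fun_prop)
    have i33 := g33.integrable hg (by fun_prop)
    have i123' : Integrable fun u => Real.exp (-g u) *
        (iteratedDeriv 1 g u * (iteratedDeriv 2 g u * iteratedDeriv 3 g u)) +
        Real.exp (-g u) * (iteratedDeriv 1 g u * (iteratedDeriv 2 g u * iteratedDeriv 3 g u)) :=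
      i123.add i123
    simp only [mul_add] at hibp
    rw [integral_add i222 i123', integral_add i123 i123] at hibp
    have e1 : ∀ u, Real.exp (-g u) * leadVar .SLA g u =
        5 / 48 * (Real.exp (-g u) * (iteratedDeriv 3 g u * iteratedDeriv 3 g u)) -
        1 / 8 * (Real.exp (-g u) *
          (iteratedDeriv 1 g u * (iteratedDeriv 2 g u * iteratedDeriv 3 g u))) +
        1 / 16 * (Real.exp (-g u) * ((iteratedDeriv 1 g u *
          (iteratedDeriv 2 g u * iteratedDeriv 2 g u)) * iteratedDeriv 1 g u)) := fun u => by
      simp only [leadVar]; ring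
    have e2 : ∀ u, (3 * iteratedDeriv 2 g u ^ 3 + 5 * iteratedDeriv 3 g u ^ 2) *
        Real.exp (-g u) =
        3 * (Real.exp (-g u) *
          (iteratedDeriv 2 g u * (iteratedDeriv 2 g u * iteratedDeriv 2 g u))) +
        5 * (Real.exp (-g u) * (iteratedDeriv 3 g u * iteratedDeriv 3 g u)) := fun u => by ring
    simp only [limitConst, e1, e2]
    have s1 : Integrable fun u =>
        5 / 48 * (Real.exp (-g u) * (iteratedDeriv 3 g u * iteratedDeriv 3 g u)) -
        1 / 8 * (Real.exp (-g u) *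
          (iteratedDeriv 1 g u * (iteratedDeriv 2 g u * iteratedDeriv 3 g u))) :=
      (i33.const_mul _).sub (i123.const_mul _)
    rw [integral_add s1 (i1122.const_mul _),
      integral_sub (i33.const_mul _) (i123.const_mul _),
      integral_add (i222.const_mul _) (i33.const_mul _)]
    simp only [integral_const_mul]
    linarith

theorem limitConst_pos (hg : RegularPotential g) (A : Algorithm) : 0 < limitConst A g := by
  have hgr : PolyGrowth (leadVar A g) := by
    obtain ⟨C, N, hC, hb⟩ := polyO_leadVar hg A
    exact ⟨C, N, hC, fun u => by simpa using hb 1 one_pos le_rfl u 0⟩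
  have hc := continuous_leadVar hg A
  have hcg := hg.smooth.continuous
  rw [← integral_leadVar hg, integral_refLaw hg]
  obtain ⟨u, hu⟩ := exists_deriv_mul_deriv_ne_zero hg
  refine integral_pos_of_integrable_nonneg_nonzero (x := u) (by fun_prop) (hgr.integrable hg hc)
    (fun u => mul_nonneg (Real.exp_nonneg _) (leadVar_nonneg A g u)) ?_
  refine mul_ne_zero (Real.exp_ne_zero _) ?_
  cases A with
  | RWM => exact pow_ne_zero 2 (left_ne_zero_of_mul hu)
  | SLA =>
    simp only [leadVar]
    set x := iteratedDeriv 1 g u * iteratedDeriv 2 g u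
    have : 0 < x ^ 2 := by positivity
    -- The variance is a positive definite quadratic form in `g'''` and `x`. The hint is its
    -- completed square, which leaves a positive multiple of `x ^ 2`.
    nlinarith [sq_nonneg (iteratedDeriv 3 g u - 3 / 5 * x)]

end LeadingCoefficient

/-! ### Elementary inequalities for the exponential. -/

section ScalarInequalities

/-- Applied to the log ratio, this turns the identity of `integral_logRatio_div` into a relation
between first and second moments, with a cubic error. A quadratic bound on `exp (-t) - 1 + t` covers
`|t| ≤ 1`; beyond that the crude size `1 / 2 + |t| / 4` is below `t ^ 2`. -/
lemma abs_mul_sigmoid_sub_le (t : ℝ) :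
    |t / (1 + Real.exp (-t)) - (t / 2 + t ^ 2 / 4)| ≤ |t| ^ 3 := by
  set q := Real.exp (-t) with hq
  have hq0 : 0 < q := Real.exp_pos _
  have e : t / (1 + q) - (t / 2 + t ^ 2 / 4) = t * (1 / (1 + q) - 1 / 2 - t / 4) := by ring
  rw [e, abs_mul, pow_succ' |t| 2]
  refine mul_le_mul_of_nonneg_left ?_ (abs_nonneg t)
  rw [sq_abs]
  rcases le_total |t| 1 with h | h
  · have hb : |q - 1 - (-t)| ≤ (-t) ^ 2 := Real.abs_exp_sub_one_sub_id_le (by rwa [abs_neg])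
    obtain ⟨h1, h2⟩ := abs_le.1 hb
    obtain ⟨h3, h4⟩ := abs_le.1 h
    have e2 : 1 / (1 + q) - 1 / 2 - t / 4 = (2 * (1 - q) - t * (1 + q)) / (4 * (1 + q)) := by
      field_simp
      ring
    rw [e2, abs_div, abs_of_pos (by positivity : 0 < 4 * (1 + q)), div_le_iff₀ (by positivity)]
    rw [abs_le]
    constructor <;> nlinarith [sq_nonneg t, mul_nonneg (sq_nonneg t) hq0.le]
  · have h1 : 1 / (1 + q) ≤ 1 := by
      rw [div_le_one (by positivity)]; linarith
    have h2 : 0 ≤ 1 / (1 + q) := by positivity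
    have h3 : |1 / (1 + q) - 1 / 2| ≤ 1 / 2 := by
      rw [abs_le]; constructor <;> linarith
    have h4 : |1 / (1 + q) - 1 / 2 - t / 4| ≤ 1 / 2 + |t| / 4 := by
      refine (abs_sub _ _).trans ?_
      rw [abs_div t 4, abs_of_pos (four_pos : (0 : ℝ) < 4)]
      linarith
    nlinarith [sq_abs t]

/-- With `q = exp (t / 2)` the gap `1 / 2 + q ^ 2 / 2 - q` is `(1 - q) ^ 2 / 2`. For `|t| ≤ 1` one
has `|1 - q| ≥ |t| / 4`, and for `|t| ≥ 1` the quantity `t ^ 2 - t ^ 4` is not positive. The bound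
keeps `exp t`, whose mean is exactly `1`. -/
lemma exp_half_le (t : ℝ) :
    Real.exp (t / 2) ≤ 1 / 2 + Real.exp t / 2 - (t ^ 2 - t ^ 4) / 32 := by
  have e : Real.exp t = Real.exp (t / 2) ^ 2 := by
    rw [← Real.exp_nat_mul]; congr 1; push_cast; ring
  set q := Real.exp (t / 2) with hq
  have hq0 : 0 < q := Real.exp_pos _
  suffices h : t ^ 2 - t ^ 4 ≤ 16 * (1 - q) ^ 2 by rw [e]; nlinarith
  rcases le_total |t| 1 with h | h
  · have key : |t| / 4 ≤ |1 - q| := by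
      rcases le_total 0 t with ht | ht
      · have h1 : t / 2 + 1 ≤ q := Real.add_one_le_exp _
        rw [abs_of_nonneg ht, abs_of_nonpos (by linarith)]
        linarith
      · have h1 : -(t / 2) + 1 ≤ Real.exp (-(t / 2)) := Real.add_one_le_exp _
        rw [Real.exp_neg, ← hq] at h1
        have h2 : (1 - t / 2) * q ≤ 1 := by
          have := mul_le_mul_of_nonneg_right h1 hq0.le
          rw [inv_mul_cancel₀ hq0.ne'] at this
          linarith
        rw [abs_of_nonpos ht] at h ⊢
        refine le_trans ?_ (le_abs_self _)
        nlinarith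
    have := pow_le_pow_left₀ (by positivity) key 2
    rw [div_pow, sq_abs, sq_abs] at this
    nlinarith [sq_nonneg (t ^ 2)]
  · have h1 : 1 ≤ t ^ 2 := by rw [← sq_abs]; nlinarith
    nlinarith [sq_nonneg (1 - q)]

lemma norm_exp_mul_I_sub_le (x : ℝ) :
    ‖Complex.exp (x * Complex.I) - (1 + x * Complex.I - x ^ 2 / 2)‖ ≤ 4 * |x| ^ 3 := by
  have hn : ‖(x : ℂ) * Complex.I‖ = |x| := by simp
  rcases le_total |x| 1 with h | h
  · have := Complex.exp_bound (x := x * Complex.I) (by rwa [hn]) (n := 3) (by norm_num)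
    rw [hn] at this
    have e : ∑ m ∈ Finset.range 3, (x * Complex.I) ^ m / (m.factorial : ℂ) =
        1 + x * Complex.I - x ^ 2 / 2 := by
      simp [Finset.sum_range_succ, Nat.factorial, mul_pow]
      ring
    rw [e] at this
    refine this.trans ?_
    have h3 : 0 ≤ |x| ^ 3 := by positivity
    rw [mul_comm]
    refine mul_le_mul_of_nonneg_right ?_ h3
    norm_num [Nat.factorial]
  · have h1 : ‖Complex.exp (x * Complex.I)‖ = 1 := Complex.norm_exp_ofReal_mul_I x
    calc _ ≤ ‖Complex.exp (x * Complex.I)‖ + ‖(1 + x * Complex.I - x ^ 2 / 2 : ℂ)‖ :=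
          norm_sub_le _ _
      _ ≤ 1 + ((1 + |x|) + |x| ^ 2 / 2) := by
          rw [h1]
          gcongr
          refine (norm_sub_le _ _).trans ?_
          gcongr
          · refine (norm_add_le _ _).trans ?_
            rw [hn, norm_one]
          · simp
      _ ≤ 4 * |x| ^ 3 := by nlinarith [mul_nonneg (sub_nonneg.2 h) (sub_nonneg.2 h), sq_abs x]

lemma abs_exp_neg_sub_le {a : ℝ} (ha : 0 ≤ a) : |Real.exp (-a) - (1 - a)| ≤ a ^ 2 := by
  rcases le_total a 1 with h | h
  · have := Real.abs_exp_sub_one_sub_id_le (x := -a) (by rwa [abs_neg, abs_of_nonneg ha])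
    rw [neg_sq] at this
    convert this using 2
    ring
  · have h1 := Real.add_one_le_exp (-a)
    have h2 : Real.exp (-a) ≤ 1 := Real.exp_le_one_iff.2 (by linarith)
    rw [abs_le]
    constructor <;> nlinarith

end ScalarInequalities

/-! ### Moment estimates for one coordinate. -/

section CoordinateEstimates

lemma one_le_order (A : Algorithm) : 1 ≤ order A := by cases A <;> simp [order]

lemma polyO_eps_pow_mul_leadCoeff (hg : RegularPotential g) (A : Algorithm) :
    PolyO (order A) (fun ε u z => ε ^ order A * leadCoeff A g u z) := by
  simpa using (PolyO.eps_pow (order A)).mul (polyO_leadCoeff hg A)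

lemma polyO_logRatio (hg : RegularPotential g) (A : Algorithm) :
    PolyO (order A) (logRatio A g) :=
  (((logRatio_sub_leadCoeff hg A).mono (Nat.le_succ _)).add
    (polyO_eps_pow_mul_leadCoeff hg A)).congr fun ε _ _ u z => by ring

/-- A difference of squares: one factor has order `order A + 1`, the other `order A`. -/
lemma polyO_logRatio_sq_sub (hg : RegularPotential g) (A : Algorithm) :
    PolyO (2 * order A + 1) (fun ε u z =>
      logRatio A g ε u z ^ 2 - ε ^ (2 * order A) * leadCoeff A g u z ^ 2) := by
  have := (logRatio_sub_leadCoeff hg A).mul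
    ((polyO_logRatio hg A).add (polyO_eps_pow_mul_leadCoeff hg A))
  rw [show order A + 1 + order A = 2 * order A + 1 by ring] at this
  exact this.congr fun ε _ _ u z => by ring

lemma integral_coord_leadCoeff_sq (hg : RegularPotential g) (A : Algorithm) :
    ∫ w, leadCoeff A g w.1 w.2 ^ 2 ∂(coordLaw g) = limitConst A g := by
  have := hg.isProbabilityMeasure_refLaw
  have hi : Integrable (fun w : ℝ × ℝ => leadCoeff A g w.1 w.2 ^ 2) (coordLaw g) :=
    ((polyO_leadCoeff hg A).pow 2).integrable hg
      (fun _ => (measurable_leadCoeff hg A).pow_const 2) one_pos le_rfl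
  rw [coordLaw, integral_prod _ hi]
  simp only [integral_leadCoeff_sq]
  exact integral_leadVar hg A

lemma integral_coord_leadCoeff (hg : RegularPotential g) (A : Algorithm) :
    ∫ w, leadCoeff A g w.1 w.2 ∂(coordLaw g) = 0 := by
  have := hg.isProbabilityMeasure_refLaw
  have hi : Integrable (fun w : ℝ × ℝ => leadCoeff A g w.1 w.2) (coordLaw g) :=
    (polyO_leadCoeff hg A).integrable hg (fun _ => measurable_leadCoeff hg A) one_pos le_rfl
  rw [coordLaw, integral_prod _ hi]
  simp [integral_leadCoeff]

lemma integrable_logRatio (hg : RegularPotential g) (A : Algorithm) {ε : ℝ} (h0 : 0 < ε)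
    (h1 : ε ≤ 1) : Integrable (fun w : ℝ × ℝ => logRatio A g ε w.1 w.2) (coordLaw g) :=
  (polyO_logRatio hg A).integrable hg (measurable_logRatio hg A) h0 h1

/-- The second moment of the log ratio, to leading order. -/
lemma abs_integral_logRatio_sq_sub (hg : RegularPotential g) (A : Algorithm) :
    ∃ C : ℝ, 0 ≤ C ∧ ∀ ε : ℝ, 0 < ε → ε ≤ 1 →
      |∫ w, logRatio A g ε w.1 w.2 ^ 2 ∂(coordLaw g) - ε ^ (2 * order A) * limitConst A g| ≤
        C * ε ^ (2 * order A + 1) := by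
  obtain ⟨C, hC, hb⟩ := (polyO_logRatio_sq_sub hg A).abs_integral_le hg
  refine ⟨C, hC, fun ε h0 h1 => ?_⟩
  have := hb ε h0 h1
  rwa [integral_sub, integral_const_mul, integral_coord_leadCoeff_sq hg] at this
  · exact ((polyO_logRatio hg A).pow 2).integrable hg
      (fun ε => (measurable_logRatio hg A ε).pow_const 2) h0 h1
  · exact (((polyO_leadCoeff hg A).pow 2).integrable hg
      (fun _ => (measurable_leadCoeff hg A).pow_const 2) h0 h1).const_mul _

/-- The mean of the log ratio is minus half its second moment, to leading order. -/
theorem abs_integral_logRatio_add (hg : RegularPotential g) (A : Algorithm) :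
    ∃ C : ℝ, 0 ≤ C ∧ ∀ ε : ℝ, 0 < ε → ε ≤ 1 →
      |∫ w, logRatio A g ε w.1 w.2 ∂(coordLaw g) + ε ^ (2 * order A) * (limitConst A g / 2)| ≤
        C * ε ^ (2 * order A + 1) := by
  obtain ⟨C, hC, hb⟩ := abs_integral_logRatio_sq_sub hg A
  have hk := one_le_order A
  -- The cubic error has order `3 * order A`, which is at least `2 * order A + 1` because `order A ≥
  -- 1`.
  have hF : PolyO (2 * order A + 1) (fun ε u z =>
      logRatio A g ε u z / (1 + Real.exp (-logRatio A g ε u z)) -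
        (logRatio A g ε u z / 2 + logRatio A g ε u z ^ 2 / 4)) :=
    (((polyO_logRatio hg A).abs.pow 3).mono (by omega)).of_abs_le fun ε _ _ u z =>
      (abs_mul_sigmoid_sub_le _).trans (le_abs_self _)
  have hFm (ε : ℝ) : Measurable fun w : ℝ × ℝ =>
      logRatio A g ε w.1 w.2 / (1 + Real.exp (-logRatio A g ε w.1 w.2)) -
        (logRatio A g ε w.1 w.2 / 2 + logRatio A g ε w.1 w.2 ^ 2 / 4) := by
    have := measurable_logRatio hg A ε
    fun_prop
  obtain ⟨D, hD, hd⟩ := hF.abs_integral_le hg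
  -- The vanishing integral gives `E R / 2 + E R² / 4 = O(D)`. Doubling it produces `2 * D`, and
  -- half the error of the second moment produces `C / 2`.
  refine ⟨C / 2 + 2 * D, by positivity, fun ε h0 h1 => ?_⟩
  have hb := hb ε h0 h1
  have hd := hd ε h0 h1
  have i1 := integrable_logRatio hg A h0 h1
  have i2 := ((polyO_logRatio hg A).pow 2).integrable hg
      (fun ε => (measurable_logRatio hg A ε).pow_const 2) h0 h1
  have i12 : Integrable (fun w : ℝ × ℝ =>
      logRatio A g ε w.1 w.2 / 2 + logRatio A g ε w.1 w.2 ^ 2 / 4) (coordLaw g) :=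
    (i1.div_const 2).add (i2.div_const 4)
  have i3 : Integrable (fun w : ℝ × ℝ =>
      logRatio A g ε w.1 w.2 / (1 + Real.exp (-logRatio A g ε w.1 w.2))) (coordLaw g) := by
    refine i1.mono (((measurable_logRatio hg A ε).div (by
      have := measurable_logRatio hg A ε; fun_prop)).aestronglyMeasurable) (ae_of_all _ fun w => ?_)
    rw [norm_div]
    refine div_le_self (norm_nonneg _) ?_
    rw [Real.norm_of_nonneg (by positivity)]
    linarith [Real.exp_pos (-logRatio A g ε w.1 w.2)]
  rw [integral_sub i3 i12, integral_add (i1.div_const 2) (i2.div_const 4), integral_div,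
    integral_div, integral_logRatio_div hg A h0] at hd
  rw [abs_le] at hb hd ⊢
  constructor <;> linarith [hb.1, hb.2, hd.1, hd.2]

/-- The mean square of the error of the leading term. -/
lemma integral_sq_logRatio_sub (hg : RegularPotential g) (A : Algorithm) :
    ∃ C : ℝ, 0 ≤ C ∧ ∀ ε : ℝ, 0 < ε → ε ≤ 1 →
      ∫ w, (logRatio A g ε w.1 w.2 - ε ^ order A * leadCoeff A g w.1 w.2) ^ 2 ∂(coordLaw g) ≤
        C * ε ^ (2 * order A + 1) := by
  obtain ⟨C, hC, hb⟩ :=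
    (((logRatio_sub_leadCoeff hg A).pow 2).mono (show 2 * order A + 1 ≤ _ by omega)).abs_integral_le
      hg
  exact ⟨C, hC, fun ε h0 h1 => (le_abs_self _).trans (hb ε h0 h1)⟩

lemma integrable_exp_half_logRatio (hg : RegularPotential g) (A : Algorithm) {ε : ℝ}
    (h0 : 0 < ε) :
    Integrable (fun w : ℝ × ℝ => Real.exp (logRatio A g ε w.1 w.2 / 2)) (coordLaw g) := by
  have := hg.isProbabilityMeasure_coordLaw
  have hm := measurable_logRatio hg A ε
  refine ((integrable_const 1).add (integrable_exp_logRatio hg A h0)).mono'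
    (by fun_prop) (ae_of_all _ fun w => ?_)
  rw [Real.norm_of_nonneg (Real.exp_nonneg _)]
  rcases le_total (logRatio A g ε w.1 w.2) 0 with h | h
  · have h1 : Real.exp (logRatio A g ε w.1 w.2 / 2) ≤ 1 := Real.exp_le_one_iff.2 (by linarith)
    have h2 := Real.exp_pos (logRatio A g ε w.1 w.2)
    simp only [Pi.add_apply]
    linarith
  · have h1 : Real.exp (logRatio A g ε w.1 w.2 / 2) ≤ Real.exp (logRatio A g ε w.1 w.2) :=
      Real.exp_le_exp.2 (by linarith)
    simp only [Pi.add_apply]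
    linarith

/-- The Hellinger affinity of the two directions of the move. -/
theorem integral_exp_half_logRatio_le (hg : RegularPotential g) (A : Algorithm) :
    ∃ C : ℝ, 0 ≤ C ∧ ∀ ε : ℝ, 0 < ε → ε ≤ 1 →
      ∫ w, Real.exp (logRatio A g ε w.1 w.2 / 2) ∂(coordLaw g) ≤
        1 - ε ^ (2 * order A) * (limitConst A g / 32) + C * ε ^ (2 * order A + 1) := by
  obtain ⟨C, hC, hb⟩ := abs_integral_logRatio_sq_sub hg A
  have hk := one_le_order A
  obtain ⟨D, hD, hd⟩ := (((polyO_logRatio hg A).pow 4).mono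
    (show 2 * order A + 1 ≤ _ by omega)).abs_integral_le hg
  refine ⟨C / 32 + D / 32, by positivity, fun ε h0 h1 => ?_⟩
  have := hg.isProbabilityMeasure_coordLaw
  have hb := (abs_le.1 (hb ε h0 h1)).1
  have hd := (abs_le.1 (hd ε h0 h1)).2
  have i2 := ((polyO_logRatio hg A).pow 2).integrable hg
      (fun ε => (measurable_logRatio hg A ε).pow_const 2) h0 h1
  have i4 := ((polyO_logRatio hg A).pow 4).integrable hg
      (fun ε => (measurable_logRatio hg A ε).pow_const 4) h0 h1
  have ie := integrable_exp_logRatio hg A h0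
  have i24 : Integrable (fun w : ℝ × ℝ =>
      (logRatio A g ε w.1 w.2 ^ 2 - logRatio A g ε w.1 w.2 ^ 4) / 32) (coordLaw g) :=
    (i2.sub i4).div_const 32
  have ic : Integrable (fun w : ℝ × ℝ =>
      1 / 2 + Real.exp (logRatio A g ε w.1 w.2) / 2) (coordLaw g) :=
    (integrable_const (1 / 2)).add (ie.div_const 2)
  have key := integral_mono (integrable_exp_half_logRatio hg A h0) (ic.sub i24)
    (fun w => exp_half_le (logRatio A g ε w.1 w.2))
  simp only [Pi.sub_apply] at key
  have e24 : ∫ w, (logRatio A g ε w.1 w.2 ^ 2 - logRatio A g ε w.1 w.2 ^ 4) / 32 ∂(coordLaw g) =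
      (∫ w, logRatio A g ε w.1 w.2 ^ 2 ∂(coordLaw g) -
        ∫ w, logRatio A g ε w.1 w.2 ^ 4 ∂(coordLaw g)) / 32 := by
    rw [integral_div, integral_sub i2 i4]
  have ec : ∫ w, (1 / 2 + Real.exp (logRatio A g ε w.1 w.2) / 2) ∂(coordLaw g) = 1 := by
    rw [integral_add (integrable_const _) (ie.div_const 2), integral_div _ (fun w : ℝ × ℝ =>
      Real.exp (logRatio A g ε w.1 w.2)), integral_exp_logRatio hg A h0]
    simp
    norm_num
  rw [integral_sub ic i24, ec, e24] at key
  linarith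

/-- The characteristic function of a centred variable, to second order. -/
lemma norm_integral_exp_mul_I_sub_le {Ω : Type*} [MeasurableSpace Ω] {μ : Measure Ω}
    [IsProbabilityMeasure μ] {X : Ω → ℝ} (hX : Measurable X)
    (h3 : Integrable (fun x => |X x| ^ 3) μ) (hmean : ∫ x, X x ∂μ = 0) (s : ℝ) :
    ‖∫ x, Complex.exp ((s * X x : ℝ) * Complex.I) ∂μ -
      ((1 - s ^ 2 / 2 * ∫ x, X x ^ 2 ∂μ : ℝ) : ℂ)‖ ≤ 4 * |s| ^ 3 * ∫ x, |X x| ^ 3 ∂μ := by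
  -- Both `|X|` and `X ^ 2` are at most `1 + |X| ^ 3`.
  have ib : Integrable (fun x => 1 + |X x| ^ 3) μ := (integrable_const 1).add h3
  have ic1 : Integrable X μ :=
    ib.mono' hX.aestronglyMeasurable (ae_of_all _ fun z => by
      rw [Real.norm_eq_abs]
      nlinarith [abs_nonneg (X z), sq_nonneg (|X z| - 1),
        mul_nonneg (abs_nonneg (X z)) (sq_nonneg (|X z| - 1))])
  have ic2 : Integrable (fun x => X x ^ 2) μ :=
    ib.mono' (hX.pow_const 2).aestronglyMeasurable (ae_of_all _ fun z => by
      rw [Real.norm_of_nonneg (by positivity), ← sq_abs]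
      rcases le_total |X z| 1 with h | h
      · nlinarith [abs_nonneg (X z), pow_nonneg (abs_nonneg (X z)) 3]
      · nlinarith [mul_nonneg (sq_nonneg |X z|) (sub_nonneg.2 h)])
  have e (z : Ω) : (1 + ((s * X z : ℝ) : ℂ) * Complex.I - ((s * X z : ℝ) : ℂ) ^ 2 / 2) =
      ((1 - s ^ 2 / 2 * X z ^ 2 : ℝ) : ℂ) + ((X z : ℝ) : ℂ) * (s * Complex.I) := by
    push_cast; ring
  have j1 : Integrable (fun z => ((1 - s ^ 2 / 2 * X z ^ 2 : ℝ) : ℂ)) μ :=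
    ((integrable_const 1).sub (ic2.const_mul _)).ofReal
  have j2 : Integrable (fun z => ((X z : ℝ) : ℂ) * (s * Complex.I)) μ :=
    ic1.ofReal.mul_const _
  have hq : ∫ z, (1 + ((s * X z : ℝ) : ℂ) * Complex.I - ((s * X z : ℝ) : ℂ) ^ 2 / 2) ∂μ =
      ((1 - s ^ 2 / 2 * ∫ x, X x ^ 2 ∂μ : ℝ) : ℂ) := by
    simp only [e]
    rw [integral_add j1 j2, integral_mul_const, integral_complex_ofReal,
      integral_complex_ofReal, hmean, integral_sub (integrable_const 1) (ic2.const_mul _),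
      integral_const_mul]
    simp
  have iq : Integrable
      (fun z => (1 + ((s * X z : ℝ) : ℂ) * Complex.I - ((s * X z : ℝ) : ℂ) ^ 2 / 2)) μ := by
    simp only [e]
    exact j1.add j2
  have ie : Integrable (fun z => Complex.exp ((s * X z : ℝ) * Complex.I)) μ :=
    (integrable_const (1 : ℝ)).mono' (by fun_prop) (ae_of_all _ fun z => by
      rw [Complex.norm_exp_ofReal_mul_I])
  rw [← hq, ← integral_sub ie iq, ← integral_const_mul]
  refine norm_integral_le_of_norm_le (h3.const_mul _) (ae_of_all _ fun z => ?_)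
  refine (norm_exp_mul_I_sub_le _).trans (le_of_eq ?_)
  rw [abs_mul, mul_pow]
  ring

lemma measurable_leadCoeff_right (hg : RegularPotential g) (A : Algorithm) (u : ℝ) :
    Measurable (leadCoeff A g u) :=
  ((continuous_leadCoeff hg A).comp (f := fun z : ℝ => (u, z)) (by fun_prop)).measurable

lemma integral_abs_leadCoeff_cube_le (hg : RegularPotential g) (A : Algorithm) :
    ∃ (C : ℝ) (N : ℕ), 0 ≤ C ∧ ∀ u : ℝ,
      Integrable (fun z => |leadCoeff A g u z| ^ 3) (gaussianReal 0 1) ∧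
      ∫ z, |leadCoeff A g u z| ^ 3 ∂(gaussianReal 0 1) ≤ C * (1 + |u|) ^ N := by
  obtain ⟨C, N, hC, hb⟩ := (polyO_leadCoeff hg A).abs.pow 3
  simp only [zero_mul, pow_zero, mul_one] at hb
  refine ⟨C * ∫ z, (1 + |z|) ^ N ∂(gaussianReal 0 1), N,
    mul_nonneg hC (integral_nonneg fun z => by positivity), fun u => ?_⟩
  have hw (z : ℝ) : |leadCoeff A g u z| ^ 3 ≤ C * (1 + |u|) ^ N * (1 + |z|) ^ N := by
    have := hb 1 one_pos le_rfl u z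
    rw [abs_pow, abs_abs] at this
    refine this.trans ?_
    rw [mul_assoc, ← mul_pow]
    gcongr
    nlinarith [mul_nonneg (abs_nonneg u) (abs_nonneg z)]
  have hcm := measurable_leadCoeff_right hg A u
  have i3 : Integrable (fun z => C * (1 + |u|) ^ N * (1 + |z|) ^ N) (gaussianReal 0 1) :=
    (RegularPotential.integrable_gaussian_one_add_abs_pow N).const_mul _
  have ii : Integrable (fun z => |leadCoeff A g u z| ^ 3) (gaussianReal 0 1) :=
    i3.mono' (by fun_prop) (ae_of_all _ fun z => by
      rw [Real.norm_of_nonneg (by positivity)]; exact hw z)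
  refine ⟨ii, (integral_mono ii i3 hw).trans (le_of_eq ?_)⟩
  rw [integral_const_mul]
  ring

/-- The conditional characteristic function of the leading term. -/
theorem norm_charFun_leadCoeff_sub_le (hg : RegularPotential g) (A : Algorithm) :
    ∃ (C : ℝ) (N : ℕ), 0 ≤ C ∧ ∀ t ε : ℝ, 0 < ε → ε ≤ 1 → ∀ u : ℝ,
      ‖∫ z, Complex.exp ((t * (ε ^ order A * leadCoeff A g u z) : ℝ) * Complex.I)
          ∂(gaussianReal 0 1) -
        (Real.exp (-(t ^ 2 / 2 * (ε ^ (2 * order A) * leadVar A g u))) : ℝ)‖ ≤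
      C * (|t| ^ 3 + t ^ 4) * ε ^ (2 * order A + 1) * (1 + |u|) ^ N := by
  obtain ⟨C, N, hC, hb⟩ := integral_abs_leadCoeff_cube_le hg A
  obtain ⟨D, M, hD, hd⟩ := (polyO_leadVar hg A).pow 2
  simp only [zero_mul, pow_zero, mul_one] at hd
  have hk := one_le_order A
  refine ⟨4 * C + D, N + M, by positivity, fun t ε h0 h1 u => ?_⟩
  set s := t * ε ^ order A with hs
  have hcm := measurable_leadCoeff_right hg A u
  have hx (z : ℝ) : t * (ε ^ order A * leadCoeff A g u z) = s * leadCoeff A g u z := by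
    rw [hs]; ring
  simp only [hx]
  -- Both sides are compared with `1 - s ^ 2 / 2 * leadVar A g u`: the characteristic function
  -- through the third absolute moment, the Gaussian factor through `|exp (-a) - (1 - a)| ≤ a ^ 2`.
  have b1 := norm_integral_exp_mul_I_sub_le hcm (hb u).1 (integral_leadCoeff A g u) s
  rw [integral_leadCoeff_sq] at b1
  replace b1 := b1.trans (mul_le_mul_of_nonneg_left (hb u).2 (by positivity))
  have hV := leadVar_nonneg A g u
  have ea : t ^ 2 / 2 * (ε ^ (2 * order A) * leadVar A g u) = s ^ 2 / 2 * leadVar A g u := by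
    rw [hs]; ring
  have hN : (1 + |u|) ^ N ≤ (1 + |u|) ^ (N + M) :=
    pow_le_pow_right₀ (by linarith [abs_nonneg u]) (by omega)
  have hM : (1 + |u|) ^ M ≤ (1 + |u|) ^ (N + M) :=
    pow_le_pow_right₀ (by linarith [abs_nonneg u]) (by omega)
  have b2 : ‖((1 - s ^ 2 / 2 * leadVar A g u : ℝ) : ℂ) -
      (Real.exp (-(t ^ 2 / 2 * (ε ^ (2 * order A) * leadVar A g u))) : ℝ)‖ ≤
      s ^ 4 * (D * (1 + |u|) ^ M) := by
    rw [← Complex.ofReal_sub, Complex.norm_real, Real.norm_eq_abs, abs_sub_comm, ea]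
    refine (abs_exp_neg_sub_le (by positivity)).trans ?_
    have h6 := hd 1 one_pos le_rfl u 0
    rw [abs_of_nonneg (sq_nonneg _), abs_zero, add_zero] at h6
    calc (s ^ 2 / 2 * leadVar A g u) ^ 2 = s ^ 4 * (leadVar A g u ^ 2 / 4) := by ring
      _ ≤ s ^ 4 * (D * (1 + |u|) ^ M) := by
        gcongr
        linarith [sq_nonneg (leadVar A g u)]
  have s3 : |s| ^ 3 ≤ |t| ^ 3 * ε ^ (2 * order A + 1) := by
    rw [hs, abs_mul, mul_pow, abs_of_pos (pow_pos h0 _), ← pow_mul]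
    have : ε ^ (order A * 3) ≤ ε ^ (2 * order A + 1) :=
      pow_le_pow_of_le_one h0.le h1 (by omega)
    gcongr
  have s4 : s ^ 4 ≤ t ^ 4 * ε ^ (2 * order A + 1) := by
    rw [hs, mul_pow, ← pow_mul]
    have : ε ^ (order A * 4) ≤ ε ^ (2 * order A + 1) :=
      pow_le_pow_of_le_one h0.le h1 (by omega)
    gcongr
  have p1 : 0 ≤ |t| ^ 3 * ε ^ (2 * order A + 1) * (1 + |u|) ^ (N + M) := by positivity
  have p2 : 0 ≤ t ^ 4 * ε ^ (2 * order A + 1) * (1 + |u|) ^ (N + M) := by positivity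
  calc _ ≤ 4 * |s| ^ 3 * (C * (1 + |u|) ^ N) + s ^ 4 * (D * (1 + |u|) ^ M) :=
        (norm_sub_le_norm_sub_add_norm_sub _ _ _).trans (add_le_add b1 b2)
    _ ≤ 4 * (|t| ^ 3 * ε ^ (2 * order A + 1)) * (C * (1 + |u|) ^ (N + M)) +
        (t ^ 4 * ε ^ (2 * order A + 1)) * (D * (1 + |u|) ^ (N + M)) := by gcongr
    _ = 4 * C * (|t| ^ 3 * ε ^ (2 * order A + 1) * (1 + |u|) ^ (N + M)) +
        D * (t ^ 4 * ε ^ (2 * order A + 1) * (1 + |u|) ^ (N + M)) := by ring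
    -- The two nonnegative cross terms are added so that the sum factors as `(4 * C + D) * (|t| ^ 3
    -- + t ^ 4)`.
    _ ≤ 4 * C * (|t| ^ 3 * ε ^ (2 * order A + 1) * (1 + |u|) ^ (N + M)) +
        D * (t ^ 4 * ε ^ (2 * order A + 1) * (1 + |u|) ^ (N + M)) +
        (D * (|t| ^ 3 * ε ^ (2 * order A + 1) * (1 + |u|) ^ (N + M)) +
        4 * C * (t ^ 4 * ε ^ (2 * order A + 1) * (1 + |u|) ^ (N + M))) :=
        le_add_of_nonneg_right (by positivity)
    _ = _ := by ring

end CoordinateEstimates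

/-! ### General tools: weak law in `L¹`, telescoping products, Lipschitz bounds. -/

section General

/-- The variance of `|f|` is nonnegative. -/
lemma integral_abs_le_sqrt {Ω : Type*} [MeasurableSpace Ω] {μ : Measure Ω}
    [IsProbabilityMeasure μ] {f : Ω → ℝ} (hf : MemLp f 2 μ) :
    ∫ x, |f x| ∂μ ≤ √(∫ x, f x ^ 2 ∂μ) := by
  refine Real.le_sqrt_of_sq_le ?_
  have h := variance_nonneg (fun x => ‖f x‖) μ
  rw [variance_eq_sub hf.norm] at h
  simpa using h

/-- A quantitative law of large numbers: coordinates are independent under the product measure, so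
variances add, and each is at most the second moment. -/
lemma integral_abs_sum_sub_le {ι Ω : Type*} [Fintype ι] [MeasurableSpace Ω] {μ : Measure Ω}
    [IsProbabilityMeasure μ] {X : ι → Ω → ℝ} (hX : ∀ i, MemLp (X i) 2 μ) :
    ∫ w : ι → Ω, |∑ i, X i (w i) - ∑ i, ∫ x, X i x ∂μ| ∂(Measure.pi fun _ => μ) ≤
      √(∑ i, ∫ x, X i x ^ 2 ∂μ) := by
  set P : Measure (ι → Ω) := Measure.pi fun _ => μ with hP
  have hi (i : ι) : MemLp (fun w : ι → Ω => X i (w i)) 2 P :=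
    (hX i).comp_measurePreserving (measurePreserving_eval (fun _ => μ) i)
  have hE (i : ι) : ∫ w, X i (w i) ∂P = ∫ x, X i x ∂μ :=
    integral_comp_eval (μ := fun _ => μ) (hX i).aestronglyMeasurable
  have hY : MemLp (∑ i, fun w : ι → Ω => X i (w i)) 2 P := memLp_finsetSum' _ fun i _ => hi i
  have hYE : ∫ w, (∑ i, fun w : ι → Ω => X i (w i)) w ∂P = ∑ i, ∫ x, X i x ∂μ := by
    simp only [Finset.sum_apply]
    rw [integral_finsetSum _ fun i _ => (hi i).integrable (by norm_num)]
    exact Finset.sum_congr rfl fun i _ => hE i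
  have hv := variance_sum_pi (μ := fun _ : ι => μ) hX
  rw [← hP, variance_eq_integral hY.aestronglyMeasurable.aemeasurable, hYE] at hv
  have hmem : MemLp (fun w => ∑ i, X i (w i) - ∑ i, ∫ x, X i x ∂μ) 2 P := by
    have := hY.sub (memLp_const (∑ i, ∫ x, X i x ∂μ))
    refine this.ae_eq (ae_of_all _ fun w => ?_)
    simp [Finset.sum_apply]
  refine (integral_abs_le_sqrt hmem).trans (Real.sqrt_le_sqrt ?_)
  simp only [Finset.sum_apply] at hv
  rw [hv]
  exact Finset.sum_le_sum fun i _ =>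
    variance_le_expectation_sq (hX i).aestronglyMeasurable

/-- Factors of norm at most `1` do not amplify errors, so replacing them one at a time adds the
individual differences. -/
lemma norm_prod_sub_prod_le {ι : Type*} (s : Finset ι) {a b : ι → ℂ}
    (ha : ∀ i ∈ s, ‖a i‖ ≤ 1) (hb : ∀ i ∈ s, ‖b i‖ ≤ 1) :
    ‖∏ i ∈ s, a i - ∏ i ∈ s, b i‖ ≤ ∑ i ∈ s, ‖a i - b i‖ := by
  classical
  induction s using Finset.induction_on with
  | empty => simp
  | insert j s hj ih =>
    rw [Finset.prod_insert hj, Finset.prod_insert hj, Finset.sum_insert hj]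
    have h1 := ih (fun i hi => ha i (Finset.mem_insert_of_mem hi))
      (fun i hi => hb i (Finset.mem_insert_of_mem hi))
    have h2 : ‖∏ i ∈ s, b i‖ ≤ 1 := by
      rw [norm_prod]
      exact Finset.prod_le_one (fun i _ => norm_nonneg _)
        fun i hi => hb i (Finset.mem_insert_of_mem hi)
    have e : a j * ∏ i ∈ s, a i - b j * ∏ i ∈ s, b i =
        a j * (∏ i ∈ s, a i - ∏ i ∈ s, b i) + (a j - b j) * ∏ i ∈ s, b i := by ring
    rw [e]
    refine (norm_add_le _ _).trans ?_
    rw [norm_mul, norm_mul]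
    have h3 := ha j (Finset.mem_insert_self j s)
    have h4 := norm_nonneg (∏ i ∈ s, a i - ∏ i ∈ s, b i)
    have h5 := norm_nonneg (a j - b j)
    nlinarith

lemma abs_exp_neg_sub_exp_neg_le {a b : ℝ} (ha : 0 ≤ a) (hb : 0 ≤ b) :
    |Real.exp (-a) - Real.exp (-b)| ≤ |a - b| := by
  wlog h : a ≤ b generalizing a b
  · rw [abs_sub_comm, abs_sub_comm a]
    exact this hb ha (le_of_not_ge h)
  have h1 : Real.exp (-b) ≤ Real.exp (-a) := Real.exp_le_exp.2 (by linarith)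
  rw [abs_of_nonneg (by linarith), abs_of_nonpos (by linarith)]
  have h2 : Real.exp (-b) = Real.exp (-a) * Real.exp (-(b - a)) := by
    rw [← Real.exp_add]; congr 1; ring
  have h3 : Real.exp (-a) ≤ 1 := Real.exp_le_one_iff.2 (by linarith)
  have h4 := Real.add_one_le_exp (-(b - a))
  have h5 := Real.exp_pos (-a)
  nlinarith [Real.exp_pos (-(b - a))]

/-- Since `min 1 (exp x) = exp (-(max 0 (-x)))`, the acceptance function is `1`-Lipschitz, and it
takes values in `[0, 1]`. The truncation at `1` matters because the change of measure is controlled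
only in probability. -/
lemma abs_min_one_exp_sub_le (a b : ℝ) :
    |min 1 (Real.exp a) - min 1 (Real.exp b)| ≤ min 1 |a - b| := by
  have e (x : ℝ) : min 1 (Real.exp x) = Real.exp (-(max 0 (-x))) := by
    rcases le_total 0 x with h | h
    · rw [min_eq_left (Real.one_le_exp h), max_eq_left (by linarith)]
      simp
    · rw [min_eq_right (Real.exp_le_one_iff.2 h), max_eq_right (by linarith), neg_neg]
  refine le_min ?_ ?_
  · have h1 : 0 ≤ min 1 (Real.exp a) := le_min zero_le_one (Real.exp_nonneg a)
    have h2 : 0 ≤ min 1 (Real.exp b) := le_min zero_le_one (Real.exp_nonneg b)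
    have h3 := min_le_left 1 (Real.exp a)
    have h4 := min_le_left 1 (Real.exp b)
    rw [abs_le]
    constructor <;> linarith
  · rw [e, e]
    refine (abs_exp_neg_sub_exp_neg_le (le_max_left _ _) (le_max_left _ _)).trans ?_
    have := abs_max_sub_max_le_abs (-a) (-b) 0
    rwa [max_comm, max_comm (-b), neg_sub_neg, abs_sub_comm b] at this

end General

/-! ### The Gaussian limit of the acceptance probability. -/

section GaussianLimit

/-- The minimum switches at `z = b / 2`. Above it the integrand is the Gaussian density; below it
the exponential tilt shifts that density by `b`. By symmetry both pieces have mass `Φ(-b / 2)`. -/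
lemma integral_min_one_exp_gaussian (b : ℝ) (hb : 0 ≤ b) :
    ∫ z, min 1 (Real.exp (b * z - b ^ 2 / 2)) ∂(gaussianReal 0 1) =
      2 * cdf (gaussianReal 0 1) (-(b / 2)) := by
  have hpdf : Integrable (gaussianPDFReal 0 1) := integrable_gaussianPDFReal 0 1
  have hsym (z : ℝ) : gaussianPDFReal 0 1 (-z) = gaussianPDFReal 0 1 z := by
    simp [gaussianPDFReal]
  have hshift (z : ℝ) : gaussianPDFReal 0 1 z * Real.exp (b * z - b ^ 2 / 2) =
      gaussianPDFReal 0 1 (z - b) := by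
    simp only [gaussianPDFReal]
    rw [mul_assoc, ← Real.exp_add]
    congr 2
    simp
    ring
  have hcdf : cdf (gaussianReal 0 1) (-(b / 2)) =
      ∫ z in Set.Iic (-(b / 2)), gaussianPDFReal 0 1 z := by
    rw [cdf_eq_real, measureReal_def, gaussianReal_apply_eq_integral _ one_ne_zero,
      ENNReal.toReal_ofReal (integral_nonneg fun z => gaussianPDFReal_nonneg 0 1 z)]
  rw [integral_gaussianReal_eq_integral_smul one_ne_zero]
  simp only [smul_eq_mul]
  have hsplit (z : ℝ) : gaussianPDFReal 0 1 z * min 1 (Real.exp (b * z - b ^ 2 / 2)) =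
      (Set.Ioi (b / 2)).indicator (gaussianPDFReal 0 1) z +
        (Set.Iic (-(b / 2))).indicator (gaussianPDFReal 0 1) (z - b) := by
    by_cases h : b / 2 < z
    · rw [Set.indicator_of_mem (show z ∈ Set.Ioi (b / 2) from h),
        Set.indicator_of_notMem (show z - b ∉ Set.Iic (-(b / 2)) by
          simp only [Set.mem_Iic]; linarith),
        min_eq_left (Real.one_le_exp (by nlinarith))]
      ring
    · push Not at h
      rw [Set.indicator_of_notMem (show z ∉ Set.Ioi (b / 2) by simp only [Set.mem_Ioi]; linarith),
        Set.indicator_of_mem (show z - b ∈ Set.Iic (-(b / 2)) by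
          simp only [Set.mem_Iic]; linarith),
        min_eq_right (Real.exp_le_one_iff.2 (by nlinarith)), hshift]
      ring
  simp only [hsplit]
  rw [integral_add (hpdf.indicator measurableSet_Ioi)
    ((hpdf.indicator measurableSet_Iic).comp_sub_right b),
    integral_sub_right_eq_self ((Set.Iic (-(b / 2))).indicator (gaussianPDFReal 0 1)) b,
    integral_indicator measurableSet_Ioi, integral_indicator measurableSet_Iic, hcdf]
  have := integral_comp_neg_Ioi (b / 2) (gaussianPDFReal 0 1)
  simp only [hsym] at this
  rw [this]
  ring

/-- Convergence of the mean of `min 1 (exp (s - θ / 2))` from convergence of the characteristic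
functions to that of a centred normal law of variance `θ`. -/
theorem tendsto_integral_min_one_exp {θ : ℝ} (hθ : 0 ≤ θ) {Q : ℕ → ProbabilityMeasure ℝ}
    (h : ∀ t : ℝ, Tendsto (fun m => charFun (Q m : Measure ℝ) t) atTop
      (𝓝 ((Real.exp (-(t ^ 2 / 2 * θ)) : ℝ) : ℂ))) :
    Tendsto (fun m => ∫ s, min 1 (Real.exp (s - θ / 2)) ∂(Q m : Measure ℝ)) atTop
      (𝓝 (2 * cdf (gaussianReal 0 1) (-(√θ / 2)))) := by
  let μ₀ : ProbabilityMeasure ℝ := ⟨gaussianReal 0 θ.toNNReal, inferInstance⟩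
  have hlim : Tendsto Q atTop (𝓝 μ₀) := by
    refine ProbabilityMeasure.tendsto_iff_tendsto_charFun.2 fun t => ?_
    have : charFun (μ₀ : Measure ℝ) t = ((Real.exp (-(t ^ 2 / 2 * θ)) : ℝ) : ℂ) := by
      change charFun (gaussianReal 0 θ.toNNReal) t = _
      rw [charFun_gaussianReal]
      push_cast
      congr 1
      simp [Real.coe_toNNReal θ hθ]
      ring
    rw [this]
    exact h t
  -- By Lévy's theorem the laws converge weakly, and the acceptance function is a bounded continuous
  -- test function.
  let F : BoundedContinuousFunction ℝ ℝ := BoundedContinuousFunction.ofNormedAddCommGroup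
    (fun s => min 1 (Real.exp (s - θ / 2))) (by fun_prop) 1 fun s => by
      rw [Real.norm_of_nonneg (le_min zero_le_one (Real.exp_nonneg _))]
      exact min_le_left _ _
  have := (ProbabilityMeasure.tendsto_iff_forall_integral_tendsto.1 hlim) F
  have e : ∫ s, F s ∂(μ₀ : Measure ℝ) = 2 * cdf (gaussianReal 0 1) (-(√θ / 2)) := by
    rw [← integral_min_one_exp_gaussian _ (Real.sqrt_nonneg θ)]
    have hmap : (gaussianReal 0 1).map (√θ * ·) = gaussianReal 0 θ.toNNReal := by
      rw [gaussianReal_map_const_mul]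
      congr 1
      · simp
      · ext
        simp [Real.sq_sqrt hθ, Real.coe_toNNReal θ hθ]
    change ∫ s, min 1 (Real.exp (s - θ / 2)) ∂(gaussianReal 0 θ.toNNReal) = _
    rw [← hmap, integral_map (by fun_prop) (by fun_prop)]
    simp [Real.sq_sqrt hθ]
  rw [e] at this
  exact this

end GaussianLimit

/-! ### The full vector: i.i.d. coordinates and the leading part of the log ratio. -/

/-- The law of the rescaled starting point under the reference law, together with the noise. -/
noncomputable def jointLaw (g : ℝ → ℝ) (n : ℕ) : Measure ((Fin n → ℝ) × (Fin n → ℝ)) :=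
  (Measure.pi fun _ => refLaw g).prod (Measure.pi fun _ => gaussianReal 0 1)

lemma RegularPotential.isProbabilityMeasure_jointLaw (hg : RegularPotential g) (n : ℕ) :
    IsProbabilityMeasure (jointLaw g n) := by
  have := hg.isProbabilityMeasure_refLaw
  unfold jointLaw
  infer_instance

lemma measurePreserving_coordPairs (hg : RegularPotential g) (n : ℕ) :
    MeasurePreserving (fun (w : (Fin n → ℝ) × (Fin n → ℝ)) (i : Fin n) => (w.1 i, w.2 i))
      (jointLaw g n) (Measure.pi fun _ => coordLaw g) := by
  have := hg.isProbabilityMeasure_refLaw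
  exact (measurePreserving_arrowProdEquivProdArrow ℝ ℝ (Fin n) (fun _ => refLaw g)
    (fun _ => gaussianReal 0 1)).symm

lemma measurePreserving_coordPair (hg : RegularPotential g) {n : ℕ} (i : Fin n) :
    MeasurePreserving (fun w : (Fin n → ℝ) × (Fin n → ℝ) => (w.1 i, w.2 i))
      (jointLaw g n) (coordLaw g) := by
  have := hg.isProbabilityMeasure_coordLaw
  exact (measurePreserving_eval (fun _ => coordLaw g) i).comp (measurePreserving_coordPairs hg n)

/-- The leading part of the log ratio. -/
noncomputable def leadSum (A : Algorithm) (g : ℝ → ℝ) {n : ℕ} (ε : Fin n → ℝ)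
    (w : (Fin n → ℝ) × (Fin n → ℝ)) : ℝ :=
  ∑ i, ε i ^ order A * leadCoeff A g (w.1 i) (w.2 i)

/-- The logarithm of the acceptance ratio for the reference law. -/
noncomputable def logRatioSum (A : Algorithm) (g : ℝ → ℝ) {n : ℕ} (ε : Fin n → ℝ)
    (w : (Fin n → ℝ) × (Fin n → ℝ)) : ℝ :=
  ∑ i, logRatio A g (ε i) (w.1 i) (w.2 i)

lemma measurable_leadSum (hg : RegularPotential g) (A : Algorithm) {n : ℕ} (ε : Fin n → ℝ) :
    Measurable (leadSum A g ε) := by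
  unfold leadSum
  refine Finset.measurable_fun_sum _ fun i _ => Measurable.const_mul ?_ _
  exact (measurable_leadCoeff hg A).comp
    (f := fun w : (Fin n → ℝ) × (Fin n → ℝ) => (w.1 i, w.2 i)) (by fun_prop)

lemma measurable_logRatioSum (hg : RegularPotential g) (A : Algorithm) {n : ℕ} (ε : Fin n → ℝ) :
    Measurable (logRatioSum A g ε) := by
  unfold logRatioSum
  refine Finset.measurable_fun_sum _ fun i _ => ?_
  exact (measurable_logRatio hg A (ε i)).comp
    (f := fun w : (Fin n → ℝ) × (Fin n → ℝ) => (w.1 i, w.2 i)) (by fun_prop)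

lemma integrable_leadSum (hg : RegularPotential g) (A : Algorithm) {n : ℕ} (ε : Fin n → ℝ) :
    Integrable (leadSum A g ε) (jointLaw g n) := by
  unfold leadSum
  refine integrable_finsetSum _ fun i _ => Integrable.const_mul ?_ _
  exact (measurePreserving_coordPair hg i).integrable_comp_of_integrable
    ((polyO_leadCoeff hg A).integrable hg (fun _ => measurable_leadCoeff hg A) one_pos le_rfl)

lemma integrable_logRatioSum (hg : RegularPotential g) (A : Algorithm) {n : ℕ} {ε : Fin n → ℝ}
    (hε : ∀ i, 0 < ε i ∧ ε i ≤ 1) :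
    Integrable (logRatioSum A g ε) (jointLaw g n) := by
  unfold logRatioSum
  refine integrable_finsetSum _ fun i _ => ?_
  exact (measurePreserving_coordPair hg i).integrable_comp_of_integrable
    (integrable_logRatio hg A (hε i).1 (hε i).2)

/-- The log ratio is its leading part shifted by half the variance, up to a small error. -/
theorem integral_abs_logRatioSum_sub_le (hg : RegularPotential g) (A : Algorithm) :
    ∃ C : ℝ, 0 ≤ C ∧ ∀ (n : ℕ) (ε : Fin n → ℝ), (∀ i, 0 < ε i ∧ ε i ≤ 1) →
      ∫ w, |logRatioSum A g ε w - leadSum A g ε w +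
          limitConst A g / 2 * ∑ i, ε i ^ (2 * order A)| ∂(jointLaw g n) ≤
        √(C * ∑ i, ε i ^ (2 * order A + 1)) + C * ∑ i, ε i ^ (2 * order A + 1) := by
  obtain ⟨C, hC, hb⟩ := abs_integral_logRatio_add hg A
  obtain ⟨D, hD, hd⟩ := integral_sq_logRatio_sub hg A
  refine ⟨C + D, by positivity, fun n ε hε => ?_⟩
  have := hg.isProbabilityMeasure_coordLaw
  have := hg.isProbabilityMeasure_jointLaw n
  set X : Fin n → ℝ × ℝ → ℝ := fun i w =>
    logRatio A g (ε i) w.1 w.2 - ε i ^ order A * leadCoeff A g w.1 w.2 with hX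
  have hXm (i : Fin n) : Measurable (X i) :=
    (measurable_logRatio hg A (ε i)).sub ((measurable_leadCoeff hg A).const_mul _)
  have hX2 (i : Fin n) : MemLp (X i) 2 (coordLaw g) := by
    rw [memLp_two_iff_integrable_sq (hXm i).aestronglyMeasurable]
    exact ((logRatio_sub_leadCoeff hg A).pow 2).integrable hg
      (fun ε => ((measurable_logRatio hg A ε).sub
        ((measurable_leadCoeff hg A).const_mul _)).pow_const 2) (hε i).1 (hε i).2
  -- The leading coefficient is centred, so the mean of the error carries the whole drift of the log
  -- ratio.
  have hXE (i : Fin n) : ∫ w, X i w ∂(coordLaw g) =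
      ∫ w, logRatio A g (ε i) w.1 w.2 ∂(coordLaw g) := by
    rw [hX]
    simp only
    rw [integral_sub (integrable_logRatio hg A (hε i).1 (hε i).2)
      (((polyO_leadCoeff hg A).integrable hg (fun _ => measurable_leadCoeff hg A) one_pos
        le_rfl).const_mul _), integral_const_mul, integral_coord_leadCoeff hg]
    simp
  have lln := integral_abs_sum_sub_le hX2
  rw [← (measurePreserving_coordPairs hg n).map_eq, integral_map
    (measurePreserving_coordPairs hg n).measurable.aemeasurable (by
      refine Measurable.aestronglyMeasurable ?_
      have : Measurable fun w : Fin n → ℝ × ℝ => ∑ i, X i (w i) :=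
        Finset.measurable_fun_sum _ fun i _ => (hXm i).comp (measurable_pi_apply i)
      exact (this.sub_const _).norm)] at lln
  set m := ∑ i, ∫ w, X i w ∂(coordLaw g) with hm
  have hsq : √(∑ i, ∫ w, X i w ^ 2 ∂(coordLaw g)) ≤
      √((C + D) * ∑ i, ε i ^ (2 * order A + 1)) := by
    refine Real.sqrt_le_sqrt ?_
    rw [Finset.mul_sum]
    refine Finset.sum_le_sum fun i _ => (hd (ε i) (hε i).1 (hε i).2).trans ?_
    have := pow_nonneg (hε i).1.le (2 * order A + 1)
    nlinarith
  -- The law of large numbers controls fluctuations about `m`; this step identifies `m` with minus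
  -- half the limiting variance.
  have hbias : |m + limitConst A g / 2 * ∑ i, ε i ^ (2 * order A)| ≤
      (C + D) * ∑ i, ε i ^ (2 * order A + 1) := by
    rw [hm, Finset.mul_sum, ← Finset.sum_add_distrib, Finset.mul_sum]
    refine (Finset.abs_sum_le_sum_abs _ _).trans (Finset.sum_le_sum fun i _ => ?_)
    rw [hXE, mul_comm (limitConst A g / 2)]
    refine (hb (ε i) (hε i).1 (hε i).2).trans ?_
    have := pow_nonneg (hε i).1.le (2 * order A + 1)
    nlinarith
  have hS (w : (Fin n → ℝ) × (Fin n → ℝ)) : ∑ i, X i (w.1 i, w.2 i) =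
      logRatioSum A g ε w - leadSum A g ε w := by
    simp [hX, logRatioSum, leadSum]
  simp only [hS] at lln
  have hi := (integrable_logRatioSum hg A hε).sub (integrable_leadSum hg A ε)
  have him : Integrable (fun w => |logRatioSum A g ε w - leadSum A g ε w - m|)
      (jointLaw g n) := (hi.sub (integrable_const m)).abs
  calc _ ≤ ∫ w, (|logRatioSum A g ε w - leadSum A g ε w - m| +
          |m + limitConst A g / 2 * ∑ i, ε i ^ (2 * order A)|) ∂(jointLaw g n) := by
        refine integral_mono (hi.add (integrable_const _)).abs
          (him.add (integrable_const _)) fun w => ?_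
        refine le_trans (le_of_eq ?_) (abs_add_le _ _)
        congr 1
        ring
    _ = ∫ w, |logRatioSum A g ε w - leadSum A g ε w - m| ∂(jointLaw g n) +
          |m + limitConst A g / 2 * ∑ i, ε i ^ (2 * order A)| := by
        rw [integral_add him (integrable_const _)]
        simp
    _ ≤ _ := add_le_add (lln.trans hsq) hbias

/-! ### Conditional characteristic functions given the starting point. -/

/-- The characteristic function of the leading part, given the starting point. -/
noncomputable def condCharFun (A : Algorithm) (g : ℝ → ℝ) {n : ℕ} (ε : Fin n → ℝ) (t : ℝ)
    (u : Fin n → ℝ) : ℂ :=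
  ∫ z, Complex.exp ((t * leadSum A g ε (u, z) : ℝ) * Complex.I)
    ∂(Measure.pi fun _ : Fin n => gaussianReal 0 1)

lemma condCharFun_eq_prod (A : Algorithm) (g : ℝ → ℝ) {n : ℕ} (ε : Fin n → ℝ) (t : ℝ)
    (u : Fin n → ℝ) :
    condCharFun A g ε t u = ∏ i, ∫ z, Complex.exp
      ((t * (ε i ^ order A * leadCoeff A g (u i) z) : ℝ) * Complex.I) ∂(gaussianReal 0 1) := by
  rw [condCharFun, ← integral_fintype_prod_eq_prod]
  refine integral_congr_ae (ae_of_all _ fun z => ?_)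
  simp only [leadSum, Finset.mul_sum, Complex.ofReal_sum, Finset.sum_mul, Complex.exp_sum]

lemma norm_integral_exp_mul_I_le {Ω : Type*} [MeasurableSpace Ω] (μ : Measure Ω)
    [IsProbabilityMeasure μ] (X : Ω → ℝ) :
    ‖∫ x, Complex.exp ((X x : ℝ) * Complex.I) ∂μ‖ ≤ 1 := by
  refine (norm_integral_le_of_norm_le_const (C := 1) (ae_of_all _ fun x => ?_)).trans ?_
  · rw [Complex.norm_exp_ofReal_mul_I]
  · simp

lemma norm_condCharFun_le (A : Algorithm) (g : ℝ → ℝ) {n : ℕ} (ε : Fin n → ℝ) (t : ℝ)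
    (u : Fin n → ℝ) : ‖condCharFun A g ε t u‖ ≤ 1 :=
  norm_integral_exp_mul_I_le _ _

lemma measurable_condCharFun (hg : RegularPotential g) (A : Algorithm) {n : ℕ} (ε : Fin n → ℝ)
    (t : ℝ) : StronglyMeasurable (condCharFun A g ε t) := by
  unfold condCharFun
  have := measurable_leadSum hg A ε
  exact StronglyMeasurable.integral_prod_right (f := fun u z =>
    Complex.exp ((t * leadSum A g ε (u, z) : ℝ) * Complex.I))
    (by unfold Function.uncurry; fun_prop)

/-- On average over the starting point, the conditional characteristic function is close to that of
a normal law. -/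
theorem integral_norm_condCharFun_sub_le (hg : RegularPotential g) (A : Algorithm) :
    ∃ C : ℝ, 0 ≤ C ∧ ∀ (n : ℕ) (ε : Fin n → ℝ), (∀ i, 0 < ε i ∧ ε i ≤ 1) →
      ∀ t θ : ℝ, 0 ≤ θ →
      ∫ u, ‖condCharFun A g ε t u - (Real.exp (-(t ^ 2 / 2 * (limitConst A g * θ))) : ℝ)‖
          ∂(Measure.pi fun _ : Fin n => refLaw g) ≤
        C * (|t| ^ 3 + t ^ 4) * ∑ i, ε i ^ (2 * order A + 1) +
        t ^ 2 / 2 * (√(C * ∑ i, ε i ^ (2 * order A + 1)) +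
          limitConst A g * |∑ i, ε i ^ (2 * order A) - θ|) := by
  obtain ⟨C, N, hC, hb⟩ := norm_charFun_leadCoeff_sub_le hg A
  have hpr := hg.isProbabilityMeasure_refLaw
  have hV2 : Integrable (fun u => leadVar A g u ^ 2) (refLaw g) := by
    obtain ⟨D, M, hD, hd⟩ := (polyO_leadVar hg A).pow 2
    have hc := continuous_leadVar hg A
    refine ((hg.integrable_one_add_abs_pow M).const_mul D).mono' (by fun_prop)
      (ae_of_all _ fun u => ?_)
    simpa using hd 1 one_pos le_rfl u 0
  have hVm : MemLp (leadVar A g) 2 (refLaw g) :=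
    (memLp_two_iff_integrable_sq (continuous_leadVar hg A).aestronglyMeasurable).2 hV2
  set W := ∫ u, (1 + |u|) ^ N ∂(refLaw g) with hW
  have hW0 : 0 ≤ W := integral_nonneg fun u => by positivity
  set V2 := ∫ u, leadVar A g u ^ 2 ∂(refLaw g) with hV2d
  have hV20 : 0 ≤ V2 := integral_nonneg fun u => by positivity
  have hK := limitConst_pos hg A
  -- `W` averages the polynomial weight in the coordinatewise bound, and `V2` enters the law of
  -- large numbers for the conditional variance.
  refine ⟨C * W + V2, by positivity, fun n ε hε t θ hθ => ?_⟩
  set P : Measure (Fin n → ℝ) := Measure.pi fun _ : Fin n => refLaw g with hP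
  set S3 := ∑ i, ε i ^ (2 * order A + 1) with hS3
  have hS30 : 0 ≤ S3 := Finset.sum_nonneg fun i _ => pow_nonneg (hε i).1.le _
  set VV : (Fin n → ℝ) → ℝ := fun u => ∑ i, ε i ^ (2 * order A) * leadVar A g (u i) with hVV
  have hVV0 (u : Fin n → ℝ) : 0 ≤ VV u := Finset.sum_nonneg fun i _ =>
    mul_nonneg (pow_nonneg (hε i).1.le _) (leadVar_nonneg A g _)
  -- pointwise bound
  have hpt (u : Fin n → ℝ) :
      ‖condCharFun A g ε t u - (Real.exp (-(t ^ 2 / 2 * (limitConst A g * θ))) : ℝ)‖ ≤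
      ∑ i, C * (|t| ^ 3 + t ^ 4) * ε i ^ (2 * order A + 1) * (1 + |u i|) ^ N +
        t ^ 2 / 2 * (|VV u - ∑ i, ∫ x, ε i ^ (2 * order A) * leadVar A g x ∂(refLaw g)| +
          limitConst A g * |∑ i, ε i ^ (2 * order A) - θ|) := by
    -- Given the start, the noises are independent; the leading sum is compared with a Gaussian of
    -- its own conditional variance `VV u`.
    have h1 : ‖condCharFun A g ε t u - ((Real.exp (-(t ^ 2 / 2 * VV u)) : ℝ) : ℂ)‖ ≤
        ∑ i, C * (|t| ^ 3 + t ^ 4) * ε i ^ (2 * order A + 1) * (1 + |u i|) ^ N := by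
      have e : ((Real.exp (-(t ^ 2 / 2 * VV u)) : ℝ) : ℂ) = ∏ i,
          ((Real.exp (-(t ^ 2 / 2 * (ε i ^ (2 * order A) * leadVar A g (u i)))) : ℝ) : ℂ) := by
        rw [← Complex.ofReal_prod, ← Real.exp_sum, hVV]
        simp only [Finset.mul_sum, Finset.sum_neg_distrib]
      rw [condCharFun_eq_prod, e]
      refine (norm_prod_sub_prod_le _ (fun i _ => norm_integral_exp_mul_I_le _ _)
        fun i _ => ?_).trans (Finset.sum_le_sum fun i _ => hb t (ε i) (hε i).1 (hε i).2 (u i))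
      rw [Complex.norm_real, Real.norm_of_nonneg (Real.exp_nonneg _)]
      refine Real.exp_le_one_iff.2 (neg_nonpos.2 ?_)
      have := leadVar_nonneg A g (u i)
      have := pow_nonneg (hε i).1.le (2 * order A)
      positivity
    -- The random conditional variance is then replaced by the constant `limitConst A g * θ`,
    -- through its mean.
    have h2 : ‖((Real.exp (-(t ^ 2 / 2 * VV u)) : ℝ) : ℂ) -
        (Real.exp (-(t ^ 2 / 2 * (limitConst A g * θ))) : ℝ)‖ ≤
        t ^ 2 / 2 * (|VV u - ∑ i, ∫ x, ε i ^ (2 * order A) * leadVar A g x ∂(refLaw g)| +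
          limitConst A g * |∑ i, ε i ^ (2 * order A) - θ|) := by
      rw [← Complex.ofReal_sub, Complex.norm_real, Real.norm_eq_abs]
      refine (abs_exp_neg_sub_exp_neg_le (mul_nonneg (by positivity) (hVV0 u))
        (by positivity)).trans ?_
      rw [← mul_sub, abs_mul, abs_of_nonneg (by positivity : 0 ≤ t ^ 2 / 2)]
      refine mul_le_mul_of_nonneg_left ?_ (by positivity)
      have e : ∑ i, ∫ x, ε i ^ (2 * order A) * leadVar A g x ∂(refLaw g) =
          limitConst A g * ∑ i, ε i ^ (2 * order A) := by
        simp only [integral_const_mul, integral_leadVar hg A, Finset.mul_sum]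
        exact Finset.sum_congr rfl fun i _ => mul_comm _ _
      rw [e, ← abs_of_pos hK, ← abs_mul, abs_of_pos hK]
      refine le_trans (le_of_eq ?_) (abs_add_le _ _)
      congr 1
      ring
    exact (norm_sub_le_norm_sub_add_norm_sub _ _ _).trans (add_le_add h1 h2)
  have hXm (i : Fin n) : MemLp (fun x => ε i ^ (2 * order A) * leadVar A g x) 2 (refLaw g) :=
    hVm.const_mul _
  have hcomp (i : Fin n) (f : ℝ → ℝ) (hf : Integrable f (refLaw g)) :
      Integrable (fun u : Fin n → ℝ => f (u i)) P :=
    (measurePreserving_eval (fun _ => refLaw g) i).integrable_comp_of_integrable hf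
  have iW (i : Fin n) : Integrable (fun u : Fin n → ℝ =>
      C * (|t| ^ 3 + t ^ 4) * ε i ^ (2 * order A + 1) * (1 + |u i|) ^ N) P :=
    (hcomp i _ (hg.integrable_one_add_abs_pow N)).const_mul _
  have iVV : Integrable VV P := integrable_finsetSum _ fun i _ =>
    (hcomp i _ (hVm.integrable (by norm_num))).const_mul _
  have iA : Integrable (fun u => |VV u -
      ∑ i, ∫ x, ε i ^ (2 * order A) * leadVar A g x ∂(refLaw g)|) P :=
    (iVV.sub (integrable_const _)).abs
  have lln := integral_abs_sum_sub_le hXm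
  have hsq : √(∑ i, ∫ x, (ε i ^ (2 * order A) * leadVar A g x) ^ 2 ∂(refLaw g)) ≤
      √((C * W + V2) * S3) := by
    refine Real.sqrt_le_sqrt ?_
    rw [hS3, Finset.mul_sum]
    refine Finset.sum_le_sum fun i _ => ?_
    simp only [mul_pow]
    rw [integral_const_mul, ← hV2d, ← pow_mul, mul_comm]
    have hk := one_le_order A
    have h1 : ε i ^ (2 * order A * 2) ≤ ε i ^ (2 * order A + 1) :=
      pow_le_pow_of_le_one (hε i).1.le (hε i).2 (by omega)
    have h2 := pow_nonneg (hε i).1.le (2 * order A + 1)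
    have h3 := mul_nonneg hC hW0
    nlinarith
  have iB : Integrable (fun u => t ^ 2 / 2 * (|VV u -
      ∑ i, ∫ x, ε i ^ (2 * order A) * leadVar A g x ∂(refLaw g)| +
          limitConst A g * |∑ i, ε i ^ (2 * order A) - θ|)) P :=
    (iA.add (integrable_const _)).const_mul _
  have iS : Integrable (fun u : Fin n → ℝ =>
      ∑ i, C * (|t| ^ 3 + t ^ 4) * ε i ^ (2 * order A + 1) * (1 + |u i|) ^ N) P :=
    integrable_finsetSum _ fun i _ => iW i
  calc _ ≤ ∫ u, (∑ i, C * (|t| ^ 3 + t ^ 4) * ε i ^ (2 * order A + 1) * (1 + |u i|) ^ N +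
        t ^ 2 / 2 * (|VV u - ∑ i, ∫ x, ε i ^ (2 * order A) * leadVar A g x ∂(refLaw g)| +
          limitConst A g * |∑ i, ε i ^ (2 * order A) - θ|)) ∂P :=
        integral_mono_of_nonneg (ae_of_all _ fun u => norm_nonneg _) (iS.add iB)
          (ae_of_all _ hpt)
    _ = C * (|t| ^ 3 + t ^ 4) * S3 * W + t ^ 2 / 2 * (∫ u, |VV u -
          ∑ i, ∫ x, ε i ^ (2 * order A) * leadVar A g x ∂(refLaw g)| ∂P +
          limitConst A g * |∑ i, ε i ^ (2 * order A) - θ|) := by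
        rw [integral_add iS iB, integral_finsetSum _ fun i _ => iW i, integral_const_mul,
          integral_add iA (integrable_const _)]
        have (i : Fin n) : ∫ u : Fin n → ℝ, C * (|t| ^ 3 + t ^ 4) * ε i ^ (2 * order A + 1) *
            (1 + |u i|) ^ N ∂P = C * (|t| ^ 3 + t ^ 4) * ε i ^ (2 * order A + 1) * W := by
          rw [integral_const_mul, hW, hP]
          congr 1
          exact integral_comp_eval (μ := fun _ => refLaw g) (f := fun x => (1 + |x|) ^ N)
            (hg.integrable_one_add_abs_pow N).aestronglyMeasurable
        simp only [this, ← Finset.sum_mul, ← Finset.mul_sum, ← hS3]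
        simp
    _ ≤ _ := by
        refine add_le_add ?_ ?_
        · have : 0 ≤ (|t| ^ 3 + t ^ 4) * S3 := by positivity
          nlinarith
        · gcongr
          exact lln.trans hsq

/-! ### Starting points with a bounded density. -/

/-- The law of the leading part when the starting point has density `h` with respect to the
reference law. -/
noncomputable def leadLaw (A : Algorithm) (g : ℝ → ℝ) {n : ℕ} (ε : Fin n → ℝ)
    (h : (Fin n → ℝ) → ℝ) : Measure ℝ :=
  ((jointLaw g n).withDensity fun w => ENNReal.ofReal (h w.1)).map (leadSum A g ε)

section Fixed

variable {n : ℕ} {h : (Fin n → ℝ) → ℝ} {B : ℝ}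

lemma ae_jointLaw_of_ae (hg : RegularPotential g) {p : (Fin n → ℝ) → Prop}
    (hp : ∀ᵐ u ∂(Measure.pi fun _ : Fin n => refLaw g), p u) :
    ∀ᵐ w ∂(jointLaw g n), p w.1 := by
  have := hg.isProbabilityMeasure_refLaw
  exact Measure.quasiMeasurePreserving_fst.ae hp

lemma integrable_density_fst (hg : RegularPotential g)
    (hi : Integrable h (Measure.pi fun _ : Fin n => refLaw g)) :
    Integrable (fun w : (Fin n → ℝ) × (Fin n → ℝ) => h w.1) (jointLaw g n) := by
  have := hg.isProbabilityMeasure_refLaw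
  exact hi.comp_fst _

lemma integral_density_fst (hg : RegularPotential g) :
    ∫ w, h w.1 ∂(jointLaw g n) = ∫ u, h u ∂(Measure.pi fun _ : Fin n => refLaw g) := by
  have := hg.isProbabilityMeasure_refLaw
  rw [jointLaw, integral_fun_fst]
  simp

lemma integral_leadLaw {E : Type*} [NormedAddCommGroup E] [NormedSpace ℝ E]
    (hg : RegularPotential g) (A : Algorithm) (ε : Fin n → ℝ) (hm : Measurable h)
    (h0 : ∀ u, 0 ≤ h u) {F : ℝ → E} (hF : StronglyMeasurable F) :
    ∫ s, F s ∂(leadLaw A g ε h) = ∫ w, h w.1 • F (leadSum A g ε w) ∂(jointLaw g n) := by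
  rw [leadLaw, integral_map (measurable_leadSum hg A ε).aemeasurable hF.aestronglyMeasurable,
    integral_withDensity_eq_integral_toReal_smul (by fun_prop) (by simp)]
  simp [ENNReal.toReal_ofReal (h0 _)]

lemma isProbabilityMeasure_leadLaw (hg : RegularPotential g) (A : Algorithm) (ε : Fin n → ℝ)
    (h0 : ∀ u, 0 ≤ h u)
    (hi : ∫ u, h u ∂(Measure.pi fun _ : Fin n => refLaw g) = 1) :
    IsProbabilityMeasure (leadLaw A g ε h) := by
  have hint : Integrable h (Measure.pi fun _ : Fin n => refLaw g) := by
    by_contra hn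
    rw [integral_undef hn] at hi
    exact zero_ne_one hi
  have : IsProbabilityMeasure ((jointLaw g n).withDensity fun w => ENNReal.ofReal (h w.1)) := by
    refine ⟨?_⟩
    rw [withDensity_apply _ MeasurableSet.univ, setLIntegral_univ,
      ← ofReal_integral_eq_lintegral_ofReal (integrable_density_fst hg hint)
      (ae_of_all _ fun w => h0 w.1), integral_density_fst hg, hi, ENNReal.ofReal_one]
  exact Measure.isProbabilityMeasure_map (measurable_leadSum hg A ε).aemeasurable

lemma charFun_leadLaw (hg : RegularPotential g) (A : Algorithm) (ε : Fin n → ℝ)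
    (hm : Measurable h) (h0 : ∀ u, 0 ≤ h u)
    (hi : Integrable h (Measure.pi fun _ : Fin n => refLaw g)) (t : ℝ) :
    charFun (leadLaw A g ε h) t =
      ∫ u, h u • condCharFun A g ε t u ∂(Measure.pi fun _ : Fin n => refLaw g) := by
  have := hg.isProbabilityMeasure_refLaw
  have hS := measurable_leadSum hg A ε
  rw [charFun_apply_real, integral_leadLaw hg A ε hm h0
    (F := fun s : ℝ => Complex.exp (t * s * Complex.I))
    (Continuous.stronglyMeasurable (by fun_prop)), jointLaw, integral_prod]
  · refine integral_congr_ae (ae_of_all _ fun u => ?_)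
    simp only [condCharFun, integral_smul]
    push_cast
    rfl
  · refine (integrable_density_fst hg hi).mono (by fun_prop) (ae_of_all _ fun w => ?_)
    rw [norm_smul, ← Complex.ofReal_mul, Complex.norm_exp_ofReal_mul_I, mul_one]

/-- The density depends on the start alone, so it multiplies the conditional characteristic
function. Because `h` has integral `1`, the constant `a` can be put under the same integral; the
bound `h ≤ B` then transfers an estimate in reference mean to the target. -/
lemma norm_charFun_leadLaw_sub_le (hg : RegularPotential g) (A : Algorithm) (ε : Fin n → ℝ)
    (hm : Measurable h) (h0 : ∀ u, 0 ≤ h u)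
    (hB : ∀ᵐ u ∂(Measure.pi fun _ : Fin n => refLaw g), h u ≤ B)
    (hi : ∫ u, h u ∂(Measure.pi fun _ : Fin n => refLaw g) = 1) (t a : ℝ) :
    ‖charFun (leadLaw A g ε h) t - (a : ℂ)‖ ≤
      B * ∫ u, ‖condCharFun A g ε t u - (a : ℂ)‖ ∂(Measure.pi fun _ : Fin n => refLaw g) := by
  have := hg.isProbabilityMeasure_refLaw
  have hint : Integrable h (Measure.pi fun _ : Fin n => refLaw g) := by
    by_contra hn
    rw [integral_undef hn] at hi
    exact zero_ne_one hi
  have hcm := (measurable_condCharFun hg A ε t).measurable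
  have i1 : Integrable (fun u => h u • condCharFun A g ε t u)
      (Measure.pi fun _ : Fin n => refLaw g) := by
    refine hint.mono (by fun_prop) (ae_of_all _ fun u => ?_)
    rw [norm_smul]
    exact mul_le_of_le_one_right (norm_nonneg _) (norm_condCharFun_le A g ε t u)
  have i2 : Integrable (fun u => ‖condCharFun A g ε t u - (a : ℂ)‖)
      (Measure.pi fun _ : Fin n => refLaw g) := by
    refine (integrable_const (1 + ‖(a : ℂ)‖)).mono' (by fun_prop) (ae_of_all _ fun u => ?_)
    rw [norm_norm]
    exact (norm_sub_le _ _).trans (by gcongr; exact norm_condCharFun_le A g ε t u)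
  have ha : (a : ℂ) = ∫ u, h u • (a : ℂ) ∂(Measure.pi fun _ : Fin n => refLaw g) := by
    rw [integral_smul_const, hi, one_smul]
  rw [charFun_leadLaw hg A ε hm h0 hint]
  nth_rewrite 1 [ha]
  rw [← integral_sub i1 (hint.smul_const _), ← integral_const_mul]
  refine norm_integral_le_of_norm_le (i2.const_mul B) ?_
  filter_upwards [hB] with u hu
  rw [← smul_sub, norm_smul, Real.norm_of_nonneg (h0 u)]
  gcongr

end Fixed

/-- The limit of the mean acceptance probability, in rescaled coordinates: the starting point has a
bounded density `h m` with respect to the reference law, and `D m` is the contribution of the change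
of measure to the log ratio. -/
theorem tendsto_integral_accept (hg : RegularPotential g) (A : Algorithm) {d : ℕ → ℕ}
    {ε : ∀ m, Fin (d m) → ℝ} (hε : ∀ m i, 0 < ε m i ∧ ε m i ≤ 1) {θ : ℝ} (hθ : 0 ≤ θ)
    (hsum : Tendsto (fun m => ∑ i, ε m i ^ (2 * order A)) atTop (𝓝 θ))
    (hsum' : Tendsto (fun m => ∑ i, ε m i ^ (2 * order A + 1)) atTop (𝓝 0))
    {h : ∀ m, (Fin (d m) → ℝ) → ℝ} (hm : ∀ m, Measurable (h m)) (h0 : ∀ m u, 0 ≤ h m u) {B : ℝ}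
    (hB0 : 0 ≤ B)
    (hB : ∀ m, ∀ᵐ u ∂(Measure.pi fun _ : Fin (d m) => refLaw g), h m u ≤ B)
    (hi : ∀ m, ∫ u, h m u ∂(Measure.pi fun _ : Fin (d m) => refLaw g) = 1)
    {D : ∀ m, (Fin (d m) → ℝ) × (Fin (d m) → ℝ) → ℝ} (hDm : ∀ m, Measurable (D m))
    (hD : Tendsto (fun m => ∫ w, min 1 |D m w| ∂(jointLaw g (d m))) atTop (𝓝 0)) :
    Tendsto (fun m => ∫ w, h m w.1 * min 1 (Real.exp (logRatioSum A g (ε m) w + D m w))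
      ∂(jointLaw g (d m))) atTop
      (𝓝 (2 * cdf (gaussianReal 0 1) (-(√(limitConst A g * θ) / 2)))) := by
  have hK := limitConst_pos hg A
  set K := limitConst A g with hKd
  have hpr := hg.isProbabilityMeasure_refLaw
  have hpj (m : ℕ) := hg.isProbabilityMeasure_jointLaw (d m)
  let Q : ℕ → ProbabilityMeasure ℝ := fun m =>
    ⟨leadLaw A g (ε m) (h m), isProbabilityMeasure_leadLaw hg A (ε m) (h0 m) (hi m)⟩
  have hQ (t : ℝ) : Tendsto (fun m => charFun (Q m : Measure ℝ) t) atTop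
      (𝓝 ((Real.exp (-(t ^ 2 / 2 * (K * θ))) : ℝ) : ℂ)) := by
    obtain ⟨C, hC, hb⟩ := integral_norm_condCharFun_sub_le hg A
    rw [tendsto_iff_norm_sub_tendsto_zero]
    refine squeeze_zero (fun m => norm_nonneg _) (fun m =>
      (norm_charFun_leadLaw_sub_le hg A (ε m) (hm m) (h0 m) (hB m) (hi m) t _).trans
        (mul_le_mul_of_nonneg_left (hb (d m) (ε m) (hε m) t θ hθ) hB0)) ?_
    have e1 : Tendsto (fun m => |∑ i, ε m i ^ (2 * order A) - θ|) atTop (𝓝 0) := by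
      simpa using (hsum.sub_const θ).abs
    have e2 := (hsum'.const_mul C).sqrt
    have e3 := (((hsum'.const_mul (C * (|t| ^ 3 + t ^ 4))).add
      ((e2.add (e1.const_mul K)).const_mul (t ^ 2 / 2))).const_mul B)
    simpa using e3
  have hlim := tendsto_integral_min_one_exp (by positivity) hQ
  have hQi (m : ℕ) : ∫ s, min 1 (Real.exp (s - K * θ / 2)) ∂(Q m : Measure ℝ) =
      ∫ w, h m w.1 * min 1 (Real.exp (leadSum A g (ε m) w - K * θ / 2)) ∂(jointLaw g (d m)) :=
    integral_leadLaw hg A (ε m) (hm m) (h0 m)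
      (F := fun s => min 1 (Real.exp (s - K * θ / 2)))
      (Continuous.stronglyMeasurable (by fun_prop))
  simp only [hQi] at hlim
  -- What remains is to replace the shifted leading sum by the true log ratio; the Lipschitz bound
  -- and `h ≤ B` reduce this to `L¹` errors under the reference law.
  refine hlim.congr_dist ?_
  obtain ⟨C, hC, hb⟩ := integral_abs_logRatioSum_sub_le hg A
  have hbound (m : ℕ) : dist
      (∫ w, h m w.1 * min 1 (Real.exp (leadSum A g (ε m) w - K * θ / 2)) ∂(jointLaw g (d m)))
      (∫ w, h m w.1 * min 1 (Real.exp (logRatioSum A g (ε m) w + D m w)) ∂(jointLaw g (d m))) ≤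
      B * ((√(C * ∑ i, ε m i ^ (2 * order A + 1)) + C * ∑ i, ε m i ^ (2 * order A + 1)) +
        (∫ w, min 1 |D m w| ∂(jointLaw g (d m)) +
          K / 2 * |∑ i, ε m i ^ (2 * order A) - θ|)) := by
    have hint : Integrable (h m) (Measure.pi fun _ : Fin (d m) => refLaw g) := by
      by_contra hn
      have := hi m
      rw [integral_undef hn] at this
      exact zero_ne_one this
    have hS := measurable_leadSum hg A (ε m)
    have hR := measurable_logRatioSum hg A (ε m)
    have hDm := hDm m
    have hmm := hm m
    have hacc (F : (Fin (d m) → ℝ) × (Fin (d m) → ℝ) → ℝ) (hF : Measurable F) :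
        Integrable (fun w => h m w.1 * min 1 (Real.exp (F w))) (jointLaw g (d m)) := by
      refine (integrable_density_fst hg hint).mono (by fun_prop) (ae_of_all _ fun w => ?_)
      rw [norm_mul]
      refine mul_le_of_le_one_right (norm_nonneg _) ?_
      rw [Real.norm_of_nonneg (le_min zero_le_one (Real.exp_nonneg _))]
      exact min_le_left _ _
    have iR : Integrable (fun w => |logRatioSum A g (ε m) w - leadSum A g (ε m) w +
        K / 2 * ∑ i, ε m i ^ (2 * order A)|) (jointLaw g (d m)) :=
      (((integrable_logRatioSum hg A (hε m)).sub (integrable_leadSum hg A (ε m))).add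
        (integrable_const _)).abs
    have iD : Integrable (fun w => min 1 |D m w|) (jointLaw g (d m)) := by
      refine (integrable_const (1 : ℝ)).mono' (by fun_prop) (ae_of_all _ fun w => ?_)
      rw [Real.norm_of_nonneg (le_min zero_le_one (abs_nonneg _))]
      exact min_le_left _ _
    have iD' : Integrable (fun w => min 1 |D m w| + K / 2 * |∑ i, ε m i ^ (2 * order A) - θ|)
      (jointLaw g (d m)) := iD.add (integrable_const _)
    rw [dist_eq_norm, ← integral_sub (hacc _ (by fun_prop)) (hacc _ (by fun_prop))]
    calc _ ≤ ∫ w, B * (|logRatioSum A g (ε m) w - leadSum A g (ε m) w +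
          K / 2 * ∑ i, ε m i ^ (2 * order A)| + (min 1 |D m w| +
          K / 2 * |∑ i, ε m i ^ (2 * order A) - θ|)) ∂(jointLaw g (d m)) := by
          refine norm_integral_le_of_norm_le ((iR.add iD').const_mul B) ?_
          filter_upwards [ae_jointLaw_of_ae hg (hB m)] with w hw
          rw [← mul_sub, norm_mul, Real.norm_of_nonneg (h0 m _), Real.norm_eq_abs]
          refine mul_le_mul hw ?_ (abs_nonneg _) hB0
          refine (abs_min_one_exp_sub_le _ _).trans ?_
          rw [abs_sub_comm]
          set a := logRatioSum A g (ε m) w - leadSum A g (ε m) w +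
            K / 2 * ∑ i, ε m i ^ (2 * order A) with ha
          have e : logRatioSum A g (ε m) w + D m w - (leadSum A g (ε m) w - K * θ / 2) =
              a + (D m w - K / 2 * (∑ i, ε m i ^ (2 * order A) - θ)) := by rw [ha]; ring
          rw [e]
          have e1 : |K / 2 * (∑ i, ε m i ^ (2 * order A) - θ)| =
              K / 2 * |∑ i, ε m i ^ (2 * order A) - θ| := by
            rw [abs_mul, abs_of_pos (by positivity : 0 < K / 2)]
          have t1 := abs_add_le a (D m w - K / 2 * (∑ i, ε m i ^ (2 * order A) - θ))
          have t2 := abs_sub (D m w) (K / 2 * (∑ i, ε m i ^ (2 * order A) - θ))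
          rw [e1] at t2
          have p1 := abs_nonneg a
          have p2 : 0 ≤ K / 2 * |∑ i, ε m i ^ (2 * order A) - θ| := by positivity
          -- Whichever of `1` and `|D m w|` is smaller, the corresponding half of the Lipschitz
          -- bound is used, so that `D` enters only as `min 1 |D|`.
          rcases le_total 1 |D m w| with h1 | h1
          · rw [min_eq_left h1]
            exact (min_le_left _ _).trans (by linarith)
          · rw [min_eq_right h1]
            exact (min_le_right _ _).trans (by linarith)
      _ = B * (∫ w, |logRatioSum A g (ε m) w - leadSum A g (ε m) w +
          K / 2 * ∑ i, ε m i ^ (2 * order A)| ∂(jointLaw g (d m)) +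
          (∫ w, min 1 |D m w| ∂(jointLaw g (d m)) +
          K / 2 * |∑ i, ε m i ^ (2 * order A) - θ|)) := by
          rw [integral_const_mul, integral_add iR iD', integral_add iD (integrable_const _)]
          simp
      _ ≤ _ := by
          gcongr
          exact hb (d m) (ε m) (hε m)
  refine squeeze_zero (fun m => dist_nonneg) hbound ?_
  have e1 : Tendsto (fun m => |∑ i, ε m i ^ (2 * order A) - θ|) atTop (𝓝 0) := by
    simpa using (hsum.sub_const θ).abs
  have e2 := (hsum'.const_mul C).sqrt
  have e3 := ((e2.add (hsum'.const_mul C)).add (hD.add (e1.const_mul (K / 2)))).const_mul B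
  simpa using e3

lemma integrable_exp_half_logRatioSum (hg : RegularPotential g) (A : Algorithm) {n : ℕ}
    {ε : Fin n → ℝ} (hε : ∀ i, 0 < ε i) :
    Integrable (fun w => Real.exp (logRatioSum A g ε w / 2)) (jointLaw g n) ∧
      ∫ w, Real.exp (logRatioSum A g ε w / 2) ∂(jointLaw g n) =
        ∏ i, ∫ w, Real.exp (logRatio A g (ε i) w.1 w.2 / 2) ∂(coordLaw g) := by
  have := hg.isProbabilityMeasure_coordLaw
  let f : Fin n → ℝ × ℝ → ℝ := fun i w => Real.exp (logRatio A g (ε i) w.1 w.2 / 2)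
  have hprod (w : (Fin n → ℝ) × (Fin n → ℝ)) : Real.exp (logRatioSum A g ε w / 2) =
      (fun v : Fin n → ℝ × ℝ => ∏ i, f i (v i)) (fun i => (w.1 i, w.2 i)) := by
    simp only [f]
    rw [← Real.exp_sum, ← Finset.sum_div, logRatioSum]
  have hpi : Integrable (fun v : Fin n → ℝ × ℝ => ∏ i, f i (v i))
      (Measure.pi fun _ => coordLaw g) :=
    Integrable.fintype_prod fun i => integrable_exp_half_logRatio hg A (hε i)
  have hmp := measurePreserving_coordPairs hg n
  simp only [hprod]
  constructor
  · exact hmp.integrable_comp_of_integrable hpi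
  · rw [← integral_fintype_prod_eq_prod (μ := fun _ => coordLaw g) f, ← hmp.map_eq]
    exact (integral_map hmp.measurable.aemeasurable
      (by rw [hmp.map_eq]; exact hpi.aestronglyMeasurable)).symm

/-- A bound on the mean acceptance probability that holds at every scale. -/
theorem integral_accept_le (hg : RegularPotential g) (A : Algorithm) :
    ∃ (C : ℝ), 0 ≤ C ∧ ∀ (n : ℕ) (ε : Fin n → ℝ), (∀ i, 0 < ε i ∧ ε i ≤ 1) →
      ∀ (φ₀ : (Fin n → ℝ) → ℝ) (φ₁ : (Fin n → ℝ) × (Fin n → ℝ) → ℝ) (M : ℝ),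
      (∀ᵐ w ∂(jointLaw g n), M ≤ φ₀ w.1) → (∀ᵐ w ∂(jointLaw g n), M ≤ φ₁ w) →
      ∫ w, Real.exp (-φ₀ w.1) * min 1 (Real.exp (logRatioSum A g ε w + (φ₀ w.1 - φ₁ w)))
        ∂(jointLaw g n) ≤
      Real.exp (-M) * Real.exp (-(limitConst A g / 32 * ∑ i, ε i ^ (2 * order A) -
        C * ∑ i, ε i ^ (2 * order A + 1))) := by
  obtain ⟨C, hC, hb⟩ := integral_exp_half_logRatio_le hg A
  refine ⟨C, hC, fun n ε hε φ₀ φ₁ M h0 h1 => ?_⟩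
  obtain ⟨hint, hval⟩ := integrable_exp_half_logRatioSum hg A fun i => (hε i).1
  calc _ ≤ ∫ w, Real.exp (-M) * Real.exp (logRatioSum A g ε w / 2) ∂(jointLaw g n) := by
        refine integral_mono_of_nonneg (ae_of_all _ fun w => ?_) (hint.const_mul _) ?_
        · exact mul_nonneg (Real.exp_nonneg _) (le_min zero_le_one (Real.exp_nonneg _))
        · filter_upwards [h0, h1] with w hw0 hw1
          -- Halving the exponent leaves `-φ₀ + (φ₀ - φ₁) / 2 = -(φ₀ + φ₁) / 2 ≤ -M`, so no
          -- smallness of the difference is required.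
          have hmin (a : ℝ) : min 1 (Real.exp a) ≤ Real.exp (a / 2) := by
            rcases le_total 0 a with ha | ha
            · exact (min_le_left _ _).trans (Real.one_le_exp (by linarith))
            · exact (min_le_right _ _).trans (Real.exp_le_exp.2 (by linarith))
          refine (mul_le_mul_of_nonneg_left (hmin _) (Real.exp_nonneg _)).trans ?_
          rw [← Real.exp_add, ← Real.exp_add]
          exact Real.exp_le_exp.2 (by linarith)
    _ = Real.exp (-M) * ∏ i, ∫ w, Real.exp (logRatio A g (ε i) w.1 w.2 / 2) ∂(coordLaw g) := by
        rw [integral_const_mul, hval]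
    _ ≤ _ := by
        refine mul_le_mul_of_nonneg_left ?_ (Real.exp_nonneg _)
        rw [Finset.mul_sum, Finset.mul_sum, ← Finset.sum_sub_distrib, ← Finset.sum_neg_distrib,
          Real.exp_sum]
        refine Finset.prod_le_prod (fun i _ => integral_nonneg fun w => Real.exp_nonneg _)
          fun i _ => ?_
        refine (hb (ε i) (hε i).1 (hε i).2).trans ?_
        refine le_trans (le_of_eq ?_) (Real.add_one_le_exp _)
        ring

/-! ### Passage between the state space and rescaled coordinates. -/

section ProductDensity

lemma pi_withDensity_ofReal {ι : Type*} [Fintype ι] {f : ι → ℝ → ℝ} (hf : ∀ i x, 0 ≤ f i x)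
    (hi : ∀ i, Integrable (f i)) :
    Measure.pi (fun i => (volume : Measure ℝ).withDensity fun x => ENNReal.ofReal (f i x)) =
      (volume : Measure (ι → ℝ)).withDensity fun x => ENNReal.ofReal (∏ i, f i (x i)) := by
  have hfin (i : ι) : IsFiniteMeasure ((volume : Measure ℝ).withDensity
      fun x => ENNReal.ofReal (f i x)) := isFiniteMeasure_withDensity_ofReal (hi i).2
  refine Measure.pi_eq fun s hs => ?_
  rw [withDensity_apply _ (MeasurableSet.univ_pi hs), volume_pi, Measure.restrict_pi_pi,
    ← ofReal_integral_eq_lintegral_ofReal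
      (Integrable.fintype_prod fun i => (hi i).integrableOn)
      (ae_of_all _ fun x => Finset.prod_nonneg fun i _ => hf i (x i)),
    integral_fintype_prod_eq_prod, ENNReal.ofReal_prod_of_nonneg]
  · refine Finset.prod_congr rfl fun i _ => ?_
    rw [withDensity_apply _ (hs i), ofReal_integral_eq_lintegral_ofReal (hi i).integrableOn
      (ae_of_all _ fun x => hf i x)]
  · exact fun i _ => integral_nonneg fun x => hf i x

end ProductDensity

section Scaling

variable {κ : ℝ} {n : ℕ}

lemma scale_pos (κ : ℝ) (i : Fin n) : 0 < scale κ i :=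
  Real.rpow_pos_of_pos (by positivity) _

/-- The passage from rescaled coordinates to the state space. -/
noncomputable def fromScaled (κ : ℝ) (n : ℕ) : (Fin n → ℝ) ≃ᵐ State n :=
  (MeasurableEquiv.piCongrRight fun i : Fin n =>
    (Homeomorph.mulLeft₀ (scale κ i) (scale_pos κ i).ne').toMeasurableEquiv).trans
    (MeasurableEquiv.toLp 2 (Fin n → ℝ))

lemma fromScaled_apply (κ : ℝ) (n : ℕ) (u : Fin n → ℝ) (i : Fin n) :
    fromScaled κ n u i = scale κ i * u i := rfl

lemma fromScaled_div (κ : ℝ) (n : ℕ) (u : Fin n → ℝ) (i : Fin n) :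
    fromScaled κ n u i / scale κ i = u i := by
  rw [fromScaled_apply, mul_div_cancel_left₀ _ (scale_pos κ i).ne']

lemma map_mul_refLaw (hg : RegularPotential g) {a : ℝ} (ha : 0 < a) :
    (refLaw g).map (fun u => a * u) =
      volume.withDensity fun x => ENNReal.ofReal (1 / a * Real.exp (-g (x / a))) := by
  have hc := hg.smooth.continuous
  ext s hs
  rw [Measure.map_apply (by fun_prop) hs, refLaw, withDensity_apply _ (hs.preimage (by fun_prop)),
    withDensity_apply _ hs]
  nth_rewrite 2 [← Real.smul_map_volume_mul_left ha.ne']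
  rw [Measure.restrict_smul, lintegral_smul_measure,
    setLIntegral_map hs (by fun_prop) (by fun_prop), smul_eq_mul,
    ← lintegral_const_mul _ (by fun_prop)]
  refine lintegral_congr fun u => ?_
  rw [← ENNReal.ofReal_mul (abs_nonneg a), abs_of_pos ha, mul_div_cancel_left₀ _ ha.ne',
    ← mul_assoc, mul_one_div_cancel ha.ne', one_mul]

lemma integrable_scaled_density (hg : RegularPotential g) {a : ℝ} (ha : 0 < a) :
    Integrable fun x => 1 / a * Real.exp (-g (x / a)) := by
  have h : Integrable fun u => Real.exp (-g u) := by simpa using hg.moments 0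
  exact (h.comp_div ha.ne').const_mul _

lemma refMeasure_eq_map (hg : RegularPotential g) (κ : ℝ) (n : ℕ) :
    refMeasure κ g n = (Measure.pi fun _ : Fin n => refLaw g).map (fromScaled κ n) := by
  have hpr := hg.isProbabilityMeasure_refLaw
  have hc := hg.smooth.continuous
  have hpi : (Measure.pi fun _ : Fin n => refLaw g).map (fun u i => scale κ i * u i) =
      (volume : Measure (Fin n → ℝ)).withDensity fun x =>
        ENNReal.ofReal (∏ i : Fin n, 1 / scale κ i * Real.exp (-g (x i / scale κ i))) := by
    have hpm (i : Fin n) : IsProbabilityMeasure ((refLaw g).map fun u => scale κ i * u) :=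
      Measure.isProbabilityMeasure_map (by fun_prop)
    rw [Measure.pi_map_pi (f := fun i u => scale κ i * u) (fun i => by fun_prop),
      ← pi_withDensity_ofReal (f := fun i x => 1 / scale κ i * Real.exp (-g (x / scale κ i)))
      (fun i x => mul_nonneg (one_div_nonneg.2 (scale_pos κ i).le) (Real.exp_nonneg _))
      (fun i => integrable_scaled_density hg (scale_pos κ i))]
    congr 1
    ext1 i
    exact map_mul_refLaw hg (scale_pos κ i)
  have hcomp : (fromScaled κ n : (Fin n → ℝ) → State n) =
      (MeasurableEquiv.toLp 2 (Fin n → ℝ)) ∘ fun u i => scale κ i * u i := rfl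
  rw [hcomp, ← Measure.map_map (MeasurableEquiv.measurable _) (by fun_prop), hpi]
  ext s hs
  rw [refMeasure, withDensity_apply _ hs, MeasurableEquiv.map_apply,
    withDensity_apply _ (hs.preimage (MeasurableEquiv.measurable _))]
  have hmp := PiLp.volume_preserving_toLp (Fin n)
  have := hmp.setLIntegral_comp_preimage hs (f := fun x : State n =>
    ENNReal.ofReal (refDensity κ g x)) (by unfold refDensity; fun_prop)
  rw [← this]
  rfl

end Scaling

/-! ### The Metropolis–Hastings ratio in rescaled coordinates. -/

section Algebra

variable {n : ℕ}

lemma refDensity_eq (κ : ℝ) (g : ℝ → ℝ) (x : State n) :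
    refDensity κ g x = (∏ i : Fin n, 1 / scale κ i) * Real.exp (-∑ i, g (x i / scale κ i)) := by
  rw [refDensity, Finset.prod_mul_distrib, ← Real.exp_sum, Finset.sum_neg_distrib]

lemma prod_one_div_scale_pos (κ : ℝ) (n : ℕ) : 0 < ∏ i : Fin n, 1 / scale κ i :=
  Finset.prod_pos fun i _ => one_div_pos.2 (scale_pos κ i)

lemma refDensity_pos (κ : ℝ) (g : ℝ → ℝ) (x : State n) : 0 < refDensity κ g x := by
  rw [refDensity_eq]
  exact mul_pos (prod_one_div_scale_pos κ n) (Real.exp_pos _)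

lemma gradient_log_refDensity (hg : RegularPotential g) (κ : ℝ) (x : State n) :
    gradient (fun y : State n => Real.log (refDensity κ g y)) x =
      WithLp.toLp 2 fun i => -(iteratedDeriv 1 g (x i / scale κ i) / scale κ i) := by
  refine HasGradientAt.gradient ?_
  rw [hasGradientAt_iff_hasFDerivAt]
  have e : (fun y : State n => Real.log (refDensity κ g y)) =
      fun y => Real.log (∏ i : Fin n, 1 / scale κ i) - ∑ i, g (y i / scale κ i) := by
    ext y
    rw [refDensity_eq, Real.log_mul (prod_one_div_scale_pos κ n).ne' (Real.exp_ne_zero _),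
      Real.log_exp, sub_eq_add_neg]
  rw [e]
  have hd (i : Fin n) : HasFDerivAt (fun y : State n => g (y i / scale κ i))
      ((iteratedDeriv 1 g (x i / scale κ i) / scale κ i) •
        (EuclideanSpace.proj i : State n →L[ℝ] ℝ)) x := by
    have h1 : HasDerivAt (fun t : ℝ => g (t / scale κ i))
        (iteratedDeriv 1 g (x i / scale κ i) / scale κ i) (x i) := by
      have := (hg.hasDerivAt (x i / scale κ i)).comp (x i)
        ((hasDerivAt_id (x i)).div_const (scale κ i))
      exact this.congr_deriv (by ring)
    exact HasDerivAt.comp_hasFDerivAt (h₂ := fun t : ℝ => g (t / scale κ i)) x h1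
      (EuclideanSpace.proj i : State n →L[ℝ] ℝ).hasFDerivAt
  refine ((HasFDerivAt.fun_sum fun i _ => hd i).const_sub _).congr_fderiv ?_
  ext v
  simp [PiLp.inner_apply, mul_comm]

/-- The drift `σ ^ 2 / 2 * g' / λ` equals `λ` times `ε ^ 2 / 2 * g'` with `ε = σ / λ`, so the SLA
step is again an SLA step in each rescaled coordinate. -/
lemma proposalMean_fromScaled (hg : RegularPotential g) (A : Algorithm) (κ σ : ℝ)
    (u : Fin n → ℝ) :
    proposalMean A κ g σ (fromScaled κ n u) =
      fromScaled κ n fun i => coordMean A g (σ / scale κ i) (u i) := by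
  cases A with
  | RWM => rfl
  | SLA =>
    ext i
    have := (scale_pos κ i).ne'
    simp only [proposalMean, gradient_log_refDensity hg, PiLp.add_apply, PiLp.smul_apply,
      fromScaled_apply, coordMean, smul_eq_mul]
    rw [mul_div_cancel_left₀ _ this]
    field_simp
    ring

/-- The proposal, in rescaled coordinates. -/
noncomputable def scaledProposal (A : Algorithm) (g : ℝ → ℝ) (ε : Fin n → ℝ)
    (w : (Fin n → ℝ) × (Fin n → ℝ)) (i : Fin n) : ℝ :=
  coordProposal A g (ε i) (w.1 i) (w.2 i)

lemma proposal_fromScaled (hg : RegularPotential g) (A : Algorithm) (κ σ : ℝ)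
    (w : (Fin n → ℝ) × (Fin n → ℝ)) :
    proposal A κ g σ (fromScaled κ n w.1) (WithLp.toLp 2 w.2) =
      fromScaled κ n (scaledProposal A g (fun i => σ / scale κ i) w) := by
  ext i
  have := (scale_pos κ i).ne'
  simp only [proposal, proposalMean_fromScaled hg, PiLp.add_apply, PiLp.smul_apply,
    fromScaled_apply, scaledProposal, coordProposal, smul_eq_mul]
  field_simp

lemma norm_sq_eq_sum (x : State n) : ‖x‖ ^ 2 = ∑ i, x i ^ 2 := by
  rw [EuclideanSpace.norm_sq_eq]
  simp

lemma proposalDensity_forward (A : Algorithm) (κ : ℝ) {σ : ℝ} (hσ : 0 < σ) (x z : State n) :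
    proposalDensity A κ g σ x (proposal A κ g σ x z) =
      (Real.sqrt (2 * Real.pi * σ ^ 2))⁻¹ ^ n * Real.exp (-(∑ i, z i ^ 2) / 2) := by
  rw [proposalDensity, proposal, add_sub_cancel_left, norm_smul, mul_pow, norm_sq_eq_sum,
    Real.norm_of_nonneg hσ.le]
  congr 2
  field_simp

lemma proposalDensity_backward (hg : RegularPotential g) (A : Algorithm) (κ : ℝ) {σ : ℝ}
    (hσ : 0 < σ) (w : (Fin n → ℝ) × (Fin n → ℝ)) :
    proposalDensity A κ g σ (fromScaled κ n (scaledProposal A g (fun i => σ / scale κ i) w))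
      (fromScaled κ n w.1) =
      (Real.sqrt (2 * Real.pi * σ ^ 2))⁻¹ ^ n *
        Real.exp (-(∑ i, reverseNoise A g (σ / scale κ i) (w.1 i) (w.2 i) ^ 2) / 2) := by
  rw [proposalDensity, proposalMean_fromScaled hg]
  have e : fromScaled κ n w.1 - fromScaled κ n (fun i => coordMean A g (σ / scale κ i)
      (scaledProposal A g (fun i => σ / scale κ i) w i)) =
      σ • WithLp.toLp 2 fun i => reverseNoise A g (σ / scale κ i) (w.1 i) (w.2 i) := by
    ext i
    have := (scale_pos κ i).ne'
    simp only [PiLp.sub_apply, PiLp.smul_apply, fromScaled_apply, smul_eq_mul, reverseNoise,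
      scaledProposal]
    field_simp
  rw [e, norm_smul, mul_pow, norm_sq_eq_sum, Real.norm_of_nonneg hσ.le]
  congr 2
  field_simp

lemma targetDensity_fromScaled (κ : ℝ) (φ : State n → ℝ) (u : Fin n → ℝ) :
    targetDensity κ g φ (fromScaled κ n u) =
      Real.exp (-φ (fromScaled κ n u)) *
        ((∏ i : Fin n, 1 / scale κ i) * Real.exp (-∑ i, g (u i))) := by
  rw [targetDensity, refDensity_eq]
  simp only [fromScaled_div]

lemma acceptProb_fromScaled (hg : RegularPotential g) (A : Algorithm) (κ : ℝ) {σ : ℝ}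
    (hσ : 0 < σ) (φ : State n → ℝ) (w : (Fin n → ℝ) × (Fin n → ℝ)) :
    acceptProb A κ g σ φ (fromScaled κ n w.1)
      (proposal A κ g σ (fromScaled κ n w.1) (WithLp.toLp 2 w.2)) =
      min 1 (Real.exp (logRatioSum A g (fun i => σ / scale κ i) w +
        (φ (fromScaled κ n w.1) -
          φ (fromScaled κ n (scaledProposal A g (fun i => σ / scale κ i) w))))) := by
  have hf := proposalDensity_forward (g := g) A κ hσ (fromScaled κ n w.1) (WithLp.toLp 2 w.2)
  have hb := proposalDensity_backward hg A κ hσ w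
  rw [acceptProb, hf]
  rw [proposal_fromScaled hg, hb, targetDensity_fromScaled, targetDensity_fromScaled]
  have hp := prod_one_div_scale_pos κ n
  have hq : 0 < (Real.sqrt (2 * Real.pi * σ ^ 2))⁻¹ ^ n := by positivity
  -- All densities are strictly positive, so the default branch never occurs; the normalising
  -- constants `c` and `q` then cancel.
  rw [if_pos (by positivity)]
  congr 1
  rw [div_eq_iff (by positivity)]
  set c := ∏ i : Fin n, 1 / scale κ i
  set q := (Real.sqrt (2 * Real.pi * σ ^ 2))⁻¹ ^ n
  have e (a b d : ℝ) : Real.exp a * (c * Real.exp b) * (q * Real.exp d) =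
      c * q * Real.exp (a + b + d) := by
    rw [Real.exp_add, Real.exp_add]; ring
  rw [e, e, mul_left_comm, ← Real.exp_add]
  congr 2
  simp only [logRatioSum, logRatio, scaledProposal]
  rw [Finset.sum_add_distrib, Finset.sum_sub_distrib, ← Finset.sum_div, Finset.sum_sub_distrib]
  ring

end Algebra

/-! ### The mean acceptance probability as an integral over i.i.d. coordinates. -/

section Reduction

variable {n : ℕ}

/-- The density of the target law with respect to the reference law, in rescaled coordinates. -/
noncomputable def scaledDensity (κ : ℝ) (φ : State n → ℝ) (u : Fin n → ℝ) : ℝ :=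
  Real.exp (-φ (fromScaled κ n u))

/-- The contribution of the change of measure to the log ratio. -/
noncomputable def potentialDiff (A : Algorithm) (κ : ℝ) (g : ℝ → ℝ) (σ : ℝ) (φ : State n → ℝ)
    (w : (Fin n → ℝ) × (Fin n → ℝ)) : ℝ :=
  φ (fromScaled κ n w.1) - φ (fromScaled κ n (scaledProposal A g (fun i => σ / scale κ i) w))

lemma measurable_scaledProposal (hg : RegularPotential g) (A : Algorithm) (ε : Fin n → ℝ) :
    Measurable (scaledProposal A g ε) := by
  refine measurable_pi_iff.2 fun i => ?_
  exact (measurable_coordProposal hg A (ε i)).comp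
    (f := fun w : (Fin n → ℝ) × (Fin n → ℝ) => (w.1 i, w.2 i)) (by fun_prop)

lemma measurable_potentialDiff (hg : RegularPotential g) (A : Algorithm) (κ σ : ℝ)
    {φ : State n → ℝ} (hφ : Measurable φ) : Measurable (potentialDiff A κ g σ φ) :=
  ((hφ.comp (fromScaled κ n).measurable).comp measurable_fst).sub
    ((hφ.comp (fromScaled κ n).measurable).comp (measurable_scaledProposal hg A _))

/-- The mean acceptance probability, in rescaled coordinates. -/
theorem meanAcceptProb_eq (hg : RegularPotential g) (A : Algorithm) (κ : ℝ) {σ : ℝ} (hσ : 0 < σ)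
    {φ : State n → ℝ} (hφ : Measurable φ) :
    meanAcceptProb A κ g σ φ = ∫ w, scaledDensity κ φ w.1 *
      min 1 (Real.exp (logRatioSum A g (fun i => σ / scale κ i) w + potentialDiff A κ g σ φ w))
      ∂(jointLaw g n) := by
  have hpr := hg.isProbabilityMeasure_refLaw
  have hme : MeasurableEmbedding
      (Prod.map (fromScaled κ n) (MeasurableEquiv.toLp 2 (Fin n → ℝ))) :=
    ((fromScaled κ n).prodCongr (MeasurableEquiv.toLp 2 (Fin n → ℝ))).measurableEmbedding
  rw [meanAcceptProb, targetMeasure, refMeasure_eq_map hg, ← map_pi_eq_stdGaussian]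
  rw [prod_withDensity_left (by fun_prop)]
  rw [integral_withDensity_eq_integral_toReal_smul (by fun_prop) (by simp)]
  change ∫ w, _ ∂((Measure.map (fromScaled κ n) (Measure.pi fun _ : Fin n => refLaw g)).prod
    (Measure.map (MeasurableEquiv.toLp 2 (Fin n → ℝ))
      (Measure.pi fun _ : Fin n => gaussianReal 0 1))) = _
  rw [Measure.map_prod_map _ _ (fromScaled κ n).measurable (MeasurableEquiv.measurable _),
    hme.integral_map]
  refine integral_congr_ae (ae_of_all _ fun w => ?_)
  simp only [Prod.map_fst, Prod.map_snd, ENNReal.toReal_ofReal (Real.exp_nonneg _), smul_eq_mul]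
  rw [MeasurableEquiv.coe_toLp, acceptProb_fromScaled hg A κ hσ]
  rfl

lemma integral_scaledDensity (hg : RegularPotential g) (κ : ℝ) {φ : State n → ℝ}
    (hφ : Measurable φ) (hp : IsProbabilityMeasure (targetMeasure κ g φ)) :
    ∫ u, scaledDensity κ φ u ∂(Measure.pi fun _ : Fin n => refLaw g) = 1 := by
  have h1 := hp.measure_univ
  rw [targetMeasure, withDensity_apply _ MeasurableSet.univ, setLIntegral_univ,
    refMeasure_eq_map hg, lintegral_map_equiv] at h1
  have hm : Measurable (scaledDensity κ φ) := (hφ.comp (fromScaled κ n).measurable).neg.exp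
  rw [integral_eq_lintegral_of_nonneg_ae (f := scaledDensity κ φ)
    (ae_of_all _ fun u => Real.exp_nonneg _) hm.aestronglyMeasurable]
  simp only [scaledDensity]
  rw [h1, ENNReal.toReal_one]

lemma ae_jointLaw_start (hg : RegularPotential g) (κ : ℝ) {p : State n → Prop}
    (hp : ∀ᵐ x ∂(refMeasure κ g n), p x) : ∀ᵐ w ∂(jointLaw g n), p (fromScaled κ n w.1) := by
  rw [refMeasure_eq_map hg] at hp
  exact ae_jointLaw_of_ae hg (ae_of_ae_map (fromScaled κ n).measurable.aemeasurable hp)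

lemma pi_gaussian_absolutelyContinuous (n : ℕ) :
    Measure.pi (fun _ : Fin n => gaussianReal 0 1) ≪ (volume : Measure (Fin n → ℝ)) := by
  have : (fun _ : Fin n => gaussianReal 0 1) = fun _ : Fin n =>
      (volume : Measure ℝ).withDensity fun x => ENNReal.ofReal (gaussianPDFReal 0 1 x) := by
    ext1 i
    rw [gaussianReal_of_var_ne_zero _ one_ne_zero]
    rfl
  rw [this, pi_withDensity_ofReal (f := fun _ x => gaussianPDFReal 0 1 x)
    (fun _ => gaussianPDFReal_nonneg 0 1) fun _ => integrable_gaussianPDFReal 0 1]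
  exact withDensity_absolutelyContinuous _ _

/-- A property that holds almost surely for the reference law holds almost surely for the
proposal. -/
lemma ae_jointLaw_proposal (hg : RegularPotential g) (A : Algorithm) (κ : ℝ) {σ : ℝ} (hσ : 0 < σ)
    {p : State n → Prop} (hp : ∀ᵐ x ∂(refMeasure κ g n), p x) :
    ∀ᵐ w ∂(jointLaw g n),
      p (fromScaled κ n (scaledProposal A g (fun i => σ / scale κ i) w)) := by
  have hpr := hg.isProbabilityMeasure_refLaw
  have hc := hg.smooth.continuous
  -- The reference density is positive everywhere, so its null sets are Lebesgue null. A measurable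
  -- superset of the exceptional set is then taken so that Fubini applies.
  have hac : (volume : Measure (State n)) ≪ refMeasure κ g n :=
    withDensity_absolutelyContinuous' (by unfold refDensity; fun_prop)
      (ae_of_all _ fun x => by simpa using refDensity_pos κ g x)
  have hp' : ∀ᵐ x ∂(volume : Measure (State n)), p x := hac.ae_le hp
  have hnull : volume {x | ¬ p x} = 0 := hp'
  obtain ⟨N, hN, hNm, hN0⟩ := exists_measurable_superset_of_null hnull
  suffices h : ∀ᵐ w ∂(jointLaw g n),
      fromScaled κ n (scaledProposal A g (fun i => σ / scale κ i) w) ∉ N by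
    filter_upwards [h] with w hw
    by_contra hn
    exact hw (hN hn)
  have hm : Measurable fun w => fromScaled κ n (scaledProposal A g (fun i => σ / scale κ i) w) :=
    (fromScaled κ n).measurable.comp (measurable_scaledProposal hg A _)
  rw [jointLaw, Measure.ae_prod_iff_ae_ae (by exact (hm hNm.compl))]
  refine ae_of_all _ fun u => ?_
  refine (pi_gaussian_absolutelyContinuous n).ae_le ?_
  -- For a fixed start the proposal is a translate of a nonzero multiple of the noise, which has a
  -- Lebesgue density.
  have hq : Measure.QuasiMeasurePreserving (fun z : Fin n → ℝ =>
      proposalMean A κ g σ (fromScaled κ n u) + σ • WithLp.toLp 2 z) volume volume :=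
    (measurePreserving_add_left (volume : Measure (State n)) _).quasiMeasurePreserving.comp
      ((Measure.quasiMeasurePreserving_smul (volume : Measure (State n)) hσ.ne').comp
        (PiLp.volume_preserving_toLp (Fin n)).quasiMeasurePreserving)
  have hN' : ∀ᵐ x ∂(volume : Measure (State n)), x ∉ N := by
    rw [ae_iff]
    simpa using hN0
  filter_upwards [hq.ae hN'] with z hz
  have := proposal_fromScaled hg A κ σ (u, z)
  rw [proposal] at this
  rw [← this]
  exact hz

end Reduction

lemma scale_eq (κ : ℝ) {n : ℕ} (i : Fin n) : scale κ i = ((i : ℝ) + 1) ^ (-κ) := rfl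

lemma exists_sum_rpow_le {a : ℝ} (ha : a < -1) :
    ∃ S : ℝ, 0 ≤ S ∧ ∀ n : ℕ, ∑ i : Fin n, ((i : ℝ) + 1) ^ a ≤ S := by
  have hs : Summable fun i : ℕ => ((i : ℝ) + 1) ^ a := by
    have := (summable_nat_add_iff 1).2 (Real.summable_nat_rpow.2 ha)
    simpa using this
  refine ⟨∑' i : ℕ, ((i : ℝ) + 1) ^ a, tsum_nonneg fun i => by positivity, fun n => ?_⟩
  rw [Fin.sum_univ_eq_sum_range (fun i => ((i : ℝ) + 1) ^ a) n]
  exact hs.sum_le_tsum _ fun i _ => by positivity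

/-! ### Second moments of the start and of the step in weighted norms. -/

section WeightedNorm

variable {n : ℕ} {s : ℝ}

lemma sNorm_nonneg (s : ℝ) (x : State n) : 0 ≤ sNorm s x := Real.sqrt_nonneg _

lemma sNorm_sq (s : ℝ) (x : State n) :
    sNorm s x ^ 2 = ∑ i : Fin n, ((i : ℝ) + 1) ^ (2 * s) * x i ^ 2 :=
  Real.sq_sqrt (Finset.sum_nonneg fun i _ => by positivity)

lemma sNorm_sq_le (s : ℝ) (x y : State n) :
    sNorm s y ^ 2 ≤ 2 * sNorm s x ^ 2 + 2 * sNorm s (y - x) ^ 2 := by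
  simp only [sNorm_sq, Finset.mul_sum, ← Finset.sum_add_distrib]
  refine Finset.sum_le_sum fun i _ => ?_
  have h : y i ^ 2 ≤ 2 * x i ^ 2 + 2 * (y - x) i ^ 2 := by
    simp only [PiLp.sub_apply]
    nlinarith [sq_nonneg (y i - 2 * x i)]
  have := mul_le_mul_of_nonneg_left h (by positivity : 0 ≤ ((i : ℝ) + 1) ^ (2 * s))
  linarith

lemma rpow_mul_scale_sq (κ s : ℝ) (i : Fin n) :
    ((i : ℝ) + 1) ^ (2 * s) * scale κ i ^ 2 = ((i : ℝ) + 1) ^ (2 * s - 2 * κ) := by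
  have h : (0 : ℝ) < (i : ℝ) + 1 := by positivity
  rw [scale_eq, ← Real.rpow_natCast, ← Real.rpow_mul h.le, ← Real.rpow_add h]
  congr 1
  push_cast
  ring

lemma div_scale_sq (κ σ : ℝ) (i : Fin n) :
    (σ / scale κ i) ^ 2 = σ ^ 2 * ((i : ℝ) + 1) ^ (2 * κ) := by
  have h0 : (0 : ℝ) < (i : ℝ) + 1 := by positivity
  have h2 : (((i : ℝ) + 1) ^ (-κ)) ^ 2 = ((i : ℝ) + 1) ^ (-(2 * κ)) := by
    rw [← Real.rpow_natCast, ← Real.rpow_mul h0.le]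
    congr 1
    push_cast
    ring
  rw [div_pow, scale_eq, h2, Real.rpow_neg h0.le, div_inv_eq_mul]

/-- The weighted second moment of a vector with coordinates `λ i * F i (u i, z i)`. -/
lemma integral_sNorm_sq (hg : RegularPotential g) (κ s : ℝ) {F : Fin n → ℝ × ℝ → ℝ}
    (hF : ∀ i, Integrable (fun w => F i w ^ 2) (coordLaw g)) :
    Integrable (fun w : (Fin n → ℝ) × (Fin n → ℝ) =>
      sNorm s (fromScaled κ n fun i => F i (w.1 i, w.2 i)) ^ 2) (jointLaw g n) ∧
    ∫ w, sNorm s (fromScaled κ n fun i => F i (w.1 i, w.2 i)) ^ 2 ∂(jointLaw g n) =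
      ∑ i : Fin n, ((i : ℝ) + 1) ^ (2 * s - 2 * κ) * ∫ w, F i w ^ 2 ∂(coordLaw g) := by
  have e (w : (Fin n → ℝ) × (Fin n → ℝ)) :
      sNorm s (fromScaled κ n fun i => F i (w.1 i, w.2 i)) ^ 2 =
      ∑ i : Fin n, ((i : ℝ) + 1) ^ (2 * s - 2 * κ) * F i (w.1 i, w.2 i) ^ 2 := by
    rw [sNorm_sq]
    refine Finset.sum_congr rfl fun i _ => ?_
    rw [fromScaled_apply, mul_pow, ← mul_assoc, rpow_mul_scale_sq]
  have hi (i : Fin n) : Integrable (fun w : (Fin n → ℝ) × (Fin n → ℝ) =>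
      F i (w.1 i, w.2 i) ^ 2) (jointLaw g n) :=
    (measurePreserving_coordPair hg i).integrable_comp_of_integrable (hF i)
  simp only [e]
  refine ⟨integrable_finsetSum _ fun i _ => (hi i).const_mul _, ?_⟩
  rw [integral_finsetSum _ fun i _ => (hi i).const_mul _]
  refine Finset.sum_congr rfl fun i _ => ?_
  rw [integral_const_mul]
  congr 1
  have hmp := measurePreserving_coordPair hg i
  have := integral_map (μ := jointLaw g n) hmp.measurable.aemeasurable
    (f := fun w => F i w ^ 2) (by rw [hmp.map_eq]; exact (hF i).aestronglyMeasurable)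
  rw [hmp.map_eq] at this
  exact this.symm

/-- The expectation is the second moment of `f` times `∑ i ^ (2 s - 2 κ)`, and `s < κ - 1 / 2` makes
this bounded in `n`. -/
lemma integral_sNorm_start_sq_le (hg : RegularPotential g) {κ s : ℝ} (hs : s < κ - 1 / 2) :
    ∃ C : ℝ, 0 ≤ C ∧ ∀ n : ℕ,
      Integrable (fun w : (Fin n → ℝ) × (Fin n → ℝ) => sNorm s (fromScaled κ n w.1) ^ 2)
        (jointLaw g n) ∧
      ∫ w, sNorm s (fromScaled κ n w.1) ^ 2 ∂(jointLaw g n) ≤ C := by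
  obtain ⟨S, hS, hb⟩ := exists_sum_rpow_le (show 2 * s - 2 * κ < -1 by linarith)
  have hm : 0 ≤ ∫ w, w.1 ^ 2 ∂(coordLaw g) := integral_nonneg fun w => sq_nonneg _
  refine ⟨S * ∫ w, w.1 ^ 2 ∂(coordLaw g), by positivity, fun n => ?_⟩
  obtain ⟨h1, h2⟩ := integral_sNorm_sq (n := n) hg κ s (F := fun _ w => w.1) fun i =>
    (PolyO.fst.pow 2).integrable hg (fun _ => by fun_prop) one_pos le_rfl
  refine ⟨h1, h2.trans_le ?_⟩
  rw [← Finset.sum_mul]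
  exact mul_le_mul_of_nonneg_right (hb n) hm

lemma polyO_proposal_sub (hg : RegularPotential g) (A : Algorithm) :
    PolyO 1 (fun ε u z => coordProposal A g ε u z - u) := by
  have h1 : PolyO 1 (fun ε _ z => ε * z) := by simpa using PolyO.eps.mul PolyO.snd
  cases A with
  | RWM => exact h1.congr fun ε _ _ u z => by simp only [coordProposal, coordMean]; ring
  | SLA =>
    have h2 : PolyO 2 (fun ε u _ => ε ^ 2 * iteratedDeriv 1 g u) := by
      simpa using (PolyO.eps_pow 2).mul (hg.polyGrowth_iteratedDeriv 1).comp_fst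
    exact (h1.sub ((h2.const_mul (1 / 2)).mono (by norm_num))).congr fun ε _ _ u z => by
      simp only [coordProposal, coordMean]; ring

/-- Coordinate `i` moves by `λ i` times a quantity of order `ε i`, and `ε i ^ 2 = σ ^ 2 * i ^ (2 κ)
≤ σ ^ 2 * n ^ (2 κ)`, in 1-based indexing. The remaining weights are summable as for the start. -/
lemma integral_sNorm_step_sq_le (hg : RegularPotential g) (A : Algorithm) {κ s : ℝ} (hκ : 0 ≤ κ)
    (hs : s < κ - 1 / 2) :
    ∃ C : ℝ, 0 ≤ C ∧ ∀ (n : ℕ) (σ : ℝ), 0 < σ → (∀ i : Fin n, σ / scale κ i ≤ 1) →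
      Integrable (fun w => sNorm s (fromScaled κ n
        (scaledProposal A g (fun i => σ / scale κ i) w) - fromScaled κ n w.1) ^ 2)
        (jointLaw g n) ∧
      ∫ w, sNorm s (fromScaled κ n (scaledProposal A g (fun i => σ / scale κ i) w) -
        fromScaled κ n w.1) ^ 2 ∂(jointLaw g n) ≤ C * (σ ^ 2 * (n : ℝ) ^ (2 * κ)) := by
  obtain ⟨S, hS, hb⟩ := exists_sum_rpow_le (show 2 * s - 2 * κ < -1 by linarith)
  have hF := (polyO_proposal_sub hg A).pow 2
  obtain ⟨C, hC, hd⟩ := hF.abs_integral_le hg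
  refine ⟨S * C, by positivity, fun n σ hσ h1 => ?_⟩
  have hε (i : Fin n) : 0 < σ / scale κ i := div_pos hσ (scale_pos κ i)
  obtain ⟨i1, i2⟩ := integral_sNorm_sq (n := n) hg κ s
    (F := fun i w => coordProposal A g (σ / scale κ i) w.1 w.2 - w.1) fun i =>
    hF.integrable hg (fun ε => by
      have := measurable_coordProposal hg A ε
      fun_prop) (hε i) (h1 i)
  have e (w : (Fin n → ℝ) × (Fin n → ℝ)) :
      fromScaled κ n (scaledProposal A g (fun i => σ / scale κ i) w) - fromScaled κ n w.1 =
      fromScaled κ n fun i => coordProposal A g (σ / scale κ i) (w.1 i) (w.2 i) - w.1 i := by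
    ext i
    simp only [PiLp.sub_apply, fromScaled_apply, scaledProposal]
    ring
  simp only [e]
  refine ⟨i1, i2.trans_le ?_⟩
  calc _ ≤ ∑ i : Fin n, ((i : ℝ) + 1) ^ (2 * s - 2 * κ) * (C * (σ ^ 2 * (n : ℝ) ^ (2 * κ))) := by
        refine Finset.sum_le_sum fun i _ => mul_le_mul_of_nonneg_left ?_ (by positivity)
        refine (le_abs_self _).trans ((hd _ (hε i) (h1 i)).trans ?_)
        refine mul_le_mul_of_nonneg_left ?_ hC
        rw [one_mul, div_scale_sq]
        gcongr
        have := i.2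
        exact_mod_cast this
    _ ≤ _ := by
        rw [← Finset.sum_mul, mul_assoc S]
        exact mul_le_mul_of_nonneg_right (hb n) (by positivity)

end WeightedNorm

/-! ### Negligibility of the change of measure in the log ratio. -/

/-- If `X` or `Y` exceeds `R`, a Markov-type term is already at least `1`. Otherwise `|a| ≤ B * Z`,
and `2 * B * Z ≤ 1 / R + R * B ^ 2 * Z ^ 2` turns this into second moments. -/
lemma min_one_abs_le {a δ B R X Y Z : ℝ} (hR : 0 < R) (hZ : 0 ≤ Z)
    (ha : |a| ≤ δ * Z) (hδ : X ≤ R → Y ≤ R → δ ≤ B) :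
    min 1 |a| ≤ X ^ 2 / R ^ 2 + Y ^ 2 / R ^ 2 + (1 / R + R * B ^ 2 * Z ^ 2) := by
  have hX2 : 0 ≤ X ^ 2 / R ^ 2 := by positivity
  have hY2 : 0 ≤ Y ^ 2 / R ^ 2 := by positivity
  have hR1 : 0 ≤ 1 / R := by positivity
  have hZ2 : 0 ≤ R * B ^ 2 * Z ^ 2 := by positivity
  by_cases h1 : X ≤ R
  · by_cases h2 : Y ≤ R
    · have h3 : |a| ≤ B * Z := ha.trans (mul_le_mul_of_nonneg_right (hδ h1 h2) hZ)
      have h4 : 2 * (B * Z) ≤ 1 / R + R * B ^ 2 * Z ^ 2 := by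
        have e : 1 / R + R * B ^ 2 * Z ^ 2 - 2 * (B * Z) = R * (B * Z - 1 / R) ^ 2 := by
          field_simp
          ring
        have : 0 ≤ R * (B * Z - 1 / R) ^ 2 := by positivity
        linarith
      have h5 := abs_nonneg a
      exact (min_le_right _ _).trans (by linarith)
    · have : 1 ≤ Y ^ 2 / R ^ 2 := by
        rw [one_le_div (by positivity)]
        exact pow_le_pow_left₀ hR.le (le_of_not_ge h2) 2
      exact (min_le_left _ _).trans (by linarith)
  · have : 1 ≤ X ^ 2 / R ^ 2 := by
      rw [one_le_div (by positivity)]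
      exact pow_le_pow_left₀ hR.le (le_of_not_ge h1) 2
    exact (min_le_left _ _).trans (by linarith)

/-- The change of measure does not contribute to the log ratio in the limit. -/
theorem tendsto_integral_min_potentialDiff (hg : RegularPotential g) (A : Algorithm) {κ : ℝ}
    (hκ : 0 ≤ κ) {φ ψ : (n : ℕ) → State n → ℝ}
    (hψ : ∀ n : ℕ, 1 ≤ n → ψ n =ᵐ[refMeasure κ g n] φ n)
    (hgrowth : LocalLipschitzGrowth κ ψ) {σ : ℕ → ℝ} (hσ_pos : ∀ n : ℕ, 1 ≤ n → 0 < σ n)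
    (hσ : Tendsto (fun n => σ n ^ 2 * (n : ℝ) ^ (2 * κ)) atTop (𝓝 0))
    (hε : ∀ᶠ n in atTop, ∀ i : Fin n, σ n / scale κ i ≤ 1) :
    Tendsto (fun n => ∫ w, min 1 |potentialDiff A κ g (σ n) (φ n) w| ∂(jointLaw g n))
      atTop (𝓝 0) := by
  obtain ⟨δ, _, _, s, s', s'', hδ, _, _, hs, hs', _, hlip⟩ := hgrowth
  obtain ⟨C₁, hC₁, hX⟩ := integral_sNorm_start_sq_le hg hs
  obtain ⟨C₂, hC₂, hY⟩ := integral_sNorm_step_sq_le hg A hκ hs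
  obtain ⟨C₃, hC₃, hZ⟩ := integral_sNorm_step_sq_le hg A hκ hs'
  -- `R` is fixed while `n → ∞`, and is made large only afterwards. The factor `3` comes from `X ^ 2
  -- + Y ^ 2 ≤ 3 * X ^ 2 + 2 * |y - x| ^ 2` in the weighted norm.
  have key (R : ℝ) (hR : 0 < R) : ∃ D : ℝ, ∀ᶠ n in atTop,
      ∫ w, min 1 |potentialDiff A κ g (σ n) (φ n) w| ∂(jointLaw g n) ≤
        3 * C₁ / R ^ 2 + 1 / R + D * (σ n ^ 2 * (n : ℝ) ^ (2 * κ)) := by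
    obtain ⟨B, hB⟩ := hδ.2 R
    refine ⟨2 * C₂ / R ^ 2 + R * B ^ 2 * C₃, ?_⟩
    filter_upwards [hlip, hε, eventually_ge_atTop 1] with n hn hε hn1
    have hpj := hg.isProbabilityMeasure_jointLaw n
    have hσn := hσ_pos n hn1
    obtain ⟨iX, bX⟩ := hX n
    obtain ⟨iY, bY⟩ := hY n (σ n) hσn hε
    obtain ⟨iZ, bZ⟩ := hZ n (σ n) hσn hε
    set x : (Fin n → ℝ) × (Fin n → ℝ) → State n := fun w => fromScaled κ n w.1 with hx
    set y : (Fin n → ℝ) × (Fin n → ℝ) → State n := fun w =>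
      fromScaled κ n (scaledProposal A g (fun i => σ n / scale κ i) w) with hy
    have iS : Integrable (fun w => 3 / R ^ 2 * sNorm s (x w) ^ 2 +
        (2 / R ^ 2 * sNorm s (y w - x w) ^ 2 +
          (1 / R + R * B ^ 2 * sNorm s' (y w - x w) ^ 2))) (jointLaw g n) :=
      (iX.const_mul _).add ((iY.const_mul _).add ((integrable_const _).add (iZ.const_mul _)))
    have i3 : Integrable (fun w => 1 / R + R * B ^ 2 * sNorm s' (y w - x w) ^ 2)
      (jointLaw g n) := (integrable_const _).add (iZ.const_mul _)
    have i2 : Integrable (fun w => 2 / R ^ 2 * sNorm s (y w - x w) ^ 2 +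
        (1 / R + R * B ^ 2 * sNorm s' (y w - x w) ^ 2)) (jointLaw g n) :=
      (iY.const_mul _).add i3
    calc _ ≤ ∫ w, (3 / R ^ 2 * sNorm s (x w) ^ 2 + (2 / R ^ 2 * sNorm s (y w - x w) ^ 2 +
          (1 / R + R * B ^ 2 * sNorm s' (y w - x w) ^ 2))) ∂(jointLaw g n) := by
          refine integral_mono_of_nonneg (ae_of_all _ fun w =>
            le_min zero_le_one (abs_nonneg _)) iS ?_
          filter_upwards [ae_jointLaw_start hg κ (hψ n hn1),
            ae_jointLaw_proposal hg A κ hσn (hψ n hn1)] with w hw1 hw2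
          have h1 : |potentialDiff A κ g (σ n) (φ n) w| ≤
              δ (sNorm s (x w)) (sNorm s (y w)) * sNorm s' (y w - x w) := by
            rw [potentialDiff, ← hw1, ← hw2, abs_sub_comm]
            exact hn.1 _ _
          have h2 := min_one_abs_le hR (sNorm_nonneg s' _) h1 (B := B) fun ha hb =>
              hB _ ⟨sNorm_nonneg s _, ha⟩ _ ⟨sNorm_nonneg s _, hb⟩
          have h3 := div_le_div_of_nonneg_right (sNorm_sq_le s (x w) (y w))
            (by positivity : 0 ≤ R ^ 2)
          refine h2.trans ((add_le_add_left (add_le_add_right h3 _) _).trans (le_of_eq ?_))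
          ring
      _ = 3 / R ^ 2 * ∫ w, sNorm s (x w) ^ 2 ∂(jointLaw g n) +
          (2 / R ^ 2 * ∫ w, sNorm s (y w - x w) ^ 2 ∂(jointLaw g n) +
          (1 / R + R * B ^ 2 * ∫ w, sNorm s' (y w - x w) ^ 2 ∂(jointLaw g n))) := by
          rw [integral_add (iX.const_mul _) i2, integral_add (iY.const_mul _) i3,
            integral_add (integrable_const _) (iZ.const_mul _), integral_const_mul,
            integral_const_mul, integral_const_mul, integral_const, probReal_univ, one_smul]
      _ ≤ 3 / R ^ 2 * C₁ + (2 / R ^ 2 * (C₂ * (σ n ^ 2 * (n : ℝ) ^ (2 * κ))) +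
          (1 / R + R * B ^ 2 * (C₃ * (σ n ^ 2 * (n : ℝ) ^ (2 * κ))))) := by
          gcongr
      _ = _ := by ring
  have hR0 : Tendsto (fun R : ℝ => 3 * C₁ / R ^ 2 + 1 / R) atTop (𝓝 0) := by
    have h1 : Tendsto (fun R : ℝ => 3 * C₁ / R ^ 2) atTop (𝓝 0) :=
      tendsto_const_nhds.div_atTop (tendsto_pow_atTop two_ne_zero)
    have h2 : Tendsto (fun R : ℝ => 1 / R) atTop (𝓝 0) :=
      tendsto_const_nhds.div_atTop tendsto_id
    simpa using h1.add h2
  refine tendsto_order.2 ⟨fun a ha => Eventually.of_forall fun n => ha.trans_le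
    (integral_nonneg fun w => le_min zero_le_one (abs_nonneg _)), fun a ha => ?_⟩
  obtain ⟨R, hRa, hR⟩ := ((hR0.eventually (gt_mem_nhds (half_pos ha))).and
    (eventually_gt_atTop 0)).exists
  obtain ⟨D, hD⟩ := key R hR
  have h0 : Tendsto (fun n => D * (σ n ^ 2 * (n : ℝ) ^ (2 * κ))) atTop (𝓝 0) := by
    simpa using hσ.const_mul D
  filter_upwards [hD, h0.eventually (gt_mem_nhds (half_pos ha))] with n h1 h2
  linarith

/-! ### Asymptotics of the sums of powers of the steps. -/

/-- The sum lies between `∫ x ^ a` over `[0, n]` and that integral plus the last term `n ^ a`. -/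
lemma tendsto_sum_rpow_div {a : ℝ} (ha : 0 ≤ a) :
    Tendsto (fun n : ℕ => (∑ i : Fin n, ((i : ℝ) + 1) ^ a) / (n : ℝ) ^ (a + 1)) atTop
      (𝓝 (1 / (a + 1))) := by
  have hmono (n : ℕ) : MonotoneOn (fun x : ℝ => x ^ a) (Set.Icc 0 (0 + (n : ℝ))) :=
    fun x hx y _ hxy => Real.rpow_le_rpow hx.1 hxy ha
  have hint (n : ℕ) : ∫ x in (0 : ℝ)..0 + (n : ℝ), x ^ a = (n : ℝ) ^ (a + 1) / (a + 1) := by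
    rw [integral_rpow (Or.inl (by linarith)), Real.zero_rpow (by linarith), zero_add, sub_zero]
  have hlow (n : ℕ) : (n : ℝ) ^ (a + 1) / (a + 1) ≤ ∑ i : Fin n, ((i : ℝ) + 1) ^ a := by
    have := (hmono n).integral_le_sum
    rw [hint] at this
    rw [Fin.sum_univ_eq_sum_range (fun i => ((i : ℝ) + 1) ^ a) n]
    simpa using this
  have hupp (n : ℕ) :
      ∑ i : Fin n, ((i : ℝ) + 1) ^ a ≤ (n : ℝ) ^ (a + 1) / (a + 1) + (n : ℝ) ^ a := by
    have := (hmono n).sum_le_integral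
    rw [hint] at this
    rw [Fin.sum_univ_eq_sum_range (fun i => ((i : ℝ) + 1) ^ a) n]
    have e := (Finset.sum_range_succ (fun i : ℕ => (i : ℝ) ^ a) n).symm.trans
      (Finset.sum_range_succ' (fun i : ℕ => (i : ℝ) ^ a) n)
    have h0 : (0 : ℝ) ≤ ((0 : ℕ) : ℝ) ^ a := by positivity
    simp only [zero_add, Nat.cast_add, Nat.cast_one] at this e
    linarith
  have hlim : Tendsto (fun n : ℕ => 1 / (a + 1) + 1 / (n : ℝ)) atTop (𝓝 (1 / (a + 1))) := by
    simpa using tendsto_const_nhds.add (tendsto_one_div_atTop_nhds_zero_nat (𝕜 := ℝ))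
  refine tendsto_of_tendsto_of_tendsto_of_le_of_le' tendsto_const_nhds hlim ?_ ?_
  · filter_upwards [eventually_gt_atTop 0] with n hn
    have hn' : (0 : ℝ) < n := by exact_mod_cast hn
    rw [le_div_iff₀ (by positivity)]
    exact le_trans (le_of_eq (by ring)) (hlow n)
  · filter_upwards [eventually_gt_atTop 0] with n hn
    have hn' : (0 : ℝ) < n := by exact_mod_cast hn
    have hna : (n : ℝ) ^ (a + 1) = (n : ℝ) ^ a * n := Real.rpow_add_one hn'.ne' a
    rw [div_le_iff₀ (by positivity)]
    refine (hupp n).trans (le_of_eq ?_)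
    rw [hna]
    field_simp

section StepSize

variable {κ l ρ s : ℝ} {n : ℕ}

lemma div_scale_le (hκ : 0 ≤ κ) (hl : 0 < l) (hn : 1 ≤ n)
    (hs : s ^ 2 = l ^ 2 * (n : ℝ) ^ (-ρ)) (i : Fin n) :
    s / scale κ i ≤ l * (n : ℝ) ^ (κ - ρ / 2) := by
  have hn' : (0 : ℝ) < n := by exact_mod_cast hn
  refine le_of_sq_le_sq ?_ (by positivity)
  have e : (l * (n : ℝ) ^ (κ - ρ / 2)) ^ 2 = s ^ 2 * (n : ℝ) ^ (2 * κ) := by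
    rw [hs, mul_pow, ← Real.rpow_natCast ((n : ℝ) ^ _), ← Real.rpow_mul hn'.le, mul_assoc,
      ← Real.rpow_add hn']
    congr 2
    push_cast
    ring
  rw [e, div_scale_sq]
  gcongr
  exact_mod_cast i.2

/-- The last factor converges, so the power of `n` in front decides the regime: its exponent `2 κ k
+ 1 - ρ k` vanishes exactly at `ρ = 2 κ + 1 / k`. -/
lemma sum_div_scale_pow (k : ℕ) (hn : 1 ≤ n) (hs : s ^ 2 = l ^ 2 * (n : ℝ) ^ (-ρ)) :
    ∑ i : Fin n, (s / scale κ i) ^ (2 * k) =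
      l ^ (2 * k) * (n : ℝ) ^ (2 * κ * k + 1 - ρ * k) *
        ((∑ i : Fin n, ((i : ℝ) + 1) ^ (2 * κ * k)) / (n : ℝ) ^ (2 * κ * k + 1)) := by
  have hn' : (0 : ℝ) < n := by exact_mod_cast hn
  have h (i : Fin n) : (s / scale κ i) ^ (2 * k) =
      l ^ (2 * k) * (n : ℝ) ^ (-(ρ * k)) * ((i : ℝ) + 1) ^ (2 * κ * k) := by
    rw [pow_mul, div_scale_sq, hs, mul_pow, mul_pow, ← pow_mul,
      ← Real.rpow_natCast ((n : ℝ) ^ _), ← Real.rpow_natCast (((i : ℝ) + 1) ^ _),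
      ← Real.rpow_mul hn'.le, ← Real.rpow_mul (by positivity), neg_mul]
  simp only [h, ← Finset.mul_sum]
  rw [sub_eq_add_neg, Real.rpow_add hn']
  have := Real.rpow_pos_of_pos hn' (2 * κ * k + 1)
  field_simp

lemma sum_pow_succ_le {e : ℝ} {ε : Fin n → ℝ} (h0 : ∀ i, 0 ≤ ε i) (he : ∀ i, ε i ≤ e) (k : ℕ) :
    ∑ i, ε i ^ (k + 1) ≤ e * ∑ i, ε i ^ k := by
  rw [Finset.mul_sum]
  refine Finset.sum_le_sum fun i _ => ?_
  rw [pow_succ, mul_comm]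
  exact mul_le_mul_of_nonneg_right (he i) (pow_nonneg (h0 i) k)

end StepSize

lemma tendsto_natCast_rpow_zero {a : ℝ} (ha : a < 0) :
    Tendsto (fun n : ℕ => (n : ℝ) ^ a) atTop (𝓝 0) := by
  have := (tendsto_rpow_neg_atTop (neg_pos.2 ha)).comp
    (tendsto_natCast_atTop_atTop (R := ℝ))
  simpa only [neg_neg, Function.comp_def] using this

lemma two_mul_cdf_gaussianReal_zero : 2 * cdf (gaussianReal 0 1) 0 = 1 := by
  simpa using (integral_min_one_exp_gaussian 0 le_rfl).symm

lemma scalingIndex_mul_order (A : Algorithm) : scalingIndex A * order A = 1 := by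
  cases A <;> simp [scalingIndex, order]

lemma meanAcceptProb_nonneg (A : Algorithm) (κ : ℝ) (g : ℝ → ℝ) {σ : ℝ} {n : ℕ}
    (φ : State n → ℝ) : 0 ≤ meanAcceptProb A κ g σ φ := by
  refine integral_nonneg fun w => ?_
  unfold acceptProb
  split_ifs with h
  · refine le_min zero_le_one (div_nonneg (mul_nonneg (mul_nonneg (Real.exp_nonneg _) ?_) ?_) h.le)
    · exact Finset.prod_nonneg fun i _ => by
        have := scale_pos κ i
        positivity
    · unfold proposalDensity
      positivity
  · exact le_rfl

/-- Puts both algorithms in one form: `l ^ k` comes out of the square root, and `2 κ k + 1` is `1 +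
2 κ` for `k = 1` and `1 + 6 κ` for `k = 3`. -/
lemma limitAccept_eq (A : Algorithm) {κ l : ℝ} (g : ℝ → ℝ) (hl : 0 < l) :
    limitAccept A κ g l = 2 * cdf (gaussianReal 0 1) (-(√(limitConst A g *
      (l ^ (2 * order A) * (1 / (2 * κ * order A + 1)))) / 2)) := by
  have h (k : ℕ) (K c : ℝ) : √(K * (l ^ (2 * k) * (1 / c))) = l ^ k * √(K / c) := by
    rw [show K * (l ^ (2 * k) * (1 / c)) = (l ^ k) ^ 2 * (K / c) by ring,
      Real.sqrt_mul (by positivity), Real.sqrt_sq (by positivity)]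
  rw [h]
  cases A
  · simp only [limitAccept, order, Nat.cast_one, mul_one, pow_one, add_comm (2 * κ) 1]
    congr 2
    ring
  · simp only [limitAccept, order, Nat.cast_ofNat,
      show 2 * κ * 3 + 1 = 1 + 6 * κ by ring]
    congr 2
    ring

/-! ### The three regimes. -/

section Limits

variable {κ l ρ : ℝ} {φ ψ : (n : ℕ) → State n → ℝ} {σ : ℕ → ℝ}

lemma eventually_div_scale_le_one (hκ : 0 ≤ κ) (hl : 0 < l)
    (hσ : ∀ n : ℕ, 1 ≤ n → σ n ^ 2 = l ^ 2 * (n : ℝ) ^ (-ρ)) (h : 2 * κ < ρ) :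
    ∀ᶠ n : ℕ in atTop, ∀ i : Fin n, σ n / scale κ i ≤ 1 := by
  have h0 := (tendsto_natCast_rpow_zero (show κ - ρ / 2 < 0 by linarith)).const_mul l
  rw [mul_zero] at h0
  filter_upwards [h0.eventually (ge_mem_nhds one_pos), eventually_ge_atTop 1] with n h1 hn i
  exact (div_scale_le hκ hl hn (hσ n hn) i).trans h1

/-- The limit of the mean acceptance probability, as a function of the limit of
`∑ i, (σ n / λ i) ^ (2 * order A)`. -/
theorem tendsto_meanAcceptProb (hg : RegularPotential g) (A : Algorithm) (hκ : 0 ≤ κ)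
    (hφ : ∀ n : ℕ, 1 ≤ n → Measurable (φ n))
    (hprob : ∀ n : ℕ, 1 ≤ n → IsProbabilityMeasure (targetMeasure κ g (φ n)))
    (hψ : ∀ n : ℕ, 1 ≤ n → ψ n =ᵐ[refMeasure κ g n] φ n) (hbelow : BoundedBelow ψ)
    (hgrowth : LocalLipschitzGrowth κ ψ) (hl : 0 < l) (hσ_pos : ∀ n : ℕ, 1 ≤ n → 0 < σ n)
    (hσ : ∀ n : ℕ, 1 ≤ n → σ n ^ 2 = l ^ 2 * (n : ℝ) ^ (-ρ)) (hρ : 2 * κ < ρ) {θ : ℝ}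
    (hθ : 0 ≤ θ) (hsum : Tendsto (fun n => ∑ i : Fin n, (σ n / scale κ i) ^ (2 * order A))
      atTop (𝓝 θ)) :
    Tendsto (fun n => meanAcceptProb A κ g (σ n) (φ n)) atTop
      (𝓝 (2 * cdf (gaussianReal 0 1) (-(√(limitConst A g * θ) / 2)))) := by
  obtain ⟨M, hM⟩ := hbelow
  have hε1 := eventually_div_scale_le_one hκ hl hσ hρ
  obtain ⟨N, hN⟩ := eventually_atTop.1 (hM.and (hε1.and (eventually_ge_atTop 1)))
  have hσ0 : Tendsto (fun n => σ n ^ 2 * (n : ℝ) ^ (2 * κ)) atTop (𝓝 0) := by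
    have h0 := (tendsto_natCast_rpow_zero (show 2 * κ - ρ < 0 by linarith)).const_mul (l ^ 2)
    rw [mul_zero] at h0
    refine h0.congr' ?_
    filter_upwards [eventually_ge_atTop 1] with n hn
    have hn' : (0 : ℝ) < n := by exact_mod_cast hn
    rw [hσ n hn, mul_assoc, ← Real.rpow_add hn']
    congr 2
    ring
  have hD := tendsto_integral_min_potentialDiff hg A hκ hψ hgrowth hσ_pos hσ0 hε1
  have hsum' : Tendsto (fun n => ∑ i : Fin n, (σ n / scale κ i) ^ (2 * order A + 1)) atTop
      (𝓝 0) := by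
    -- The sum of one higher power is at most the largest step times the main sum: the first tends
    -- to `0` and the second to `θ`.
    have h0 := ((tendsto_natCast_rpow_zero (show κ - ρ / 2 < 0 by linarith)).const_mul l).mul hsum
    rw [mul_zero, zero_mul] at h0
    refine tendsto_of_tendsto_of_tendsto_of_le_of_le' tendsto_const_nhds h0 ?_ ?_
    · filter_upwards [eventually_ge_atTop 1] with n hn
      exact Finset.sum_nonneg fun i _ =>
        pow_nonneg (div_pos (hσ_pos n hn) (scale_pos κ i)).le _
    · filter_upwards [eventually_ge_atTop 1] with n hn
      exact sum_pow_succ_le (fun i => (div_pos (hσ_pos n hn) (scale_pos κ i)).le)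
        (div_scale_le hκ hl hn (hσ n hn)) _
  -- The bounds on `ψ` and on the steps hold only from `N` on; the shifted sequence satisfies them
  -- for every index.
  rw [← tendsto_add_atTop_iff_nat N]
  have hN' (m : ℕ) := hN (m + N) (Nat.le_add_left N m)
  have h1 (m : ℕ) : 1 ≤ m + N := (hN' m).2.2
  have key := tendsto_integral_accept hg A (d := fun m => m + N)
    (ε := fun m i => σ (m + N) / scale κ i)
    (fun m i => ⟨div_pos (hσ_pos _ (h1 m)) (scale_pos κ i), (hN' m).2.1 i⟩) hθ
    (hsum.comp (tendsto_add_atTop_nat N)) (hsum'.comp (tendsto_add_atTop_nat N))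
    (h := fun m => scaledDensity κ (φ (m + N)))
    (fun m => ((hφ _ (h1 m)).comp (fromScaled κ (m + N)).measurable).neg.exp)
    (fun m u => Real.exp_nonneg _) (Real.exp_nonneg (-M))
    (fun m => by
      have hae := hψ _ (h1 m)
      rw [refMeasure_eq_map hg] at hae
      filter_upwards [ae_of_ae_map (fromScaled κ (m + N)).measurable.aemeasurable hae] with u hu
      rw [scaledDensity, ← hu]
      exact Real.exp_le_exp.2 (neg_le_neg ((hN' m).1 _)))
    (fun m => integral_scaledDensity hg κ (hφ _ (h1 m)) (hprob _ (h1 m)))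
    (D := fun m => potentialDiff A κ g (σ (m + N)) (φ (m + N)))
    (fun m => measurable_potentialDiff hg A κ _ (hφ _ (h1 m)))
    (hD.comp (tendsto_add_atTop_nat N))
  exact key.congr fun m => (meanAcceptProb_eq hg A κ (hσ_pos _ (h1 m)) (hφ _ (h1 m))).symm

/-- Below the critical exponent the mean acceptance probability decays faster than any power. -/
theorem tendsto_rpow_mul_meanAcceptProb (hg : RegularPotential g) (A : Algorithm) (hκ : 0 ≤ κ)
    (hφ : ∀ n : ℕ, 1 ≤ n → Measurable (φ n))
    (hψ : ∀ n : ℕ, 1 ≤ n → ψ n =ᵐ[refMeasure κ g n] φ n) (hbelow : BoundedBelow ψ)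
    (hl : 0 < l) (hσ_pos : ∀ n : ℕ, 1 ≤ n → 0 < σ n)
    (hσ : ∀ n : ℕ, 1 ≤ n → σ n ^ 2 = l ^ 2 * (n : ℝ) ^ (-ρ)) (hρ : 2 * κ < ρ)
    (hρ' : ρ * order A < 2 * κ * order A + 1) (p : ℝ) :
    Tendsto (fun n : ℕ => (n : ℝ) ^ p * meanAcceptProb A κ g (σ n) (φ n)) atTop (𝓝 0) := by
  obtain ⟨M, hM⟩ := hbelow
  obtain ⟨C, hC, hacc⟩ := integral_accept_le hg A
  have hK := limitConst_pos hg A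
  set K := limitConst A g with hKdef
  set k := order A with hk
  set a := 2 * κ * k with ha
  have ha0 : 0 ≤ a := by positivity
  set η := a + 1 - ρ * k with hη
  have hη0 : 0 < η := by linarith
  -- Half of the rate `K / 32` is kept and the other half absorbs the higher-order sum once the
  -- steps are small; `1 / (2 * (a + 1))` is half the limit of the normalised power sum.
  set c := K / 64 * (l ^ (2 * k) * (1 / (2 * (a + 1)))) with hc
  have hc0 : 0 < c := by positivity
  have hε1 := eventually_div_scale_le_one hκ hl hσ hρ
  have hsmall := ((tendsto_natCast_rpow_zero (show κ - ρ / 2 < 0 by linarith)).const_mul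
    (C * l)).eventually (ge_mem_nhds (show C * l * 0 < K / 64 by rw [mul_zero]; positivity))
  have hratio := (tendsto_sum_rpow_div ha0).eventually
    (le_mem_nhds (show 1 / (2 * (a + 1)) < 1 / (a + 1) from
      one_div_lt_one_div_of_lt (by positivity) (by linarith)))
  have hbound : ∀ᶠ n : ℕ in atTop, (n : ℝ) ^ p * meanAcceptProb A κ g (σ n) (φ n) ≤
      Real.exp (-M) * ((n : ℝ) ^ p * Real.exp (-c * (n : ℝ) ^ η)) := by
    filter_upwards [hM, hε1, hsmall, hratio, eventually_ge_atTop 1] with n hMn h1 h2 h3 hn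
    have hn' : (0 : ℝ) < n := by exact_mod_cast hn
    have hpos (i : Fin n) : 0 < σ n / scale κ i := div_pos (hσ_pos n hn) (scale_pos κ i)
    have hS0 : 0 ≤ ∑ i : Fin n, (σ n / scale κ i) ^ (2 * k) :=
      Finset.sum_nonneg fun i _ => pow_nonneg (hpos i).le _
    have hexp : c * (n : ℝ) ^ η ≤ K / 32 * ∑ i : Fin n, (σ n / scale κ i) ^ (2 * k) -
        C * ∑ i : Fin n, (σ n / scale κ i) ^ (2 * k + 1) := by
      have e1 := mul_le_mul_of_nonneg_left (sum_pow_succ_le (fun i => (hpos i).le)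
        (div_scale_le hκ hl hn (hσ n hn)) (2 * k)) hC
      have e2 := mul_le_mul_of_nonneg_right h2 hS0
      have e3 : c * (n : ℝ) ^ η ≤ K / 64 * ∑ i : Fin n, (σ n / scale κ i) ^ (2 * k) := by
        rw [sum_div_scale_pow k hn (hσ n hn), hc, mul_assoc (K / 64)]
        refine mul_le_mul_of_nonneg_left ?_ (by positivity)
        rw [mul_right_comm]
        exact mul_le_mul_of_nonneg_left h3 (by positivity)
      linarith
    have hE := hacc n (fun i => σ n / scale κ i) (fun i => ⟨hpos i, h1 i⟩)
      (fun u => φ n (fromScaled κ n u))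
      (fun w => φ n (fromScaled κ n (scaledProposal A g (fun i => σ n / scale κ i) w))) M
      (by
        filter_upwards [ae_jointLaw_start hg κ (hψ n hn)] with w hw
        exact (hMn _).trans_eq hw)
      (by
        filter_upwards [ae_jointLaw_proposal hg A κ (hσ_pos n hn) (hψ n hn)] with w hw
        exact (hMn _).trans_eq hw)
    have hmean : meanAcceptProb A κ g (σ n) (φ n) ≤
        Real.exp (-M) * Real.exp (-c * (n : ℝ) ^ η) := by
      rw [meanAcceptProb_eq hg A κ (hσ_pos n hn) (hφ n hn)]
      refine hE.trans (mul_le_mul_of_nonneg_left (Real.exp_le_exp.2 ?_) (Real.exp_nonneg _))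
      linarith
    calc _ ≤ (n : ℝ) ^ p * (Real.exp (-M) * Real.exp (-c * (n : ℝ) ^ η)) :=
          mul_le_mul_of_nonneg_left hmean (by positivity)
      _ = _ := by ring
  have hlim : Tendsto (fun n : ℕ => Real.exp (-M) *
      ((n : ℝ) ^ p * Real.exp (-c * (n : ℝ) ^ η))) atTop (𝓝 0) := by
    -- In the variable `n ^ η`, the factor `n ^ p` is the power `p / η`, which the exponential
    -- dominates.
    have h1 := (tendsto_rpow_mul_exp_neg_mul_atTop_nhds_zero (p / η) c hc0).comp
      ((tendsto_rpow_atTop hη0).comp tendsto_natCast_atTop_atTop)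
    have h2 := h1.const_mul (Real.exp (-M))
    rw [mul_zero] at h2
    refine h2.congr fun n => ?_
    simp only [Function.comp_apply]
    rw [← Real.rpow_mul (Nat.cast_nonneg n), mul_div_cancel₀ _ hη0.ne']
  exact tendsto_of_tendsto_of_tendsto_of_le_of_le' tendsto_const_nhds hlim
    (Eventually.of_forall fun n =>
      mul_nonneg (by positivity) (meanAcceptProb_nonneg A κ g (φ n))) hbound

end Limits

end LocalMCMC
theorem theorem3
    (A : LocalMCMC.Algorithm) (κ : ℝ) (hκ : 0 ≤ κ)
    (g : ℝ → ℝ) (hg : LocalMCMC.RegularPotential g)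
    (φ : (n : ℕ) → LocalMCMC.State n → ℝ)
    (hφ : ∀ n : ℕ, 1 ≤ n → Measurable (φ n))
    (hprob : ∀ n : ℕ, 1 ≤ n → IsProbabilityMeasure (LocalMCMC.targetMeasure κ g (φ n)))
    (ψ : (n : ℕ) → LocalMCMC.State n → ℝ)
    (hψ : ∀ n : ℕ, 1 ≤ n → ψ n =ᵐ[LocalMCMC.refMeasure κ g n] φ n)
    (hbelow : LocalMCMC.BoundedBelow ψ)
    (hgrowth : LocalMCMC.LocalLipschitzGrowth κ ψ)
    (l ρ : ℝ) (hl : 0 < l) (hρ : 0 < ρ)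
    (σ : ℕ → ℝ) (hσ_pos : ∀ n : ℕ, 1 ≤ n → 0 < σ n)
    (hσ : ∀ n : ℕ, 1 ≤ n → σ n ^ 2 = l ^ 2 * (n : ℝ) ^ (-ρ)) :
    (ρ = 2 * κ + LocalMCMC.scalingIndex A →
      0 < LocalMCMC.limitConst A g ∧
      Tendsto (fun n : ℕ => LocalMCMC.meanAcceptProb A κ g (σ n) (φ n)) atTop
        (𝓝 (LocalMCMC.limitAccept A κ g l))) ∧
    (2 * κ + LocalMCMC.scalingIndex A < ρ →
      Tendsto (fun n : ℕ => LocalMCMC.meanAcceptProb A κ g (σ n) (φ n)) atTop (𝓝 1)) ∧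
    (2 * κ < ρ → ρ < 2 * κ + LocalMCMC.scalingIndex A →
      ∀ p : ℝ, 0 ≤ p →
        Tendsto (fun n : ℕ => (n : ℝ) ^ p * LocalMCMC.meanAcceptProb A κ g (σ n) (φ n)) atTop
          (𝓝 0)) := by
  have hord := LocalMCMC.scalingIndex_mul_order A
  have hord1 : (1 : ℝ) ≤ LocalMCMC.order A := by exact_mod_cast LocalMCMC.one_le_order A
  have hI : 0 < LocalMCMC.scalingIndex A := by
    by_contra h
    nlinarith
  have ha0 : 0 ≤ 2 * κ * LocalMCMC.order A := by positivity
  -- `r` is `1` at the critical exponent and `0` above it.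
  have hsum {r : ℝ} (hr : Tendsto (fun n : ℕ => (n : ℝ) ^
      (2 * κ * LocalMCMC.order A + 1 - ρ * LocalMCMC.order A)) atTop (𝓝 r)) :
      Tendsto (fun n => ∑ i : Fin n, (σ n / LocalMCMC.scale κ i) ^ (2 * LocalMCMC.order A)) atTop
        (𝓝 (l ^ (2 * LocalMCMC.order A) * r * (1 / (2 * κ * LocalMCMC.order A + 1)))) := by
    refine ((hr.const_mul _).mul (LocalMCMC.tendsto_sum_rpow_div ha0)).congr' ?_
    filter_upwards [eventually_ge_atTop 1] with n hn
    exact (LocalMCMC.sum_div_scale_pow _ hn (hσ n hn)).symm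
  refine ⟨fun h => ⟨LocalMCMC.limitConst_pos hg A, ?_⟩, fun h => ?_, fun h h' p _ => ?_⟩
  · have h0 : 2 * κ * LocalMCMC.order A + 1 - ρ * LocalMCMC.order A = 0 := by
      rw [h, add_mul, hord]
      ring
    have hs := hsum (r := 1) (by simp only [h0, Real.rpow_zero]; exact tendsto_const_nhds)
    rw [mul_one] at hs
    rw [LocalMCMC.limitAccept_eq A g hl]
    exact LocalMCMC.tendsto_meanAcceptProb hg A hκ hφ hprob hψ hbelow hgrowth hl hσ_pos hσ
      (by linarith) (by positivity) hs
  · have h0 : 2 * κ * LocalMCMC.order A + 1 - ρ * LocalMCMC.order A < 0 := by nlinarith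
    have hs := hsum (LocalMCMC.tendsto_natCast_rpow_zero h0)
    rw [mul_zero, zero_mul] at hs
    -- With `θ = 0` the limiting normal law degenerates and the limit is `2 Φ(0) = 1`.
    have := LocalMCMC.tendsto_meanAcceptProb hg A hκ hφ hprob hψ hbelow hgrowth hl hσ_pos hσ
      (by linarith) le_rfl hs
    rwa [mul_zero, Real.sqrt_zero, zero_div, neg_zero,
      LocalMCMC.two_mul_cdf_gaussianReal_zero] at this
  · exact LocalMCMC.tendsto_rpow_mul_meanAcceptProb hg A hκ hφ hψ hbelow hl hσ_pos hσ h
      (by nlinarith) p
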